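/- Let $D$ be a compact metric space with a finite Borel measure $\lambda$, let $\mu>0$, let $C=\{R,B\}$ (red, blue), and let $\bar\lambda=\lambda\otimes(\text{counting measure on }C)$. For $x=(p,c)\in D\times C$ let $N(x)=\{q\in D: d(p,q)<1\}\times\{\bar c\}$, where $\bar c$ is the colour opposite to $c$, and let $N(A)=\bigcup_{x\in A}N(x)$. A finite family $A$ of particles is \emph{valid} if $A\cap N(A)=\emptyset$. For a finite family $x_1,\dots,x_n$ in $D\times C$ put $$\tilde\Pi(x_1,\dots,x_n)=\sum_{(X_1,\dots,X_n)}\ \prod_{k=1}^n\frac{1}{\bar\lambda(N(\{X_1,\dots,X_k\}))+k\mu},$$ where the sum is over all $n!$ orderings of the family. The first-in-first-match process is the Markov jump process $(\eta_t)_{t\ge0}$ on the finite lists $\gamma=(x_1,\dots,x_n)$ of elements of $D\times C$ with generator $$Lf(\gamma)=\sum_{i=1}^n\big(\mu+\bar\lambda(N(x_i)\setminus N(\{x_1,\dots,x_{i-1}\}))\big)\,[f(\gamma\setminus x_i)-f(\gamma)]+\int_{(D\times C)\setminus N(\gamma)}[f(\gamma,y)-f(\gamma)]\,\bar\lambda(dy)$$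 (understood as a solution of the martingale problem for $L$ and the bounded measurable functions $f$ for which there is an $m$ such that $f$ vanishes on all lists of length greater than $m$). Let $(\eta_t)$ be such a process whose law at time $t$ does not depend on $t$, and let $\tilde\eta=(\tilde\eta^R,\tilde\eta^B)$ be the configuration $\eta_t$ with its order forgotten, $\tilde\eta^R$ and $\tilde\eta^B$ being regarded as finite counting measures on $D$. Order configurations by $\xi\ge\gamma$ iff $\xi^R\supseteq\gamma^R$ and $\xi^B\subseteq\gamma^B$ (inclusion with multiplicity, i.e. inequality of counting measures). Then: 1. (FKG lattice inequality) For all finite subsets $\xi=(\xi^R,\xi^B)$ and $\gamma=(\gamma^R,\gamma^B)$ of $D\times C$, $$\tilde\Pi(\xi\vee\gamma)\,\tilde\Pi(\xi\wedge\gamma)\ge\tilde\Pi(\xi)\,\tilde\Pi(\gamma),$$ where $\xi\vee\gamma=(\xi^R\cup\gamma^R,\ \xi^B\cap\gamma^B)$ and $\xi\wedge\gamma=(\xi^R\cap\gamma^R,\ \xi^B\cup\gamma^B)$. 2. $\tilde\Pi$ is the unnormalized Janossy density of $\tilde\eta$: there is a constant $K>0$ such that for every measurable $F\ge0$, $$\mathbb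 E F(\tilde\eta)=\sum_{n\ge0}\frac1{n!}\int_{(D\times C)^n}K\,\mathbf 1(x_1,\dots,x_n\text{ valid})\,\tilde\Pi(x_1,\dots,x_n)\,F(\{x_1,\dots,x_n\})\,\bar\lambda(dx_1)\cdots\bar\lambda(dx_n).$$ 3. (Positive association) $\mathbb E[f(\tilde\eta)g(\tilde\eta)]\ge\mathbb E f(\tilde\eta)\,\mathbb E g(\tilde\eta)$ for all measurable $f,g$ that are increasing in the above order and for which $f(\tilde\eta)$, $g(\tilde\eta)$ and $f(\tilde\eta)g(\tilde\eta)$ are integrable. 4. For each colour $c\in C$, the point process $\tilde\eta^c$ on $D$ is positively associated (the inequality of part 3 for functions of $\tilde\eta^c$ that are increasing in the usual order of counting measures), and it is weakly super-Poissonian: its mean measure is finite, $\mathbb E\prod_{i=1}^k\tilde\eta^c(B_i)\ge\prod_{i=1}^k\mathbb E\,\tilde\eta^c(B_i)$ for all pairwise disjoint Borel sets $B_1,\dots,B_k\subseteq D$, and $\mathbb P(\tilde\eta^c(B)=0)\ge e^{-\mathbb E\,\tilde\eta^c(B)}$ for every Borel set $B\subseteq D$. -/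

import Mathlib

open MeasureTheory ProbabilityTheory Set
open scoped ENNReal NNReal

noncomputable section

namespace FIFM

/-- The two colours; `true` is red and `false` is blue, so that `!c` is the opposite colour. -/
abbrev Color : Type := Bool

/-- Red. -/
abbrev red : Color := true

/-- Blue. -/
abbrev blue : Color := false

/-- A coloured particle: a location in `D` and a colour. -/
abbrev Particle (D : Type*) : Type _ := D × Color

/-- Finite ordered configurations `(x₁, …, xₙ)`, listed in order of arrival, i.e. the disjoint union
over `n` of `(D × C)ⁿ`. -/
abbrev Config (D : Type*) : Type _ := Σ n : ℕ, Fin n → Particle D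

section Geometry

variable {D : Type*} [MetricSpace D]

/-- `N(x)`: the particles of the opposite colour at distance less than one from `x`. -/
def nbhd (x : Particle D) : Set (Particle D) := Metric.ball x.1 1 ×ˢ {!x.2}

/-- A family of particles is valid if it contains no two particles that could be matched. -/
def Valid {ι : Type*} (x : ι → Particle D) : Prop := ∀ i j, x i ∉ nbhd (x j)

/-- `W`: the arrivals that would be matched to the `i`-th particle of `γ`, i.e. the particles
in `N(xᵢ)` that do not lie in `N(xⱼ)` for an earlier `j`. -/
def priorityRegion (γ : Config D) (i : Fin γ.1) : Set (Particle D) :=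
  nbhd (γ.2 i) \ ⋃ j : Fin γ.1, ⋃ _ : j < i, nbhd (γ.2 j)

/-- Remove the `i`-th particle, keeping the order of the others. -/
def remove {D : Type*} : (γ : Config D) → Fin γ.1 → Config D
  | ⟨0, _⟩, i => i.elim0
  | ⟨n + 1, x⟩, i => ⟨n, i.removeNth x⟩

/-- Add a particle at the end of the list. -/
def append {D : Type*} (γ : Config D) (y : Particle D) : Config D :=
  ⟨γ.1 + 1, Fin.snoc (α := fun _ => Particle D) γ.2 y⟩

variable [MeasurableSpace D]

/-- `λ ⊗ (counting measure on colours)`. -/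
def lamBar (lam : Measure D) : Measure (Particle D) := lam.prod Measure.count

/-- The generator of the first-in-first-match process: particle `i` leaves at rate
`μ + λ̄(Wᵢ)` (loss of patience or match), and an arrival that finds no partner is appended. -/
def generator (lam : Measure D) (mu : ℝ) (f : Config D → ℝ) (γ : Config D) : ℝ :=
  (∑ i : Fin γ.1, (mu + (lamBar lam).real (priorityRegion γ i)) * (f (remove γ i) - f γ))
    + ∫ y in (⋃ i : Fin γ.1, nbhd (γ.2 i))ᶜ, (f (append γ y) - f γ) ∂(lamBar lam)

/-- `η` is a stationary version, adapted to `ℱ`, of the first-in-first-match Markov jump process: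
it solves the martingale problem for the generator, for all bounded measurable functions that
vanish on configurations with more than some number `n` of particles, and all `η t` have the
same law. -/
structure IsStationaryMatchingProcess (lam : Measure D) (mu : ℝ) {Ω : Type*}
    [mΩ : MeasurableSpace Ω] (P : Measure Ω) (ℱ : Filtration ℝ≥0 mΩ)
    (η : ℝ≥0 → Ω → Config D) : Prop where
  measurable : Measurable (fun p : ℝ≥0 × Ω => η p.1 p.2)
  adapted : ∀ t, Measurable[ℱ t] (η t)
  martingale : ∀ (n : ℕ) (f : Config D → ℝ), Measurable f → (∃ C, ∀ γ, |f γ| ≤ C) →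
    (∀ γ : Config D, n < γ.1 → f γ = 0) →
      Martingale (fun (t : ℝ≥0) ω => f (η t ω) - f (η 0 ω)
        - ∫ s in (0 : ℝ)..t, generator lam mu f (η s.toNNReal ω)) ℱ P
  stationary : ∀ t, P.map (η t) = P.map (η 0)

open Classical in
/-- `Π̃(x)`, for a finite family `x` of particles: the sum over all orderings `X₁, …, Xₙ` of the
family of `∏ₖ (λ̄(N(X₁, …, Xₖ)) + k μ)⁻¹`. -/
def piTilde (lam : Measure D) (mu : ℝ) {ι : Type*} [Fintype ι] (x : ι → Particle D) : ℝ :=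
  ∑ e : Fin (Fintype.card ι) ≃ ι, ∏ k : Fin (Fintype.card ι),
    ((lamBar lam).real (⋃ j : Fin (Fintype.card ι), ⋃ _ : j ≤ k, nbhd (x (e j)))
      + ((k : ℕ) + 1 : ℝ) * mu)⁻¹

/-- `Π̃(ξ)` for a finite set `ξ` of particles. -/
def piTildeSet (lam : Measure D) (mu : ℝ) (ξ : Finset (Particle D)) : ℝ :=
  piTilde lam mu (fun p : {p // p ∈ ξ} => (p : Particle D))

end Geometry

section Lattice

variable {D : Type*}

open Classical in
/-- `ξ ∨ γ = (ξᴿ ∪ γᴿ, ξᴮ ∩ γᴮ)`. -/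
def join (ξ γ : Finset (Particle D)) : Finset (Particle D) :=
  (ξ ∪ γ).filter (fun p => p.2 = red) ∪ (ξ ∩ γ).filter (fun p => p.2 = blue)

open Classical in
/-- `ξ ∧ γ = (ξᴿ ∩ γᴿ, ξᴮ ∪ γᴮ)`. -/
def meet (ξ γ : Finset (Particle D)) : Finset (Particle D) :=
  (ξ ∩ γ).filter (fun p => p.2 = red) ∪ (ξ ∪ γ).filter (fun p => p.2 = blue)

end Lattice

section PointProcess

variable {D : Type*} [MeasurableSpace D]

/-- The points of colour `c`, without their order, as a counting measure on `D`. -/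
def colorPart (c : Color) (γ : Config D) : Measure D :=
  ∑ i : Fin γ.1, if (γ.2 i).2 = c then Measure.dirac (γ.2 i).1 else 0

/-- The unordered configuration as the pair (red points, blue points). The second factor
carries the reversed order, so "larger" means more red points and fewer blue points. -/
def unordered (γ : Config D) : Measure D × (Measure D)ᵒᵈ :=
  (colorPart red γ, OrderDual.toDual (colorPart blue γ))

/-- The finite counting measures on `D`. -/
def countingMeasures (D : Type*) [MeasurableSpace D] : Set (Measure D) :=
  {ν | ∃ (n : ℕ) (p : Fin n → D), ν = ∑ i, Measure.dirac (p i)}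

/-- The unordered two-coloured configurations. -/
def configurations (D : Type*) [MeasurableSpace D] : Set (Measure D × (Measure D)ᵒᵈ) :=
  {ξ | ξ.1 ∈ countingMeasures D ∧ OrderDual.ofDual ξ.2 ∈ countingMeasures D}

/-- A law `Q` of unordered configurations has Janossy densities `j n` with respect to `ρ`:
`∫ F dQ = ∑ₙ (1/n!) ∫ jₙ(x₁, …, xₙ) F({x₁, …, xₙ}) ρ(dx₁) ⋯ ρ(dxₙ)` for all measurable `F ≥ 0`. -/
def HasJanossyDensity (Q : Measure (Measure D × (Measure D)ᵒᵈ)) (ρ : Measure (Particle D))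
    (j : (n : ℕ) → (Fin n → Particle D) → ℝ) : Prop :=
  ∀ F : Measure D × (Measure D)ᵒᵈ → ℝ≥0∞, Measurable F →
    ∫⁻ ξ, F ξ ∂Q = ∑' n : ℕ, ((n.factorial : ℝ≥0∞))⁻¹ *
      ∫⁻ x : Fin n → Particle D, ENNReal.ofReal (j n x) * F (unordered ⟨n, x⟩)
        ∂(Measure.pi fun _ => ρ)

/-- Positive association of a law `Q` carried by the set `S` in an ordered measurable space:
`E[f g] ≥ E[f] E[g]` for all functions `f`, `g` increasing on `S` with finite expectations. -/
def PositivelyAssociated {E : Type*} [MeasurableSpace E] [Preorder E] (S : Set E)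
    (Q : Measure E) : Prop :=
  ∀ f g : E → ℝ, Measurable f → Measurable g → MonotoneOn f S → MonotoneOn g S →
    Integrable f Q → Integrable g Q → Integrable (fun ξ => f ξ * g ξ) Q →
      (∫ ξ, f ξ ∂Q) * (∫ ξ, g ξ ∂Q) ≤ ∫ ξ, f ξ * g ξ ∂Q

/-- The point process with law `Q` has finite mean measure and is weakly super-Poissonian: its
moment measures (on products of disjoint sets) and its void probabilities are at least those of
the Poisson process with the same mean measure. -/
structure WeaklySuperPoissonian (Q : Measure (Measure D)) : Prop where
  mean_finite : ∫⁻ ν, ν univ ∂Q < ∞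
  moments : ∀ (k : ℕ) (B : Fin k → Set D), (∀ i, MeasurableSet (B i)) →
    Pairwise (fun i j => Disjoint (B i) (B j)) →
      ∏ i, ∫⁻ ν, ν (B i) ∂Q ≤ ∫⁻ ν, ∏ i, ν (B i) ∂Q
  voids : ∀ B : Set D, MeasurableSet B →
    ENNReal.ofReal (Real.exp (-(∫⁻ ν, ν B ∂Q).toReal)) ≤ Q {ν | ν B = 0}

end PointProcess

end FIFM

end

noncomputable section

namespace FIFM

section

section TwistedLattice

variable {ι : Type*} [DecidableEq ι]

/-- Union outside `B`, intersection inside `B`. -/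
def twistSup (B S T : Finset ι) : Finset ι := (S ∪ T) \ B ∪ (S ∩ T ∩ B)

/-- Intersection outside `B`, union inside `B`. -/
def twistInf (B S T : Finset ι) : Finset ι := (S ∩ T) \ B ∪ ((S ∪ T) ∩ B)

lemma mem_twistSup {B S T : Finset ι} {i : ι} :
    i ∈ twistSup B S T ↔ (i ∉ B ∧ (i ∈ S ∨ i ∈ T)) ∨ (i ∈ B ∧ i ∈ S ∧ i ∈ T) := by
  simp only [twistSup, Finset.mem_union, Finset.mem_sdiff, Finset.mem_inter]; tauto

lemma mem_twistInf {B S T : Finset ι} {i : ι} :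
    i ∈ twistInf B S T ↔ (i ∉ B ∧ i ∈ S ∧ i ∈ T) ∨ (i ∈ B ∧ (i ∈ S ∨ i ∈ T)) := by
  simp only [twistInf, Finset.mem_union, Finset.mem_sdiff, Finset.mem_inter]; tauto

variable [Fintype ι]

lemma sum_symmDiff {β : Type*} [AddCommMonoid β] (B : Finset ι) (f : Finset ι → β) :
    ∑ S, f (symmDiff S B) = ∑ S, f S :=
  Equiv.sum_comp (Function.Involutive.toPerm (fun S => symmDiff S B) (fun S => by simp)) f

theorem four_functions_twist {β : Type*} [CommSemiring β] [LinearOrder β] [IsStrictOrderedRing β]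
    [ExistsAddOfLE β] (B : Finset ι) (f₁ f₂ f₃ f₄ : Finset ι → β)
    (h₁ : 0 ≤ f₁) (h₂ : 0 ≤ f₂) (h₃ : 0 ≤ f₃) (h₄ : 0 ≤ f₄)
    (h : ∀ S T, f₁ S * f₂ T ≤ f₃ (twistSup B S T) * f₄ (twistInf B S T)) :
    (∑ S, f₁ S) * ∑ S, f₂ S ≤ (∑ S, f₃ S) * ∑ S, f₄ S := by
  have key := four_functions_theorem_univ (fun S => f₁ (symmDiff S B))
    (fun S => f₂ (symmDiff S B)) (fun S => f₄ (symmDiff S B)) (fun S => f₃ (symmDiff S B))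
    (fun S => h₁ (symmDiff S B)) (fun S => h₂ (symmDiff S B)) (fun S => h₄ (symmDiff S B))
    (fun S => h₃ (symmDiff S B)) (fun S T => by
      refine (h _ _).trans_eq ?_
      rw [mul_comm]
      congr 2
      · ext i
        simp only [mem_twistInf, Finset.mem_symmDiff, Finset.inf_eq_inter, Finset.mem_inter]
        tauto
      · ext i
        simp only [mem_twistSup, Finset.mem_symmDiff, Finset.sup_eq_union, Finset.mem_union]
        tauto)
  simp only [sum_symmDiff] at key
  rwa [mul_comm (∑ S, f₃ S)]

/-- The four functions theorem for sums over complementary pairs. -/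
theorem four_functions_compl (B : Finset ι) (f₁ f₂ f₃ f₄ : Finset ι → ℝ≥0)
    (h : ∀ S T, f₁ S * f₂ T ≤ f₃ (twistSup B S T) * f₄ (twistInf B S T)) :
    ∑ S, f₁ S * f₂ Sᶜ ≤ ∑ S, f₃ S * f₄ Sᶜ := by
  have hc : ∀ f : Finset ι → ℝ≥0, ∑ S, f Sᶜ = ∑ S, f S := fun f =>
    Equiv.sum_comp (Function.Involutive.toPerm (fun S : Finset ι => Sᶜ) compl_involutive) f
  have key := four_functions_twist B (fun S => f₁ S * f₂ Sᶜ) (fun S => f₁ Sᶜ * f₂ Sᶜᶜ)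
    (fun S => f₃ S * f₄ Sᶜ) (fun S => f₃ Sᶜ * f₄ Sᶜᶜ)
    (fun S => zero_le) (fun S => zero_le) (fun S => zero_le) (fun S => zero_le)
    (fun S T => by
      have e1 : twistSup B Tᶜ Sᶜ = (twistInf B S T)ᶜ := by
        ext i; simp only [mem_twistSup, mem_twistInf, Finset.mem_compl]; tauto
      have e2 : twistInf B Tᶜ Sᶜ = (twistSup B S T)ᶜ := by
        ext i; simp only [mem_twistSup, mem_twistInf, Finset.mem_compl]; tauto
      have a1 := h S T
      have a2 := h Tᶜ Sᶜ
      rw [e1, e2] at a2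
      simp only [compl_compl]
      calc f₁ S * f₂ Sᶜ * (f₁ Tᶜ * f₂ T) = (f₁ S * f₂ T) * (f₁ Tᶜ * f₂ Sᶜ) := by ring
        _ ≤ _ := mul_le_mul' a1 a2
        _ = _ := by ring)
  rw [hc (fun S => f₁ S * f₂ Sᶜ), hc (fun S => f₃ S * f₄ Sᶜ), ← sq, ← sq] at key
  exact (pow_le_pow_iff_left₀ zero_le zero_le two_ne_zero).1 key

end TwistedLattice

section LogSupermodular

variable {ι : Type*}

/-- Log-supermodularity with respect to the twisted lattice operations. -/
def LogSupermodular [DecidableEq ι] (B : Finset ι) (u : Finset ι → ℝ) : Prop :=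
  ∀ S T, u S * u T ≤ u (twistSup B S T) * u (twistInf B S T)

lemma tendsto_of_affine_recursion {r : ℝ} (h0 : 0 ≤ r) (h1 : r < 1) {c x : ℕ → ℝ} {l : ℝ}
    (hc : Filter.Tendsto c Filter.atTop (nhds l)) (hx : Monotone x)
    (hrec : ∀ k, x (k + 1) = r * (c k + x k)) :
    ∃ y, Filter.Tendsto x Filter.atTop (nhds y) ∧ y = r * (l + y) := by
  obtain ⟨C, hC⟩ := hc.bddAbove_range
  have hb : BddAbove (Set.range x) := by
    refine ⟨r * C / (1 - r), ?_⟩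
    rintro _ ⟨k, rfl⟩
    refine (hx (Nat.le_succ k)).trans ?_
    rw [le_div_iff₀ (by linarith)]
    have := hrec k
    have h2 := hx (Nat.le_succ k)
    have h3 := hC ⟨k, rfl⟩
    simp only [Nat.succ_eq_add_one] at *
    nlinarith
  refine ⟨_, tendsto_atTop_ciSup hx hb, ?_⟩
  have t1 := tendsto_atTop_ciSup hx hb
  have t2 := (t1.comp (Filter.tendsto_add_atTop_nat 1))
  have t3 : Filter.Tendsto (fun k => r * (c k + x k)) Filter.atTop (nhds (r * (l + ⨆ i, x i))) :=
    (hc.add t1).const_mul r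
  refine tendsto_nhds_unique t2 (t3.congr fun k => ?_)
  simp [hrec k]

/-- One step of the recursion whose fixed points are the discretized weights. -/
def subsetStep (ρ : Finset ι → ℝ) (u : Finset ι → ℝ) (A : Finset ι) : ℝ :=
  ρ A * ∑ S ∈ A.powerset, u S

lemma subsetStep_nonneg {ρ u : Finset ι → ℝ} (hρ : ∀ A, 0 ≤ ρ A) (hu : ∀ A, 0 ≤ u A)
    (A : Finset ι) : 0 ≤ subsetStep ρ u A :=
  mul_nonneg (hρ A) (Finset.sum_nonneg fun S _ => hu S)

lemma subsetStep_mono {ρ u v : Finset ι → ℝ} (hρ : ∀ A, 0 ≤ ρ A) (h : ∀ A, u A ≤ v A)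
    (A : Finset ι) : subsetStep ρ u A ≤ subsetStep ρ v A :=
  mul_le_mul_of_nonneg_left (Finset.sum_le_sum fun S _ => h S) (hρ A)

variable [DecidableEq ι]

lemma LogSupermodular.subsetStep [Fintype ι] {B : Finset ι} {ρ u : Finset ι → ℝ}
    (hρ0 : ∀ A, 0 ≤ ρ A) (hu0 : ∀ A, 0 ≤ u A)
    (hρ : LogSupermodular B ρ) (hu : LogSupermodular B u) :
    LogSupermodular B (subsetStep ρ u) := by
  intro A A'
  have hsum : ∀ A : Finset ι, ∑ S ∈ A.powerset, u S = ∑ S, if S ⊆ A then u S else 0 := by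
    intro A
    rw [← Finset.sum_filter]
    congr 1
    ext S; simp
  have key := four_functions_twist B (fun S => if S ⊆ A then u S else 0)
    (fun S => if S ⊆ A' then u S else 0)
    (fun S => if S ⊆ twistSup B A A' then u S else 0)
    (fun S => if S ⊆ twistInf B A A' then u S else 0)
    (fun S => by dsimp; split_ifs <;> simp [hu0]) (fun S => by dsimp; split_ifs <;> simp [hu0])
    (fun S => by dsimp; split_ifs <;> simp [hu0]) (fun S => by dsimp; split_ifs <;> simp [hu0])
    (fun S T => by
      by_cases hS : S ⊆ A
      · by_cases hT : T ⊆ A'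
        · have e1 : twistSup B S T ⊆ twistSup B A A' := by
            intro i hi
            rw [mem_twistSup] at hi ⊢
            have := @hS i; have := @hT i; tauto
          have e2 : twistInf B S T ⊆ twistInf B A A' := by
            intro i hi
            rw [mem_twistInf] at hi ⊢
            have := @hS i; have := @hT i; tauto
          simpa [hS, hT, e1, e2] using hu S T
        · simp only [hT, if_false, mul_zero]
          exact mul_nonneg (by split_ifs <;> simp [hu0]) (by split_ifs <;> simp [hu0])
      · simp only [hS, if_false, zero_mul]
        exact mul_nonneg (by split_ifs <;> simp [hu0]) (by split_ifs <;> simp [hu0]))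
  simp only [← hsum] at key
  unfold FIFM.subsetStep
  calc _ = (ρ A * ρ A') * ((∑ S ∈ A.powerset, u S) * ∑ S ∈ A'.powerset, u S) := by ring
    _ ≤ (ρ (twistSup B A A') * ρ (twistInf B A A')) *
        ((∑ S ∈ (twistSup B A A').powerset, u S) * ∑ S ∈ (twistInf B A A').powerset, u S) :=
      mul_le_mul (hρ A A') key (mul_nonneg (Finset.sum_nonneg fun S _ => hu0 S)
        (Finset.sum_nonneg fun S _ => hu0 S)) (mul_nonneg (hρ0 _) (hρ0 _))
    _ = _ := by ring

lemma exists_logSupermodular_fixedPoint [Fintype ι] {B : Finset ι} {ρ : Finset ι → ℝ}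
    (hρ0 : ∀ A, 0 ≤ ρ A) (hρe : ρ ∅ = 1) (hρ1 : ∀ A : Finset ι, A.Nonempty → ρ A < 1)
    (hρ : LogSupermodular B ρ) :
    ∃ u : Finset ι → ℝ, u ∅ = 1 ∧ LogSupermodular B u ∧
      ∀ A : Finset ι, A.Nonempty → u A = ρ A * (∑ S ∈ A.ssubsets, u S + u A) := by
  let u : ℕ → Finset ι → ℝ := fun k => (subsetStep ρ)^[k] (fun A => if A = ∅ then 1 else 0)
  have hu1 : ∀ k, u (k + 1) = subsetStep ρ (u k) := fun k => Function.iterate_succ_apply' _ _ _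
  have hu0 : ∀ k A, 0 ≤ u k A := by
    intro k
    induction k with
    | zero => intro A; simp only [u, Function.iterate_zero, id]; split_ifs <;> simp
    | succ k ih => intro A; rw [hu1]; exact subsetStep_nonneg hρ0 ih A
  have hue : ∀ k, u k ∅ = 1 := by
    intro k
    induction k with
    | zero => simp [u]
    | succ k ih => rw [hu1]; simp [subsetStep, hρe, ih]
  have hstep : ∀ k A, u k A ≤ u (k + 1) A := by
    intro k
    induction k with
    | zero =>
      intro A
      by_cases hA : A = ∅
      · subst hA; rw [hue, hue]
      · exact le_trans (by simp [u, hA]) (hu0 1 A)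
    | succ k ih => intro A; rw [hu1, hu1 (k + 1)]; exact subsetStep_mono hρ0 ih A
  have hmono : ∀ A, Monotone fun k => u k A := fun A => monotone_nat_of_le_succ fun k => hstep k A
  have hlsm : ∀ k, LogSupermodular B (u k) := by
    intro k
    induction k with
    | zero =>
      intro S T
      by_cases hS : S = ∅
      · by_cases hT : T = ∅
        · subst hS; subst hT; simp [twistSup, twistInf]
        · exact le_trans (by simp [u, hT]) (mul_nonneg (hu0 0 _) (hu0 0 _))
      · exact le_trans (by simp [u, hS]) (mul_nonneg (hu0 0 _) (hu0 0 _))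
    | succ k ih => rw [hu1]; exact LogSupermodular.subsetStep hρ0 (hu0 k) hρ ih
  have hrec : ∀ k A, u (k + 1) A = ρ A * (∑ S ∈ A.ssubsets, u k S + u k A) := by
    intro k A
    rw [hu1, subsetStep]
    congr 1
    rw [← Finset.insert_erase (Finset.mem_powerset_self A), Finset.sum_insert (by simp), add_comm]
    rfl
  have hconv : ∀ n, ∀ A : Finset ι, A.card = n → ∃ y, Filter.Tendsto (fun k => u k A)
      Filter.atTop (nhds y) := by
    intro n
    induction n using Nat.strong_induction_on with
    | _ n ih =>
    intro A hA
    rcases A.eq_empty_or_nonempty with rfl | hne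
    · exact ⟨1, by simp [hue]⟩
    · have hs : ∀ S ∈ A.ssubsets, ∃ y, Filter.Tendsto (fun k => u k S) Filter.atTop (nhds y) :=
        fun S hS => ih _ (hA ▸ Finset.card_lt_card (Finset.mem_ssubsets.1 hS)) S rfl
      choose! y hy using hs
      obtain ⟨z, hz, -⟩ := tendsto_of_affine_recursion (hρ0 A) (hρ1 A hne)
        (tendsto_finsetSum _ hy) (hmono A) (fun k => hrec k A)
      exact ⟨z, hz⟩
  choose v hv using fun A => hconv _ A rfl
  refine ⟨v, ?_, ?_, ?_⟩
  · exact tendsto_nhds_unique (hv ∅) (by simp [hue])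
  · intro S T
    exact le_of_tendsto_of_tendsto' ((hv S).mul (hv T)) ((hv _).mul (hv _)) fun k => hlsm k S T
  · intro A hA
    refine tendsto_nhds_unique ((hv A).comp (Filter.tendsto_add_atTop_nat 1)) ?_
    have : Filter.Tendsto (fun k => ρ A * (∑ S ∈ A.ssubsets, u k S + u k A)) Filter.atTop
        (nhds (ρ A * (∑ S ∈ A.ssubsets, v S + v A))) :=
      ((tendsto_finsetSum _ fun S _ => hv S).add (hv A)).const_mul _
    exact this.congr fun k => (hrec k A).symm

lemma card_twist (B S T : Finset ι) :
    (twistSup B S T).card + (twistInf B S T).card = S.card + T.card := by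
  have h1 : (twistSup B S T) ∪ (twistInf B S T) = S ∪ T := by
    ext i; simp only [mem_twistSup, mem_twistInf, Finset.mem_union]; tauto
  have h2 : (twistSup B S T) ∩ (twistInf B S T) = S ∩ T := by
    ext i; simp only [mem_twistSup, mem_twistInf, Finset.mem_inter]; tauto
  rw [← Finset.card_union_add_card_inter, h1, h2, Finset.card_union_add_card_inter]

lemma tendsto_exp_sub_one_div (a : ℝ) :
    Filter.Tendsto (fun ε : ℝ => (Real.exp (ε * a) - 1) / ε) (nhdsWithin 0 (Set.Ioi 0))
      (nhds a) := by
  have h : HasDerivAt (fun ε : ℝ => Real.exp (ε * a)) a 0 := by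
    simpa using ((hasDerivAt_id (0 : ℝ)).mul_const a).exp
  have := h.tendsto_slope.mono_left
    (nhdsWithin_mono 0 (fun x (hx : 0 < x) => hx.ne' : Set.Ioi (0:ℝ) ⊆ {0}ᶜ))
  refine this.congr fun ε => ?_
  simp [slope_def_field]

/-- Solutions of `g S * Z S = ∑ i ∈ S, Z (S.erase i)` with submodular `g` are log-supermodular. -/
theorem logSupermodular_of_recursion [Fintype ι] {B : Finset ι} {g Z : Finset ι → ℝ}
    (hge : g ∅ = 0) (hg0 : ∀ A : Finset ι, A.Nonempty → 0 < g A)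
    (hg : ∀ S T, g (twistSup B S T) + g (twistInf B S T) ≤ g S + g T)
    (hZe : Z ∅ = 1) (hZ : ∀ A : Finset ι, A.Nonempty → g A * Z A = ∑ i ∈ A, Z (A.erase i)) :
    LogSupermodular B Z := by
  have hex : ∀ ε : ℝ, 0 < ε → ∃ u : Finset ι → ℝ, u ∅ = 1 ∧ LogSupermodular B u ∧
      ∀ A : Finset ι, A.Nonempty →
        u A = Real.exp (-(ε * g A)) * (∑ S ∈ A.ssubsets, u S + u A) := by
    intro ε hε
    refine exists_logSupermodular_fixedPoint (fun A => (Real.exp_pos _).le) (by simp [hge])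
      (fun A hA => by simpa using mul_pos hε (hg0 A hA)) ?_
    intro S T
    rw [← Real.exp_add, ← Real.exp_add, Real.exp_le_exp]
    have := hg S T
    nlinarith
  choose! u hue hul hur using hex
  have hlim : ∀ n, ∀ A : Finset ι, A.card = n → Filter.Tendsto (fun ε => ε ^ A.card * u ε A)
      (nhdsWithin 0 (Set.Ioi 0)) (nhds (Z A)) := by
    intro n
    induction n using Nat.strong_induction_on with
    | _ n ih =>
    intro A hA
    rcases A.eq_empty_or_nonempty with rfl | hne
    · rw [hZe]
      refine tendsto_const_nhds.congr' ?_
      filter_upwards [self_mem_nhdsWithin] with ε hε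
      simp [hue ε hε]
    · have hs : ∀ S ∈ A.ssubsets, Filter.Tendsto (fun ε => ε ^ (A.card - S.card - 1) *
          (ε ^ S.card * u ε S)) (nhdsWithin 0 (Set.Ioi 0))
          (nhds (if S.card + 1 = A.card then Z S else 0)) := by
        intro S hS
        have hlt := Finset.card_lt_card (Finset.mem_ssubsets.1 hS)
        have h1 := ih _ (hA ▸ hlt) S rfl
        split_ifs with hc
        · have : A.card - S.card - 1 = 0 := by omega
          simpa [this] using h1
        · have h0 : Filter.Tendsto (fun ε : ℝ => ε ^ (A.card - S.card - 1))
              (nhdsWithin 0 (Set.Ioi 0)) (nhds 0) := by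
            have : A.card - S.card - 1 ≠ 0 := by omega
            have h2 := ((continuous_pow (A.card - S.card - 1)).tendsto (0 : ℝ))
            rw [zero_pow this] at h2
            exact h2.mono_left nhdsWithin_le_nhds
          simpa using h0.mul h1
      have hsum := tendsto_finsetSum _ hs
      have hval : ∑ S ∈ A.ssubsets, (if S.card + 1 = A.card then Z S else 0)
          = ∑ i ∈ A, Z (A.erase i) := by
        rw [← Finset.sum_filter]
        symm
        refine Finset.sum_bij (fun i _ => A.erase i) ?_ ?_ ?_ ?_
        · intro i hi
          simp only [Finset.mem_filter, Finset.mem_ssubsets]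
          exact ⟨Finset.erase_ssubset hi, Finset.card_erase_add_one hi⟩
        · intro i hi j hj hij
          by_contra hne
          have : i ∈ A.erase j := Finset.mem_erase.2 ⟨hne, hi⟩
          beta_reduce at hij
          rw [← hij] at this
          simp at this
        · intro S hS
          simp only [Finset.mem_filter, Finset.mem_ssubsets] at hS
          obtain ⟨i, hi⟩ : ∃ i, A \ S = {i} := by
            rw [← Finset.card_eq_one, Finset.card_sdiff_of_subset hS.1.1]; omega
          have hiA : i ∈ A \ S := by rw [hi]; simp
          refine ⟨i, (Finset.mem_sdiff.1 hiA).1, ?_⟩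
          rw [Finset.erase_eq, ← hi, Finset.sdiff_sdiff_eq_self hS.1.1]
        · intro i hi; rfl
      rw [hval] at hsum
      have hquot := hsum.div (tendsto_exp_sub_one_div (g A)) (hg0 A hne).ne'
      have hZA : Z A = (∑ i ∈ A, Z (A.erase i)) / g A := by
        rw [← hZ A hne, mul_div_cancel_left₀ _ (hg0 A hne).ne']
      rw [hZA]
      refine hquot.congr' ?_
      filter_upwards [self_mem_nhdsWithin] with ε hε
      have hε : 0 < ε := hε
      have hE : 0 < Real.exp (ε * g A) - 1 := by
        have : 0 < ε * g A := mul_pos hε (hg0 A hne)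
        have := Real.add_one_lt_exp this.ne'
        linarith
      have hr := hur ε hε A hne
      have hr2 : (Real.exp (ε * g A) - 1) * u ε A = ∑ S ∈ A.ssubsets, u ε S := by
        rw [Real.exp_neg] at hr
        have h3 : Real.exp (ε * g A) * u ε A = ∑ S ∈ A.ssubsets, u ε S + u ε A := by
          nth_rewrite 1 [hr]
          rw [← mul_assoc, mul_inv_cancel₀ (Real.exp_pos _).ne', one_mul]
        linarith
      have hl : ∑ S ∈ A.ssubsets, ε ^ (A.card - S.card - 1) * (ε ^ S.card * u ε S)
          = ε ^ (A.card - 1) * ∑ S ∈ A.ssubsets, u ε S := by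
        rw [Finset.mul_sum]
        refine Finset.sum_congr rfl fun S hS => ?_
        have hlt := Finset.card_lt_card (Finset.mem_ssubsets.1 hS)
        rw [← mul_assoc, ← pow_add]
        congr 2; omega
      rw [Pi.div_apply, hl, ← hr2]
      have hp : ε ^ A.card = ε ^ (A.card - 1) * ε := by
        rw [← pow_succ]; congr 1; have := hne.card_pos; omega
      rw [hp]
      field_simp
  intro S T
  refine le_of_tendsto_of_tendsto ((hlim _ S rfl).mul (hlim _ T rfl))
    ((hlim _ _ rfl).mul (hlim _ _ rfl)) ?_
  filter_upwards [self_mem_nhdsWithin] with ε hε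
  have hε : 0 < ε := hε
  have h1 := hul ε hε S T
  have h2 : ε ^ S.card * ε ^ T.card
      = ε ^ (twistSup B S T).card * ε ^ (twistInf B S T).card := by
    rw [← pow_add, ← pow_add, card_twist]
  calc _ = (ε ^ S.card * ε ^ T.card) * (u ε S * u ε T) := by ring
    _ ≤ (ε ^ S.card * ε ^ T.card) * (u ε (twistSup B S T) * u ε (twistInf B S T)) :=
      mul_le_mul_of_nonneg_left h1 (by positivity)
    _ = _ := by rw [h2]; ring

end LogSupermodular

end

section

section Families

variable {X : Type*}

lemma exists_equiv_of_map_eq {ι κ : Type*} [Fintype ι] [Fintype κ] {x : ι → X} {y : κ → X}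
    (h : Finset.univ.val.map x = Finset.univ.val.map y) : ∃ e : ι ≃ κ, y ∘ e = x := by
  classical
  have hc : ∀ a, Nonempty ({i // x i = a} ≃ {j // y j = a}) := by
    intro a
    refine ⟨Fintype.equivOfCardEq ?_⟩
    have := congrArg (Multiset.count a) h
    rw [Multiset.count_map, Multiset.count_map] at this
    rw [Fintype.card_subtype, Fintype.card_subtype]
    simpa [Finset.card_def, eq_comm] using this
  let f := fun a => (hc a).some
  refine ⟨(Equiv.sigmaFiberEquiv x).symm.trans
    ((Equiv.sigmaCongrRight f).trans (Equiv.sigmaFiberEquiv y)), ?_⟩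
  funext i
  exact (f (x i) ⟨i, rfl⟩).2

lemma map_val_eq_map_univ {ι : Type*} (S : Finset ι) (x : ι → X) :
    S.val.map x = Finset.univ.val.map (fun p : {p // p ∈ S} => x p) := by
  conv_lhs => rw [← Finset.attach_map_val (s := S)]
  simp [Finset.univ_eq_attach]

end Families

variable {D : Type*} [MetricSpace D]

lemma notMem_nbhd_self (x : Particle D) : x ∉ nbhd x := by
  simp [nbhd]

lemma mem_nbhd_comm {x y : Particle D} : x ∈ nbhd y ↔ y ∈ nbhd x := by
  rcases x with ⟨p, c⟩
  rcases y with ⟨q, d⟩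
  simp only [nbhd, mem_prod, Metric.mem_ball, mem_singleton_iff, dist_comm]
  cases c <;> cases d <;> simp

variable [MeasurableSpace D]

instance (lam : Measure D) [IsFiniteMeasure lam] : IsFiniteMeasure (lamBar lam) := by
  unfold lamBar; infer_instance

/-- The mass of the region matched to the first `k` particles. -/
def cov (lam : Measure D) {n : ℕ} (x : Fin n → Particle D) (k : ℕ) : ℝ :=
  (lamBar lam).real (⋃ j : Fin n, ⋃ _ : (j : ℕ) < k, nbhd (x j))

/-- The product weight of an ordered family. -/
def weight (lam : Measure D) (mu : ℝ) {n : ℕ} (x : Fin n → Particle D) : ℝ :=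
  ∏ k : Fin n, (cov lam x (k + 1) + ((k : ℕ) + 1 : ℝ) * mu)⁻¹

lemma cov_nonneg (lam : Measure D) {n : ℕ} (x : Fin n → Particle D) (k : ℕ) : 0 ≤ cov lam x k :=
  measureReal_nonneg

lemma cov_zero (lam : Measure D) {n : ℕ} (x : Fin n → Particle D) : cov lam x 0 = 0 := by
  simp [cov]

lemma cov_castSucc (lam : Measure D) {n : ℕ} (x : Fin (n + 1) → Particle D) {k : ℕ} (hk : k ≤ n) :
    cov lam (fun i : Fin n => x i.castSucc) k = cov lam x k := by
  unfold cov
  congr 1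
  ext q
  simp only [mem_iUnion, exists_prop, Fin.exists_fin_succ', Fin.val_castSucc, Fin.val_last]
  constructor
  · exact Or.inl
  · rintro (h | h)
    · exact h
    · omega

lemma cov_full (lam : Measure D) {n : ℕ} (x : Fin n → Particle D) :
    cov lam x n = (lamBar lam).real (⋃ j : Fin n, nbhd (x j)) := by
  unfold cov
  congr 1
  ext q
  simp

lemma weight_nonneg (lam : Measure D) {mu : ℝ} (hmu : 0 < mu) {n : ℕ} (x : Fin n → Particle D) :
    0 ≤ weight lam mu x :=
  Finset.prod_nonneg fun k _ => inv_nonneg.2 (by have := cov_nonneg lam x (k + 1); positivity)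

lemma weight_succ (lam : Measure D) (mu : ℝ) {n : ℕ} (x : Fin (n + 1) → Particle D) :
    weight lam mu x = weight lam mu (fun i : Fin n => x i.castSucc) *
      (cov lam x (n + 1) + ((n : ℝ) + 1) * mu)⁻¹ := by
  unfold weight
  rw [Fin.prod_univ_castSucc]
  congr 1
  refine Finset.prod_congr rfl fun k _ => ?_
  rw [Fin.val_castSucc, cov_castSucc lam x (by omega)]

lemma weight_le (lam : Measure D) {mu : ℝ} (hmu : 0 < mu) {n : ℕ} (x : Fin n → Particle D) :
    weight lam mu x ≤ ((n.factorial : ℝ) * mu ^ n)⁻¹ := by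
  induction n with
  | zero => simp [weight]
  | succ n ih =>
    rw [weight_succ]
    calc _ ≤ ((n.factorial : ℝ) * mu ^ n)⁻¹ * (((n : ℝ) + 1) * mu)⁻¹ := by
          refine mul_le_mul (ih _) ?_ (inv_nonneg.2 ?_) (by positivity)
          · exact inv_anti₀ (by positivity) (by have := cov_nonneg lam x (n + 1); linarith)
          · have := cov_nonneg lam x (n + 1); positivity
      _ = _ := by
          rw [← mul_inv, Nat.factorial_succ]; push_cast; ring_nf

lemma piTilde_eq_sum (lam : Measure D) (mu : ℝ) {ι : Type*} [Fintype ι]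
    [DecidableEq ι] {n : ℕ} (h : Fintype.card ι = n) (x : ι → Particle D) :
    piTilde lam mu x = ∑ e : Fin n ≃ ι, weight lam mu (x ∘ e) := by
  classical
  subst h
  unfold piTilde weight cov
  congr! 11
  exact Fin.le_def.trans Nat.lt_succ_iff.symm

lemma piTilde_nonneg (lam : Measure D) {mu : ℝ} (hmu : 0 < mu) {ι : Type*} [Fintype ι]
    (x : ι → Particle D) : 0 ≤ piTilde lam mu x := by
  classical
  rw [piTilde_eq_sum lam mu rfl]
  exact Finset.sum_nonneg fun e _ => weight_nonneg lam hmu _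

lemma piTilde_comp_equiv (lam : Measure D) (mu : ℝ) {ι κ : Type*} [Fintype ι] [Fintype κ]
    (e : ι ≃ κ) (x : κ → Particle D) : piTilde lam mu (x ∘ e) = piTilde lam mu x := by
  classical
  rw [piTilde_eq_sum lam mu rfl, piTilde_eq_sum lam mu (Fintype.card_congr e).symm]
  exact Fintype.sum_equiv (Equiv.equivCongr (Equiv.refl _) e) _ _ fun f => rfl

lemma piTilde_empty (lam : Measure D) (mu : ℝ) {ι : Type*} [Fintype ι] [IsEmpty ι]
    (x : ι → Particle D) : piTilde lam mu x = 1 := by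
  classical
  rw [piTilde_eq_sum lam mu (Fintype.card_eq_zero (α := ι))]
  have : Unique (Fin 0 ≃ ι) := Equiv.equivOfIsEmpty _ _ |> fun e => ⟨⟨e⟩, fun f => by
    ext i; exact i.elim0⟩
  rw [Fintype.sum_unique]
  simp [weight]

lemma piTilde_recursion (lam : Measure D) {mu : ℝ} (hmu : 0 < mu) {ι : Type*} [Fintype ι]
    [DecidableEq ι] [Nonempty ι] (x : ι → Particle D) :
    ((lamBar lam).real (⋃ i, nbhd (x i)) + (Fintype.card ι : ℝ) * mu) * piTilde lam mu x
      = ∑ i, piTilde lam mu (fun j : {j // j ≠ i} => x j.1) := by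
  obtain ⟨n, hn⟩ : ∃ n, Fintype.card ι = n + 1 :=
    Nat.exists_eq_succ_of_ne_zero Fintype.card_ne_zero
  rw [piTilde_eq_sum lam mu hn, hn]
  have h1 : ∀ e : Fin (n + 1) ≃ ι, weight lam mu (x ∘ e) =
      weight lam mu (fun i : Fin n => x (e i.castSucc)) *
      ((lamBar lam).real (⋃ i, nbhd (x i)) + ((n : ℝ) + 1) * mu)⁻¹ := by
    intro e
    rw [weight_succ, cov_full]
    congr 4
    exact e.surjective.iUnion_comp (fun i => nbhd (x i))
  simp only [h1]
  rw [← Finset.sum_mul, Nat.cast_succ]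
  have hpos : 0 < (lamBar lam).real (⋃ i, nbhd (x i)) + ((n : ℝ) + 1) * mu := by positivity
  rw [mul_comm, inv_mul_cancel_right₀ hpos.ne']
  rw [Fintype.sum_equiv (Equiv.equivCongr finSuccEquivLast (Equiv.refl ι))
    (fun e : Fin (n + 1) ≃ ι => weight lam mu fun i : Fin n => x (e i.castSucc))
    (fun e : Option (Fin n) ≃ ι => weight lam mu fun i : Fin n => x (e (some i)))
    (fun e => by simp [Equiv.equivCongr])]
  rw [← Finset.sum_fiberwise Finset.univ (fun e : Option (Fin n) ≃ ι => e none)]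
  refine Finset.sum_congr rfl fun i _ => ?_
  have hcard : Fintype.card {j // j ≠ i} = n := by
    rw [Fintype.card_subtype_compl, hn]; simp
  rw [piTilde_eq_sum lam mu hcard,
    Finset.sum_subtype (p := fun e : Option (Fin n) ≃ ι => e none = i) _ (by simp)]
  exact Fintype.sum_equiv (Equiv.optionSubtype i) _ _ fun e => rfl

/-- `Π̃` as a function of multisets of particles. -/
def piTildeMultiset (lam : Measure D) (mu : ℝ) (M : Multiset (Particle D)) : ℝ :=
  piTilde lam mu (fun i : Fin M.toList.length => M.toList.get i)

lemma piTildeMultiset_map_univ (lam : Measure D) (mu : ℝ) {ι : Type*} [Fintype ι]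
    (x : ι → Particle D) :
    piTildeMultiset lam mu (Finset.univ.val.map x) = piTilde lam mu x := by
  set M := Finset.univ.val.map x with hM
  have h : Finset.univ.val.map (fun i : Fin M.toList.length => M.toList.get i)
      = Finset.univ.val.map x := by
    rw [← hM]
    have := Fin.univ_val_map (fun i : Fin M.toList.length => M.toList.get i)
    rw [this, List.ofFn_get, Multiset.coe_toList]
  obtain ⟨e, he⟩ := exists_equiv_of_map_eq h
  rw [← piTilde_comp_equiv lam mu e x, he]
  rfl

lemma piTildeMultiset_nonneg (lam : Measure D) {mu : ℝ} (hmu : 0 < mu)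
    (M : Multiset (Particle D)) : 0 ≤ piTildeMultiset lam mu M :=
  piTilde_nonneg lam hmu _

lemma piTildeMultiset_zero (lam : Measure D) (mu : ℝ) :
    piTildeMultiset lam mu (0 : Multiset (Particle D)) = 1 := by
  have := piTildeMultiset_map_univ lam mu (fun i : Fin 0 => (i.elim0 : Particle D))
  rw [piTilde_empty] at this
  simpa using this

lemma piTildeMultiset_recursion (lam : Measure D) {mu : ℝ} (hmu : 0 < mu) {ι : Type*}
    [DecidableEq ι] (x : ι → Particle D) {S : Finset ι} (hS : S.Nonempty) :
    ((lamBar lam).real (⋃ i ∈ S, nbhd (x i)) + (S.card : ℝ) * mu) *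
      piTildeMultiset lam mu (S.val.map x)
      = ∑ i ∈ S, piTildeMultiset lam mu ((S.erase i).val.map x) := by
  have : Nonempty {p // p ∈ S} := hS.to_subtype
  rw [map_val_eq_map_univ, piTildeMultiset_map_univ]
  have := piTilde_recursion lam hmu (fun p : {p // p ∈ S} => x p)
  rw [Fintype.card_coe] at this
  have hU : (⋃ i ∈ S, nbhd (x i)) = ⋃ i : {p // p ∈ S}, nbhd (x i) := by
    ext q; simp
  rw [hU]
  refine this.trans ?_
  rw [← Finset.sum_coe_sort S]
  refine Finset.sum_congr rfl fun i _ => ?_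
  rw [map_val_eq_map_univ, piTildeMultiset_map_univ]
  let e : {p // p ∈ S.erase i} ≃ {j : {p // p ∈ S} // j ≠ i} :=
    { toFun := fun p => ⟨⟨p, Finset.mem_of_mem_erase p.2⟩, fun h =>
        Finset.ne_of_mem_erase p.2 (congrArg Subtype.val h)⟩
      invFun := fun j => ⟨j.1.1, Finset.mem_erase.2 ⟨fun h => j.2 (Subtype.ext h), j.1.2⟩⟩
      left_inv := fun p => rfl
      right_inv := fun p => rfl }
  exact (piTilde_comp_equiv lam mu e
    (fun j : {j : {p // p ∈ S} // j ≠ i} => x (j : {p // p ∈ S}))).symm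

lemma piTildeSet_eq (lam : Measure D) (mu : ℝ) (ξ : Finset (Particle D)) :
    piTildeSet lam mu ξ = piTildeMultiset lam mu ξ.val := by
  rw [piTildeSet, ← piTildeMultiset_map_univ, ← map_val_eq_map_univ ξ (fun p => p),
    Multiset.map_id']

variable [BorelSpace D]

lemma measurableSet_nbhd (x : Particle D) : MeasurableSet (nbhd x) :=
  Metric.isOpen_ball.measurableSet.prod (measurableSet_singleton _)

/-- The particles of the family whose colour is not `c`. -/
def otherColor {X : Type*} {ι : Type*} [Fintype ι] (x : ι → X × Color) (c : Color) : Finset ι :=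
  Finset.univ.filter fun i => (x i).2 ≠ c

lemma mem_otherColor {X : Type*} {ι : Type*} [Fintype ι] {x : ι → X × Color} {c : Color} {i : ι} :
    i ∈ otherColor x c ↔ (x i).2 ≠ c := by simp [otherColor]

lemma measureReal_iUnion_nbhd_twist (lam : Measure D) [IsFiniteMeasure lam] {ι : Type*} [Fintype ι]
    [DecidableEq ι] (x : ι → Particle D) (c : Color) (S T : Finset ι) :
    (lamBar lam).real (⋃ i ∈ twistSup (otherColor x c) S T, nbhd (x i)) +
      (lamBar lam).real (⋃ i ∈ twistInf (otherColor x c) S T, nbhd (x i)) ≤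
    (lamBar lam).real (⋃ i ∈ S, nbhd (x i)) + (lamBar lam).real (⋃ i ∈ T, nbhd (x i)) := by
  let N : Finset ι → Set (Particle D) := fun S => ⋃ i ∈ S, nbhd (x i)
  have hN : ∀ S, MeasurableSet (N S) := fun S =>
    Finset.measurableSet_biUnion _ fun i _ => measurableSet_nbhd _
  let C : Set (Particle D) := {q | q.2 = c}
  have hC : MeasurableSet C := measurable_snd (measurableSet_singleton c)
  have hsplit : ∀ S, (lamBar lam).real (N S)
      = (lamBar lam).real (N S ∩ C) + (lamBar lam).real (N S \ C) := fun S =>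
    (measureReal_inter_add_sdiff hC (measure_ne_top _ _)).symm
  have hmem : ∀ i q, q ∈ nbhd (x i) → (q ∈ C ↔ (x i).2 ≠ c) := by
    intro i q hq
    have : q.2 = !(x i).2 := hq.2
    simp only [C, mem_ofPred_eq, this]
    cases (x i).2 <;> cases c <;> simp
  have h1 : (lamBar lam).real (N (twistSup (otherColor x c) S T) \ C) +
      (lamBar lam).real (N (twistInf (otherColor x c) S T) \ C) ≤
      (lamBar lam).real (N S \ C) + (lamBar lam).real (N T \ C) := by
    rw [← measureReal_union_add_inter ((hN T).diff hC)]
    refine add_le_add (measureReal_mono ?_) (measureReal_mono ?_)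
    · rintro q ⟨hq, hqC⟩
      simp only [N, mem_iUnion, exists_prop] at hq
      obtain ⟨i, hi, hq⟩ := hq
      have := hmem i q hq
      rw [mem_twistSup, mem_otherColor] at hi
      rcases hi with ⟨_, hi | hi⟩ | ⟨h, _⟩
      · exact Or.inl ⟨mem_biUnion hi hq, hqC⟩
      · exact Or.inr ⟨mem_biUnion hi hq, hqC⟩
      · exact absurd (this.2 h) hqC
    · rintro q ⟨hq, hqC⟩
      simp only [N, mem_iUnion, exists_prop] at hq
      obtain ⟨i, hi, hq⟩ := hq
      have := hmem i q hq
      rw [mem_twistInf, mem_otherColor] at hi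
      rcases hi with ⟨_, hi, hi'⟩ | ⟨h, _⟩
      · exact ⟨⟨mem_biUnion hi hq, hqC⟩, ⟨mem_biUnion hi' hq, hqC⟩⟩
      · exact absurd (this.2 h) hqC
  have h2 : (lamBar lam).real (N (twistInf (otherColor x c) S T) ∩ C) +
      (lamBar lam).real (N (twistSup (otherColor x c) S T) ∩ C) ≤
      (lamBar lam).real (N S ∩ C) + (lamBar lam).real (N T ∩ C) := by
    rw [← measureReal_union_add_inter ((hN T).inter hC)]
    refine add_le_add (measureReal_mono ?_) (measureReal_mono ?_)
    · rintro q ⟨hq, hqC⟩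
      simp only [N, mem_iUnion, exists_prop] at hq
      obtain ⟨i, hi, hq⟩ := hq
      have := hmem i q hq
      rw [mem_twistInf, mem_otherColor] at hi
      rcases hi with ⟨h, _⟩ | ⟨_, hi | hi⟩
      · exact absurd (this.1 hqC) h
      · exact Or.inl ⟨mem_biUnion hi hq, hqC⟩
      · exact Or.inr ⟨mem_biUnion hi hq, hqC⟩
    · rintro q ⟨hq, hqC⟩
      simp only [N, mem_iUnion, exists_prop] at hq
      obtain ⟨i, hi, hq⟩ := hq
      have := hmem i q hq
      rw [mem_twistSup, mem_otherColor] at hi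
      rcases hi with ⟨h, _⟩ | ⟨_, hi, hi'⟩
      · exact absurd (this.1 hqC) h
      · exact ⟨⟨mem_biUnion hi hq, hqC⟩, ⟨mem_biUnion hi' hq, hqC⟩⟩
  have e1 := hsplit S
  have e2 := hsplit T
  have e3 := hsplit (twistSup (otherColor x c) S T)
  have e4 := hsplit (twistInf (otherColor x c) S T)
  simp only [N] at *
  linarith

theorem logSupermodular_piTildeMultiset (lam : Measure D) [IsFiniteMeasure lam] {mu : ℝ}
    (hmu : 0 < mu) {ι : Type*} [Fintype ι] [DecidableEq ι] (x : ι → Particle D) (c : Color) :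
    LogSupermodular (otherColor x c) (fun S => piTildeMultiset lam mu (S.val.map x)) := by
  refine logSupermodular_of_recursion
    (g := fun S => (lamBar lam).real (⋃ i ∈ S, nbhd (x i)) + (S.card : ℝ) * mu) ?_ ?_ ?_ ?_ ?_
  · simp
  · intro A hA
    have : 0 < A.card := hA.card_pos
    positivity
  · intro S T
    have h1 := measureReal_iUnion_nbhd_twist lam x c S T
    have h2 : ((twistSup (otherColor x c) S T).card : ℝ) + (twistInf (otherColor x c) S T).card
        = S.card + T.card := by exact_mod_cast card_twist (otherColor x c) S T
    have h3 : ((twistSup (otherColor x c) S T).card : ℝ) * mu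
      + (twistInf (otherColor x c) S T).card * mu = S.card * mu + T.card * mu := by
      rw [← add_mul, h2, add_mul]
    linarith
  · simpa using piTildeMultiset_zero lam mu
  · intro A hA
    exact piTildeMultiset_recursion lam hmu x hA

/-- The FKG lattice inequality for `Π̃`. -/
theorem piTildeSet_join_mul_meet (lam : Measure D) [IsFiniteMeasure lam] {mu : ℝ} (hmu : 0 < mu)
    (ξ γ : Finset (Particle D)) :
    piTildeSet lam mu ξ * piTildeSet lam mu γ ≤
      piTildeSet lam mu (join ξ γ) * piTildeSet lam mu (meet ξ γ) := by
  classical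
  let U := {p // p ∈ ξ ∪ γ}
  let x : U → Particle D := fun p => p
  let S : Finset U := ξ.subtype _
  let T : Finset U := γ.subtype _
  have key := logSupermodular_piTildeMultiset lam hmu x red S T
  have hval : ∀ (A : Finset U) (ζ : Finset (Particle D)),
      (∀ p, p ∈ ζ ↔ ∃ h : p ∈ ξ ∪ γ, (⟨p, h⟩ : U) ∈ A) →
      piTildeMultiset lam mu (A.val.map x) = piTildeSet lam mu ζ := by
    intro A ζ h
    have : ζ = A.map ⟨x, Subtype.val_injective⟩ := by
      ext p
      rw [h]
      simp [x, U]
    rw [piTildeSet_eq, this]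
    rfl
  have hcol : ∀ c : Color, c = blue ↔ ¬ c = red := by
    intro c
    cases c <;> simp
  beta_reduce at key
  rw [hval S ξ, hval T γ, hval _ (join ξ γ), hval _ (meet ξ γ)] at key
  · exact key
  · intro p
    simp only [meet, mem_twistInf, mem_otherColor, Finset.mem_union, Finset.mem_filter,
      Finset.mem_inter, S, T, x, Finset.mem_subtype, exists_prop, hcol]
    tauto
  · intro p
    simp only [join, mem_twistSup, mem_otherColor, Finset.mem_union, Finset.mem_filter,
      Finset.mem_inter, S, T, x, Finset.mem_subtype, exists_prop, hcol]
    tauto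
  · exact fun p => ⟨fun h => ⟨Finset.mem_union_right _ h, Finset.mem_subtype.2 h⟩,
      fun ⟨_, h⟩ => Finset.mem_subtype.1 h⟩
  · exact fun p => ⟨fun h => ⟨Finset.mem_union_left _ h, Finset.mem_subtype.2 h⟩,
      fun ⟨_, h⟩ => Finset.mem_subtype.1 h⟩

end

section

section PoissonIntegral

variable {X : Type*} [MeasurableSpace X]

/-- A function of finite multisets is measurable if it is so on families of each size. -/
def MultisetMeasurable {β : Type*} [MeasurableSpace β] (F : Multiset X → β) : Prop :=
  ∀ n : ℕ, Measurable fun x : Fin n → X => F (Finset.univ.val.map x)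

lemma map_univ_comp_equiv {Y ι κ : Type*} [Fintype ι] [Fintype κ] (e : ι ≃ κ) (y : κ → Y) :
    Finset.univ.val.map (fun i => y (e i)) = Finset.univ.val.map y := by
  rw [← Multiset.map_univ_val_equiv e, Multiset.map_map]
  rfl

lemma MultisetMeasurable.comp_family {β : Type*} [MeasurableSpace β] {F : Multiset X → β}
    (hF : MultisetMeasurable F) {κ : Type*} [Fintype κ] :
    Measurable fun y : κ → X => F (Finset.univ.val.map y) := by
  have e : Fin (Fintype.card κ) ≃ κ := (Fintype.equivFin κ).symm
  have : (fun y : κ → X => F (Finset.univ.val.map y)) =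
      fun y : κ → X => F (Finset.univ.val.map fun i => y (e i)) := by
    funext y
    rw [map_univ_comp_equiv e y]
  rw [this]
  exact (hF _).comp (measurable_pi_lambda _ fun i => measurable_pi_apply _)

lemma MultisetMeasurable.comp_subfamily {β : Type*} [MeasurableSpace β] {F : Multiset X → β}
    (hF : MultisetMeasurable F) {κ : Type*} (S : Finset κ) :
    Measurable fun y : κ → X => F (S.val.map y) := by
  have : (fun y : κ → X => F (S.val.map y)) =
      fun y : κ → X => F (Finset.univ.val.map fun p : {p // p ∈ S} => y p) :=
    funext fun y => by rw [map_val_eq_map_univ]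
  rw [this]
  exact (hF.comp_family (κ := {p // p ∈ S})).comp
    (measurable_pi_lambda _ fun i => measurable_pi_apply _)

variable (ρ : Measure X)

/-- The integral over unordered finite families with respect to `∑ₙ ρⁿ / n!`. -/
def poissonIntegral (F : Multiset X → ℝ≥0∞) : ℝ≥0∞ :=
  ∑' n : ℕ, ((n.factorial : ℝ≥0∞))⁻¹ *
    ∫⁻ x : Fin n → X, F (Finset.univ.val.map x) ∂(Measure.pi fun _ => ρ)

variable [SigmaFinite ρ]

lemma lintegral_pi_reindex {κ ι : Type*} [Fintype κ] [Fintype ι] (e : ι ≃ κ)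
    (G : (κ → X) → ℝ≥0∞) :
    ∫⁻ y : ι → X, G (fun j => y (e.symm j)) ∂(Measure.pi fun _ => ρ)
      = ∫⁻ x, G x ∂(Measure.pi fun _ => ρ) := by
  rw [← (measurePreserving_piCongrLeft (fun _ : κ => ρ) e).lintegral_comp_emb
    (MeasurableEquiv.measurableEmbedding _)]
  refine lintegral_congr fun y => ?_
  congr 1
  funext j
  obtain ⟨i, rfl⟩ := e.surjective j
  rw [Equiv.symm_apply_apply]
  exact (Equiv.piCongrLeft_apply_apply (fun _ : κ => X) e y i).symm

lemma lintegral_map_univ_reindex {κ : Type*} [Fintype κ] {m : ℕ} (h : Fintype.card κ = m)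
    (F : Multiset X → ℝ≥0∞) :
    ∫⁻ y : κ → X, F (Finset.univ.val.map y) ∂(Measure.pi fun _ => ρ)
      = ∫⁻ x : Fin m → X, F (Finset.univ.val.map x) ∂(Measure.pi fun _ => ρ) := by
  subst h
  rw [← lintegral_pi_reindex ρ (Fintype.equivFin κ)]
  refine lintegral_congr fun y => ?_
  rw [map_univ_comp_equiv (Fintype.equivFin κ).symm y]

lemma lintegral_split_pred {κ : Type*} [Fintype κ] (p : κ → Prop) [DecidablePred p] {k m : ℕ}
    (h₁ : Fintype.card {i // p i} = k) (h₂ : Fintype.card {i // ¬ p i} = m)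
    {F G : Multiset X → ℝ≥0∞} (hF : MultisetMeasurable F) (hG : MultisetMeasurable G) :
    ∫⁻ x : κ → X, F (Finset.univ.val.map fun i : {i // p i} => x i) *
        G (Finset.univ.val.map fun i : {i // ¬ p i} => x i) ∂(Measure.pi fun _ => ρ)
      = (∫⁻ x : Fin k → X, F (Finset.univ.val.map x) ∂(Measure.pi fun _ => ρ)) *
        ∫⁻ x : Fin m → X, G (Finset.univ.val.map x) ∂(Measure.pi fun _ => ρ) := by
  rw [← lintegral_map_univ_reindex ρ h₁, ← lintegral_map_univ_reindex ρ h₂,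
    ← lintegral_prod_mul hF.comp_family.aemeasurable hG.comp_family.aemeasurable]
  exact (measurePreserving_piEquivPiSubtypeProd (fun _ : κ => ρ) p).lintegral_comp_emb
    (MeasurableEquiv.measurableEmbedding _) fun z => F (Finset.univ.val.map z.1) *
      G (Finset.univ.val.map z.2)

lemma lintegral_split {n : ℕ} (S : Finset (Fin n)) {F G : Multiset X → ℝ≥0∞}
    (hF : MultisetMeasurable F) (hG : MultisetMeasurable G) :
    ∫⁻ x : Fin n → X, F (S.val.map x) * G (Sᶜ.val.map x) ∂(Measure.pi fun _ => ρ)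
      = (∫⁻ x : Fin S.card → X, F (Finset.univ.val.map x) ∂(Measure.pi fun _ => ρ)) *
        ∫⁻ x : Fin (n - S.card) → X, G (Finset.univ.val.map x) ∂(Measure.pi fun _ => ρ) := by
  rw [← lintegral_split_pred ρ (· ∈ S) (by rw [Fintype.card_subtype]; simp)
    (by rw [Fintype.card_subtype_compl, Fintype.card_fin, Fintype.card_subtype]; simp) hF hG]
  refine lintegral_congr fun x => ?_
  congr 2
  · rw [map_val_eq_map_univ S x]
    congr!
  · rw [map_val_eq_map_univ]
    let e : {i // i ∈ Sᶜ} ≃ {i // ¬ i ∈ S} :=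
      Equiv.subtypeEquivRight fun i => Finset.mem_compl
    exact map_univ_comp_equiv e (fun i : {i // ¬ i ∈ S} => x i)

lemma poissonIntegral_mul {F G : Multiset X → ℝ≥0∞}
    (hF : MultisetMeasurable F) (hG : MultisetMeasurable G) :
    poissonIntegral ρ F * poissonIntegral ρ G = ∑' n : ℕ, ((n.factorial : ℝ≥0∞))⁻¹ *
      ∫⁻ x : Fin n → X, ∑ S : Finset (Fin n), F (S.val.map x) * G (Sᶜ.val.map x)
        ∂(Measure.pi fun _ => ρ) := by
  set J := fun (H : Multiset X → ℝ≥0∞) (m : ℕ) =>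
    ∫⁻ x : Fin m → X, H (Finset.univ.val.map x) ∂(Measure.pi fun _ => ρ) with hJ
  have hL : poissonIntegral ρ F * poissonIntegral ρ G = ∑' n : ℕ,
      ∑ p ∈ Finset.HasAntidiagonal.antidiagonal n, ((p.1.factorial : ℝ≥0∞))⁻¹ * J F p.1 *
        (((p.2.factorial : ℝ≥0∞))⁻¹ * J G p.2) := by
    unfold poissonIntegral
    rw [← ENNReal.tsum_mul_right]
    simp_rw [← ENNReal.tsum_mul_left]
    rw [← ENNReal.tsum_prod (f := fun m k => ((m.factorial : ℝ≥0∞))⁻¹ * J F m *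
        (((k.factorial : ℝ≥0∞))⁻¹ * J G k)),
      ← Finset.HasAntidiagonal.sigmaAntidiagonalEquivProd.tsum_eq, ENNReal.tsum_sigma']
    congr 1; funext n
    rw [tsum_fintype, ← Finset.sum_coe_sort (Finset.HasAntidiagonal.antidiagonal n)]
    rfl
  rw [hL]
  congr 1; funext n
  rw [lintegral_finsetSum (f := fun (S : Finset (Fin n)) (x : Fin n → X) =>
    F (S.val.map x) * G (Sᶜ.val.map x)) _
    fun S _ => (hF.comp_subfamily S).mul (hG.comp_subfamily Sᶜ)]
  simp_rw [lintegral_split ρ _ hF hG]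
  have hmap : ∀ S : Finset (Fin n), S.card ∈ Finset.range (n + 1) := fun S => by
    simpa [Nat.lt_succ_iff] using Finset.card_le_univ S
  rw [← Finset.sum_fiberwise_of_maps_to (fun S _ => hmap S), Finset.mul_sum,
    Finset.Nat.sum_antidiagonal_eq_sum_range_succ
      (fun m k => ((m.factorial : ℝ≥0∞))⁻¹ * J F m * (((k.factorial : ℝ≥0∞))⁻¹ * J G k))]
  refine Finset.sum_congr rfl fun m hm => ?_
  have hm : m ≤ n := Nat.lt_succ_iff.1 (Finset.mem_range.1 hm)
  have : ∑ S : Finset (Fin n) with S.card = m, J F S.card * J G (n - S.card)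
      = (n.choose m : ℝ≥0∞) * (J F m * J G (n - m)) := by
    rw [Finset.sum_congr rfl (g := fun _ => J F m * J G (n - m))
      (fun S hS => by rw [(Finset.mem_filter.1 hS).2]), Finset.sum_const, nsmul_eq_mul]
    congr 2
    rw [← Finset.powerset_univ, ← Finset.powersetCard_eq_filter, Finset.card_powersetCard]
    simp
  change _ = _ * ∑ S : Finset (Fin n) with S.card = m, J F S.card * J G (n - S.card)
  rw [this]
  have hfac : ((n.factorial : ℝ≥0∞))⁻¹ * (n.choose m : ℝ≥0∞)
      = ((m.factorial : ℝ≥0∞))⁻¹ * (((n - m).factorial : ℝ≥0∞))⁻¹ := by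
    have h0 : ∀ k : ℕ, (k.factorial : ℝ≥0∞) ≠ 0 := fun k => by
      exact_mod_cast k.factorial_ne_zero
    have ht : ∀ k : ℕ, (k.factorial : ℝ≥0∞) ≠ ∞ := fun k => ENNReal.natCast_ne_top _
    rw [← ENNReal.mul_inv (Or.inl (h0 _)) (Or.inl (ht _)), ← Nat.choose_mul_factorial_mul_factorial hm]
    push_cast
    rw [mul_assoc, ENNReal.mul_inv (Or.inr (ENNReal.mul_ne_top (ht _) (ht _)))
      (Or.inl (ENNReal.natCast_ne_top _)), mul_comm, ← mul_assoc, ENNReal.mul_inv_cancel, one_mul]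
    · exact_mod_cast (Nat.choose_pos hm).ne'
    · exact ENNReal.natCast_ne_top _
  rw [← mul_assoc (_)⁻¹ (n.choose m : ℝ≥0∞), hfac]
  ring

/-- A four functions theorem for finite point configurations. -/
theorem poissonIntegral_four_functions {F₁ F₂ F₃ F₄ : Multiset X → ℝ≥0}
    (h₁ : MultisetMeasurable F₁) (h₂ : MultisetMeasurable F₂) (h₃ : MultisetMeasurable F₃)
    (h₄ : MultisetMeasurable F₄)
    (h : ∀ (n : ℕ) (x : Fin n → X), ∃ B : Finset (Fin n), ∀ S T,
      F₁ (S.val.map x) * F₂ (T.val.map x) ≤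
        F₃ ((twistSup B S T).val.map x) * F₄ ((twistInf B S T).val.map x)) :
    poissonIntegral ρ (fun M => F₁ M) * poissonIntegral ρ (fun M => F₂ M) ≤
      poissonIntegral ρ (fun M => F₃ M) * poissonIntegral ρ (fun M => F₄ M) := by
  rw [poissonIntegral_mul ρ (fun n => (h₁ n).coe_nnreal_ennreal)
      (fun n => (h₂ n).coe_nnreal_ennreal),
    poissonIntegral_mul ρ (fun n => (h₃ n).coe_nnreal_ennreal)
      (fun n => (h₄ n).coe_nnreal_ennreal)]
  refine ENNReal.tsum_le_tsum fun n => mul_le_mul_right (lintegral_mono fun x => ?_) _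
  obtain ⟨B, hB⟩ := h n x
  have := four_functions_compl B (fun S => F₁ (S.val.map x)) (fun S => F₂ (S.val.map x))
    (fun S => F₃ (S.val.map x)) (fun S => F₄ (S.val.map x)) hB
  simp only [← ENNReal.coe_mul, ← ENNReal.ofNNReal_finsetSum]
  exact ENNReal.coe_le_coe.2 this

lemma lintegral_insertNth {n : ℕ} (i : Fin (n + 1)) {G : (Fin (n + 1) → X) → ℝ≥0∞}
    (hG : Measurable G) :
    ∫⁻ x, G x ∂(Measure.pi fun _ => ρ) =
      ∫⁻ y, ∫⁻ z : Fin n → X, G (i.insertNth (α := fun _ => X) y z) ∂(Measure.pi fun _ => ρ) ∂ρ := by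
  have h := (measurePreserving_piFinSuccAbove (fun _ : Fin (n + 1) => ρ) i).symm
  rw [← h.lintegral_comp_emb (MeasurableEquiv.measurableEmbedding _), lintegral_prod]
  · rfl
  · exact (hG.comp (MeasurableEquiv.measurable _)).aemeasurable

lemma integral_insertNth {n : ℕ} (i : Fin (n + 1)) {G : (Fin (n + 1) → X) → ℝ}
    (hG : Integrable G (Measure.pi fun _ => ρ)) :
    ∫ x, G x ∂(Measure.pi fun _ => ρ) =
      ∫ z : Fin n → X, ∫ y, G (i.insertNth (α := fun _ => X) y z) ∂ρ ∂(Measure.pi fun _ => ρ) := by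
  have h := (measurePreserving_piFinSuccAbove (fun _ : Fin (n + 1) => ρ) i).symm
  rw [← h.integral_comp (MeasurableEquiv.measurableEmbedding _), integral_prod_symm]
  · rfl
  · exact (h.integrable_comp_emb (MeasurableEquiv.measurableEmbedding _)).2 hG

lemma map_univ_insertNth {Y : Type*} {n : ℕ} (i : Fin (n + 1)) (y : Y) (z : Fin n → Y) :
    Finset.univ.val.map (i.insertNth (α := fun _ => Y) y z) = y ::ₘ Finset.univ.val.map z := by
  rw [Fin.univ_succAbove n i]
  simp [Finset.map_val, Function.comp_def]

lemma measurable_insertNth {n : ℕ} (i : Fin (n + 1)) :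
    Measurable fun p : X × (Fin n → X) => i.insertNth (α := fun _ => X) p.1 p.2 :=
  (MeasurableEquiv.piFinSuccAbove (fun _ => X) i).symm.measurable

open Classical in
/-- The Mecke formula for `∑ₙ ρⁿ / n!`. -/
theorem poissonIntegral_mecke {H : X → Multiset X → ℝ≥0∞}
    (hH : ∀ n : ℕ, Measurable fun p : X × (Fin n → X) => H p.1 (Finset.univ.val.map p.2)) :
    poissonIntegral ρ (fun M => (M.map fun a => H a (M.erase a)).sum)
      = ∫⁻ a, poissonIntegral ρ (H a) ∂ρ := by
  unfold poissonIntegral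
  have hin : ∀ n : ℕ, Measurable fun a => ∫⁻ z : Fin n → X, H a (Finset.univ.val.map z)
      ∂(Measure.pi fun _ => ρ) := fun n => (hH n).lintegral_prod_right'
  rw [lintegral_tsum fun n => ((hin n).const_mul _).aemeasurable,
    tsum_eq_zero_add' ENNReal.summable]
  simp only [Finset.univ_eq_empty, Finset.empty_val, Multiset.map_zero, Multiset.sum_zero,
    lintegral_zero, mul_zero, zero_add]
  congr 1; funext n
  rw [lintegral_const_mul _ (hin n)]
  let R : Fin (n + 1) → (Fin (n + 1) → X) → ℝ≥0∞ := fun i x =>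
    H (x i) (Finset.univ.val.map fun j => x (i.succAbove j))
  have hR : ∀ i, Measurable (R i) := fun i => (hH n).comp
    (g := fun p : X × (Fin n → X) => H p.1 (Finset.univ.val.map p.2))
    (f := fun x : Fin (n + 1) → X => (x i, fun j => x (i.succAbove j)))
    ((measurable_pi_apply i).prodMk (measurable_pi_lambda _ fun j => measurable_pi_apply _))
  have hsum : ∀ x : Fin (n + 1) → X, ((Finset.univ.val.map x).map fun a =>
      H a ((Finset.univ.val.map x).erase a)).sum = ∑ i, R i x := by
    intro x
    rw [Multiset.map_map]
    change ∑ i, _ = _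
    refine Finset.sum_congr rfl fun i _ => ?_
    simp only [Function.comp, R]
    congr 1
    have h1 := map_univ_insertNth i (x i) (fun j => x (i.succAbove j))
    have h2 : (i.insertNth (α := fun _ => X) (x i) fun j => x (i.succAbove j)) = x :=
      Fin.insertNth_self_removeNth i x
    rw [h2] at h1
    rw [h1, Multiset.erase_cons_head]
  simp_rw [hsum]
  rw [lintegral_finsetSum _ fun i _ => hR i]
  have hval : ∀ i, ∫⁻ x, R i x ∂(Measure.pi fun _ => ρ) =
      ∫⁻ a, ∫⁻ z : Fin n → X, H a (Finset.univ.val.map z) ∂(Measure.pi fun _ => ρ) ∂ρ := by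
    intro i
    rw [lintegral_insertNth ρ i (hR i)]
    simp [R]
  simp_rw [hval]
  rw [Finset.sum_const, Finset.card_univ, Fintype.card_fin, nsmul_eq_mul, ← mul_assoc]
  congr 1
  rw [Nat.factorial_succ, Nat.cast_mul, ENNReal.mul_inv (Or.inr (ENNReal.natCast_ne_top _))
    (Or.inl (ENNReal.natCast_ne_top _)), mul_right_comm, ENNReal.inv_mul_cancel, one_mul]
  · exact_mod_cast Nat.succ_ne_zero n
  · exact ENNReal.natCast_ne_top _

end PoissonIntegral

end

section

section ConfigMeasurable

variable {D : Type*} [MeasurableSpace D]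

lemma measurableSet_config {s : Set (Config D)} :
    MeasurableSet s ↔ ∀ n, MeasurableSet (Sigma.mk n ⁻¹' s) := by
  change MeasurableSet[Sigma.instMeasurableSpace] s ↔ _
  unfold Sigma.instMeasurableSpace
  rw [MeasurableSpace.measurableSet_iInf]
  rfl

lemma measurable_config {β : Type*} [MeasurableSpace β] {f : Config D → β} :
    Measurable f ↔ ∀ n : ℕ, Measurable fun x : Fin n → Particle D => f ⟨n, x⟩ := by
  constructor
  · intro h n s hs
    exact measurableSet_config.1 (h hs) n
  · intro h s hs
    exact measurableSet_config.2 fun n => h n hs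

lemma measurable_configMk (n : ℕ) :
    Measurable fun x : Fin n → Particle D => (⟨n, x⟩ : Config D) :=
  fun _ hs => measurableSet_config.1 hs n

lemma measurable_config_length : Measurable fun γ : Config D => γ.1 :=
  measurable_config.2 fun _ => measurable_const

lemma measurable_append {n : ℕ} :
    Measurable fun p : (Fin n → Particle D) × Particle D => append ⟨n, p.1⟩ p.2 := by
  have : (fun p : (Fin n → Particle D) × Particle D => append ⟨n, p.1⟩ p.2) = fun p =>
      (⟨n + 1, (Fin.last n).insertNth (α := fun _ => Particle D) p.2 p.1⟩ : Config D) := by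
    funext p
    simp [append, Fin.insertNth_last']
  rw [this]
  exact (measurable_configMk _).comp ((measurable_insertNth _).comp measurable_swap)

lemma integrable_append (lam : Measure D) [IsFiniteMeasure lam] {f : Config D → ℝ}
    (hf : Measurable f) {C : ℝ} (hC : ∀ γ, |f γ| ≤ C) (γ : Config D) (s : Set (Particle D)) :
    IntegrableOn (fun y => f (append γ y)) s (lamBar lam) := by
  refine Integrable.of_bound (C := C) ?_ (Filter.Eventually.of_forall fun y => hC _)
  exact (hf.comp (measurable_append.comp measurable_prodMk_left)).aestronglyMeasurable

end ConfigMeasurable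

variable {D : Type*} [MetricSpace D] [MeasurableSpace D]

/-- The part of the particle space that can be matched to the configuration. -/
def nbhdUnion (γ : Config D) : Set (Particle D) := ⋃ i : Fin γ.1, nbhd (γ.2 i)

/-- The departure rate of the `i`-th particle. -/
def rate (lam : Measure D) (mu : ℝ) (γ : Config D) (i : Fin γ.1) : ℝ :=
  mu + (lamBar lam).real (priorityRegion γ i)

lemma generator_def (lam : Measure D) (mu : ℝ) (f : Config D → ℝ) (γ : Config D) :
    generator lam mu f γ = (∑ i : Fin γ.1, rate lam mu γ i * (f (remove γ i) - f γ))
      + ∫ y in (nbhdUnion γ)ᶜ, (f (append γ y) - f γ) ∂(lamBar lam) := rfl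

lemma le_rate (lam : Measure D) (mu : ℝ) (γ : Config D) (i : Fin γ.1) : mu ≤ rate lam mu γ i := by
  unfold rate; linarith [measureReal_nonneg (μ := lamBar lam) (s := priorityRegion γ i)]

lemma rate_le (lam : Measure D) [IsFiniteMeasure lam] (mu : ℝ) (γ : Config D) (i : Fin γ.1) :
    rate lam mu γ i ≤ mu + (lamBar lam).real univ := by
  unfold rate
  gcongr
  · exact measure_ne_top _ _
  · exact subset_univ _

lemma remove_fst {D : Type*} (γ : Config D) (i : Fin γ.1) : (remove γ i).1 + 1 = γ.1 := by
  rcases γ with ⟨_ | n, x⟩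
  · exact i.elim0
  · rfl

/-- The total rate of departures, weighted with the values of `f` after the departure. -/
def downPart (lam : Measure D) (mu : ℝ) (f : Config D → ℝ) (γ : Config D) : ℝ :=
  ∑ i : Fin γ.1, rate lam mu γ i * f (remove γ i)

/-- The total rate of arrivals, weighted with the values of `f` after the arrival. -/
def upPart (lam : Measure D) (f : Config D → ℝ) (γ : Config D) : ℝ :=
  ∫ y in (nbhdUnion γ)ᶜ, f (append γ y) ∂(lamBar lam)

lemma generator_eq_zero (lam : Measure D) (mu : ℝ) {f : Config D → ℝ} {n : ℕ}
    (hn : ∀ γ : Config D, n < γ.1 → f γ = 0) {γ : Config D} (hγ : n + 1 < γ.1) :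
    generator lam mu f γ = 0 := by
  rw [generator_def]
  have h1 : ∀ i, f (remove γ i) = 0 := fun i => hn _ (by have := remove_fst γ i; omega)
  have h2 : ∀ y, f (append γ y) = 0 := fun y => hn _ (by simp only [append]; omega)
  have h3 : f γ = 0 := hn _ (by omega)
  simp [h1, h2, h3]

lemma abs_generator_le (lam : Measure D) [IsFiniteMeasure lam] {mu : ℝ} (hmu : 0 < mu)
    {f : Config D → ℝ} {C : ℝ} (hC : ∀ γ, |f γ| ≤ C) (hC0 : 0 ≤ C) {n : ℕ}
    (hn : ∀ γ : Config D, n < γ.1 → f γ = 0) (γ : Config D) :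
    |generator lam mu f γ| ≤ ((n : ℝ) + 1) * ((mu + (lamBar lam).real univ) * (2 * C))
      + 2 * C * (lamBar lam).real univ := by
  have hL : 0 ≤ (lamBar lam).real univ := measureReal_nonneg
  by_cases hγ : n + 1 < γ.1
  · rw [generator_eq_zero lam mu hn hγ]; simp; positivity
  · have h2 : ∀ γ γ', |f γ - f γ'| ≤ 2 * C := fun γ γ' => by
      have := abs_sub (f γ) (f γ'); linarith [hC γ, hC γ']
    rw [generator_def]
    refine (abs_add_le _ _).trans (add_le_add ?_ ?_)
    · refine (Finset.abs_sum_le_sum_abs _ _).trans ?_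
      calc _ ≤ ∑ i : Fin γ.1, (mu + (lamBar lam).real univ) * (2 * C) := by
            refine Finset.sum_le_sum fun i _ => ?_
            rw [abs_mul, abs_of_nonneg (hmu.le.trans (le_rate lam mu γ i))]
            exact mul_le_mul (rate_le lam mu γ i) (h2 _ _) (abs_nonneg _) (by positivity)
        _ = (γ.1 : ℝ) * ((mu + (lamBar lam).real univ) * (2 * C)) := by simp
        _ ≤ _ := by
            have : (γ.1 : ℝ) ≤ n + 1 := by exact_mod_cast (by omega : γ.1 ≤ n + 1)
            gcongr
    · rw [← Real.norm_eq_abs]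
      refine (norm_setIntegral_le_of_norm_le_const (C := 2 * C)
        (measure_lt_top _ _) fun y _ => h2 _ _).trans ?_
      gcongr
      · exact measure_ne_top _ _
      · exact subset_univ _

lemma generator_eq (lam : Measure D) [IsFiniteMeasure lam] (mu : ℝ) {f : Config D → ℝ}
    (hf : Measurable f) {C : ℝ} (hC : ∀ γ, |f γ| ≤ C) (γ : Config D) :
    generator lam mu f γ = downPart lam mu f γ - (∑ i, rate lam mu γ i) * f γ
      + (upPart lam f γ - (lamBar lam).real (nbhdUnion γ)ᶜ * f γ) := by
  rw [generator_def, integral_sub (integrable_append lam hf hC γ _) (integrable_const _)]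
  simp [downPart, upPart, mul_sub, Finset.sum_sub_distrib, Finset.sum_mul]

variable [BorelSpace D]

lemma measurableSet_nbhdUnion (γ : Config D) : MeasurableSet (nbhdUnion γ) :=
  MeasurableSet.iUnion fun _ => measurableSet_nbhd _

lemma rate_eq_cov (lam : Measure D) [IsFiniteMeasure lam] (mu : ℝ) {n : ℕ}
    (x : Fin n → Particle D) (i : Fin n) :
    rate lam mu ⟨n, x⟩ i = mu + (cov lam x (i + 1) - cov lam x i) := by
  have hsub : (⋃ j : Fin n, ⋃ _ : (j : ℕ) < i, nbhd (x j)) ⊆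
      ⋃ j : Fin n, ⋃ _ : (j : ℕ) < i + 1, nbhd (x j) :=
    iUnion_mono fun j => iUnion_subset fun h => subset_iUnion_of_subset (by omega) subset_rfl
  unfold rate cov
  rw [← measureReal_sdiff hsub (MeasurableSet.iUnion fun j => MeasurableSet.iUnion fun _ =>
    measurableSet_nbhd _) (measure_ne_top _ _)]
  congr 2
  ext q
  simp only [priorityRegion, mem_sdiff, mem_iUnion, exists_prop, not_exists, not_and]
  constructor
  · rintro ⟨h1, h2⟩
    exact ⟨⟨i, by omega, h1⟩, fun j hj => h2 j hj⟩
  · rintro ⟨⟨j, hj, h1⟩, h2⟩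
    refine ⟨?_, fun j hj => h2 j hj⟩
    by_cases h : (j : ℕ) < i
    · exact absurd h1 (h2 j h)
    · have : j = i := by ext; omega
      exact this ▸ h1

lemma sum_rate (lam : Measure D) [IsFiniteMeasure lam] (mu : ℝ) {n : ℕ}
    (x : Fin n → Particle D) :
    ∑ i, rate lam mu ⟨n, x⟩ i = (n : ℝ) * mu + cov lam x n := by
  simp_rw [rate_eq_cov]
  rw [Finset.sum_add_distrib, Fin.sum_univ_eq_sum_range (fun i => cov lam x (i + 1) - cov lam x i),
    Finset.sum_range_sub, cov_zero]
  simp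

lemma upPart_eq (lam : Measure D) (f : Config D → ℝ) (γ : Config D) :
    upPart lam f γ = ∫ y, (nbhdUnion γ)ᶜ.indicator (fun y => f (append γ y)) y ∂(lamBar lam) :=
  (integral_indicator (measurableSet_nbhdUnion γ).compl).symm

variable [SecondCountableTopology D]

lemma measurableSet_nbhd_prod {n : ℕ} (j : Fin n) :
    MeasurableSet {p : (Fin n → Particle D) × Particle D | p.2 ∈ nbhd (p.1 j)} := by
  have : {p : (Fin n → Particle D) × Particle D | p.2 ∈ nbhd (p.1 j)} =
      {p | dist p.2.1 (p.1 j).1 < 1} ∩ {p | p.2.2 = !(p.1 j).2} := by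
    ext p; simp [nbhd, mem_prod]
  rw [this]
  refine MeasurableSet.inter (measurableSet_lt (Measurable.dist ?_ ?_) measurable_const)
    (measurableSet_eq_fun ?_ ?_)
  · fun_prop
  · fun_prop
  · fun_prop
  · exact (measurable_of_finite (fun b : Bool => !b)).comp (by fun_prop)

lemma measurable_cov (lam : Measure D) [IsFiniteMeasure lam] {n : ℕ} (k : ℕ) :
    Measurable fun x : Fin n → Particle D => cov lam x k := by
  have hs : MeasurableSet {p : (Fin n → Particle D) × Particle D |
      p.2 ∈ ⋃ j : Fin n, ⋃ _ : (j : ℕ) < k, nbhd (p.1 j)} := by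
    have : {p : (Fin n → Particle D) × Particle D |
        p.2 ∈ ⋃ j : Fin n, ⋃ _ : (j : ℕ) < k, nbhd (p.1 j)} =
        ⋃ j : Fin n, ⋃ _ : (j : ℕ) < k, {p | p.2 ∈ nbhd (p.1 j)} := by
      ext p; simp
    rw [this]
    exact MeasurableSet.iUnion fun j => MeasurableSet.iUnion fun _ => measurableSet_nbhd_prod j
  exact (measurable_measure_prodMk_left (ν := lamBar lam) hs).ennreal_toReal

lemma measurable_weight (lam : Measure D) [IsFiniteMeasure lam] (mu : ℝ) {n : ℕ} :
    Measurable fun x : Fin n → Particle D => weight lam mu x := by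
  unfold weight
  exact Finset.measurable_prod _ fun k _ => ((measurable_cov lam _).add_const _).inv

lemma measurableSet_valid (n : ℕ) : MeasurableSet {x : Fin n → Particle D | Valid x} := by
  have : {x : Fin n → Particle D | Valid x} = ⋂ i, ⋂ j, {x | x i ∉ nbhd (x j)} := by
    ext x; simp [Valid]
  rw [this]
  refine MeasurableSet.iInter fun i => MeasurableSet.iInter fun j => MeasurableSet.compl ?_
  exact (measurable_id.prodMk (measurable_pi_apply i)) (measurableSet_nbhd_prod j)

lemma measurableSet_nbhdUnion_prod (n : ℕ) :
    MeasurableSet {p : (Fin n → Particle D) × Particle D | p.2 ∈ nbhdUnion ⟨n, p.1⟩} := by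
  have : {p : (Fin n → Particle D) × Particle D | p.2 ∈ nbhdUnion ⟨n, p.1⟩} =
      ⋃ j : Fin n, {p | p.2 ∈ nbhd (p.1 j)} := by
    ext p; simp [nbhdUnion]
  rw [this]
  exact MeasurableSet.iUnion fun j => measurableSet_nbhd_prod j

lemma measurable_rate (lam : Measure D) [IsFiniteMeasure lam] (mu : ℝ) {n : ℕ} (i : Fin n) :
    Measurable fun x : Fin n → Particle D => rate lam mu ⟨n, x⟩ i := by
  simp_rw [rate_eq_cov]
  exact ((measurable_cov lam _).sub (measurable_cov lam _)).const_add _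

lemma measurable_downPart (lam : Measure D) [IsFiniteMeasure lam] (mu : ℝ) {f : Config D → ℝ}
    (hf : Measurable f) : Measurable (downPart lam mu f) := by
  refine measurable_config.2 fun n => ?_
  refine Finset.measurable_sum (f := fun (i : Fin n) (x : Fin n → Particle D) =>
    rate lam mu ⟨n, x⟩ i * f (remove ⟨n, x⟩ i)) (Finset.univ : Finset (Fin n)) fun i _ => (measurable_rate lam mu i).mul ?_
  rcases n with _ | n
  · exact i.elim0
  · exact hf.comp ((measurable_configMk n).comp
      (measurable_pi_lambda _ fun j => measurable_pi_apply _))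

lemma measurable_upIndicator {f : Config D → ℝ} (hf : Measurable f) (n : ℕ) :
    Measurable fun p : (Fin n → Particle D) × Particle D =>
      (nbhdUnion ⟨n, p.1⟩)ᶜ.indicator (fun y => f (append ⟨n, p.1⟩ y)) p.2 :=
  (hf.comp measurable_append).indicator (measurableSet_nbhdUnion_prod n).compl

lemma measurable_upPart (lam : Measure D) [IsFiniteMeasure lam] {f : Config D → ℝ}
    (hf : Measurable f) : Measurable (upPart lam f) := by
  refine measurable_config.2 fun n => ?_
  simp_rw [upPart_eq]
  exact (measurable_upIndicator hf n).stronglyMeasurable.integral_prod_right.measurable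

lemma measurable_generator (lam : Measure D) [IsFiniteMeasure lam] (mu : ℝ) {f : Config D → ℝ}
    (hf : Measurable f) {C : ℝ} (hC : ∀ γ, |f γ| ≤ C) : Measurable (generator lam mu f) := by
  rw [funext (generator_eq lam mu hf hC)]
  refine ((measurable_downPart lam mu hf).sub (Measurable.mul ?_ hf)).add
    ((measurable_upPart lam hf).sub (Measurable.mul ?_ hf))
  · exact measurable_config.2 fun n => Finset.measurable_sum
      (f := fun (i : Fin n) (x : Fin n → Particle D) => rate lam mu ⟨n, x⟩ i) (Finset.univ : Finset (Fin n))
      fun i _ => measurable_rate lam mu i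
  · refine measurable_config.2 fun n => ?_
    exact (measurable_measure_prodMk_left (ν := lamBar lam)
      (measurableSet_nbhdUnion_prod (D := D) n).compl).ennreal_toReal

/-- `π` annihilates the generator. -/
def IsInvariant (lam : Measure D) (mu : ℝ) (π : Measure (Config D)) : Prop :=
  ∀ (n : ℕ) (f : Config D → ℝ), Measurable f → (∃ C, ∀ γ, |f γ| ≤ C) →
    (∀ γ : Config D, n < γ.1 → f γ = 0) → ∫ γ, generator lam mu f γ ∂π = 0

lemma integrable_generator (lam : Measure D) [IsFiniteMeasure lam] {mu : ℝ} (hmu : 0 < mu)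
    {f : Config D → ℝ} (hf : Measurable f) {C : ℝ} (hC : ∀ γ, |f γ| ≤ C) {n : ℕ}
    (hn : ∀ γ : Config D, n < γ.1 → f γ = 0) (π : Measure (Config D)) [IsFiniteMeasure π] :
    Integrable (generator lam mu f) π := by
  have hC0 : 0 ≤ C := (abs_nonneg _).trans (hC ⟨0, Fin.elim0⟩)
  exact Integrable.of_bound (measurable_generator lam mu hf hC).aestronglyMeasurable _
    (Filter.Eventually.of_forall (abs_generator_le lam hmu hC hC0 hn))

end

section

/-- The telescoping identity behind the product form. -/
lemma sum_mul_prod_inv_telescope (a b : ℕ → ℝ) (ha0 : a 0 = 0) (ha : ∀ k, a (k + 1) ≠ 0)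
    (hb : ∀ k, b k ≠ 0) (m : ℕ) :
    ∑ i ∈ Finset.range (m + 1),
      (b i - a i) * ∏ k ∈ Finset.range (m + 1), (if k < i then a (k + 1) else b k)⁻¹
      = ∏ k ∈ Finset.range m, (a (k + 1))⁻¹ := by
  induction m with
  | zero => simp [ha0, hb]
  | succ m ih =>
    rw [Finset.sum_range_succ]
    have h1 : ∀ i ∈ Finset.range (m + 1),
        (b i - a i) * ∏ k ∈ Finset.range (m + 1 + 1), (if k < i then a (k + 1) else b k)⁻¹
        = ((b i - a i) * ∏ k ∈ Finset.range (m + 1), (if k < i then a (k + 1) else b k)⁻¹) *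
          (b (m + 1))⁻¹ := by
      intro i hi
      have : ¬ m + 1 < i := by have := Finset.mem_range.1 hi; omega
      rw [Finset.prod_range_succ, if_neg this, mul_assoc]
    rw [Finset.sum_congr rfl h1, ← Finset.sum_mul, ih, Finset.prod_range_succ _ (m + 1)]
    have h2 : ∏ k ∈ Finset.range (m + 1), (if k < m + 1 then a (k + 1) else b k)⁻¹
        = ∏ k ∈ Finset.range (m + 1), (a (k + 1))⁻¹ :=
      Finset.prod_congr rfl fun k hk => by rw [if_pos (Finset.mem_range.1 hk)]
    rw [h2, if_neg (lt_irrefl _), Finset.prod_range_succ]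
    have := ha m
    have := hb (m + 1)
    field_simp
    ring

lemma measurable_comp_removeNth {D : Type*} [MeasurableSpace D] {f : Config D → ℝ} (hf : Measurable f) {n : ℕ}
    (i : Fin (n + 1)) :
    Measurable fun x : Fin (n + 1) → Particle D => f ⟨n, i.removeNth x⟩ := by
  have h : Measurable fun x : Fin (n + 1) → Particle D => (i.removeNth x : Fin n → Particle D) :=
    measurable_pi_lambda _ fun j => measurable_pi_apply (i.succAbove j)
  exact (measurable_config.1 hf n).comp h

variable {D : Type*} [MetricSpace D]

lemma valid_insertNth {n : ℕ} (i : Fin (n + 1)) (y : Particle D) (z : Fin n → Particle D) :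
    Valid (i.insertNth (α := fun _ => Particle D) y z) ↔ Valid z ∧ y ∉ nbhdUnion ⟨n, z⟩ := by
  simp only [Valid, Fin.forall_iff_succAbove i, Fin.insertNth_apply_same,
    Fin.insertNth_apply_succAbove, nbhdUnion, mem_iUnion, not_exists]
  constructor
  · rintro ⟨⟨_, h1⟩, h2⟩
    exact ⟨fun j => (h2 j).2, h1⟩
  · rintro ⟨h1, h2⟩
    exact ⟨⟨notMem_nbhd_self y, h2⟩, fun j => ⟨fun h => h2 j (mem_nbhd_comm.1 h), h1 j⟩⟩

variable [MeasurableSpace D]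

lemma cov_insertNth_le (lam : Measure D) {n : ℕ} (i : Fin (n + 1)) (y : Particle D)
    (z : Fin n → Particle D) {k : ℕ} (hk : k ≤ i) :
    cov lam (i.insertNth (α := fun _ => Particle D) y z) k = cov lam z k := by
  unfold cov
  congr 1
  ext q
  simp only [mem_iUnion, exists_prop, Fin.exists_iff_succAbove i, Fin.insertNth_apply_same,
    Fin.insertNth_apply_succAbove]
  constructor
  · rintro (⟨h, _⟩ | ⟨j, h, hq⟩)
    · omega
    · refine ⟨j, ?_, hq⟩
      simp only [Fin.succAbove, Fin.lt_def] at h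
      split_ifs at h <;> simp at h <;> omega
  · rintro ⟨j, h, hq⟩
    refine Or.inr ⟨j, ?_, hq⟩
    rw [Fin.succAbove_of_castSucc_lt]
    · simpa using h
    · rw [Fin.lt_def]; simp; omega

/-- The mass matched to `y` or one of the first `k` particles. -/
def covWith (lam : Measure D) {n : ℕ} (y : Particle D) (z : Fin n → Particle D) (k : ℕ) : ℝ :=
  (lamBar lam).real (nbhd y ∪ ⋃ j : Fin n, ⋃ _ : (j : ℕ) < k, nbhd (z j))

lemma cov_insertNth_gt (lam : Measure D) {n : ℕ} (i : Fin (n + 1)) (y : Particle D)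
    (z : Fin n → Particle D) {k : ℕ} (hk : i ≤ k) :
    cov lam (i.insertNth (α := fun _ => Particle D) y z) (k + 1) = covWith lam y z k := by
  unfold cov covWith
  congr 1
  ext q
  simp only [mem_iUnion, exists_prop, Fin.exists_iff_succAbove i, Fin.insertNth_apply_same,
    Fin.insertNth_apply_succAbove, mem_union]
  refine or_congr ⟨fun h => h.2, fun h => ⟨by omega, h⟩⟩ (exists_congr fun j => and_congr_left' ?_)
  simp only [Fin.succAbove, Fin.lt_def]
  split_ifs with h <;> simp at h ⊢ <;> omega

lemma weight_eq_range (lam : Measure D) (mu : ℝ) {n : ℕ} (x : Fin n → Particle D) :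
    weight lam mu x = ∏ k ∈ Finset.range n, (cov lam x (k + 1) + ((k : ℝ) + 1) * mu)⁻¹ :=
  Fin.prod_univ_eq_prod_range (fun k : ℕ => (cov lam x (k + 1) + ((k : ℝ) + 1) * mu)⁻¹) n

open Classical in
/-- The unnormalized stationary density of ordered configurations. -/
def density (lam : Measure D) (mu : ℝ) {n : ℕ} (x : Fin n → Particle D) : ℝ :=
  if Valid x then weight lam mu x else 0

lemma density_nonneg (lam : Measure D) {mu : ℝ} (hmu : 0 < mu) {n : ℕ}
    (x : Fin n → Particle D) : 0 ≤ density lam mu x := by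
  unfold density; split_ifs
  · exact weight_nonneg lam hmu x
  · rfl

lemma density_le (lam : Measure D) {mu : ℝ} (hmu : 0 < mu) {n : ℕ}
    (x : Fin n → Particle D) : density lam mu x ≤ ((n.factorial : ℝ) * mu ^ n)⁻¹ := by
  unfold density; split_ifs
  · exact weight_le lam hmu x
  · positivity

lemma abs_sum_rate_le (lam : Measure D) [IsFiniteMeasure lam] {mu : ℝ} (hmu : 0 < mu) {n : ℕ} (x : Fin n → Particle D) :
    |∑ i, rate lam mu ⟨n, x⟩ i| ≤ n * (mu + (lamBar lam).real univ) := by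
  rw [abs_of_nonneg (Finset.sum_nonneg fun i _ => hmu.le.trans (le_rate lam mu ⟨n, x⟩ i))]
  exact (Finset.sum_le_sum fun i _ => rate_le lam mu ⟨n, x⟩ i).trans_eq (by simp; ring)

variable [BorelSpace D]

lemma sum_weight_insertNth (lam : Measure D) [IsFiniteMeasure lam] {mu : ℝ} (hmu : 0 < mu) {n : ℕ}
    (y : Particle D) (z : Fin n → Particle D) :
    ∑ i : Fin (n + 1), weight lam mu (i.insertNth (α := fun _ => Particle D) y z) *
      rate lam mu ⟨n + 1, i.insertNth (α := fun _ => Particle D) y z⟩ i = weight lam mu z := by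
  set a : ℕ → ℝ := fun k => cov lam z k + k * mu with ha
  set b : ℕ → ℝ := fun k => covWith lam y z k + ((k : ℝ) + 1) * mu with hb
  have hterm : ∀ i : Fin (n + 1), weight lam mu (i.insertNth (α := fun _ => Particle D) y z) *
      rate lam mu ⟨n + 1, i.insertNth (α := fun _ => Particle D) y z⟩ i =
      (b i - a i) * ∏ k ∈ Finset.range (n + 1), (if k < (i : ℕ) then a (k + 1) else b k)⁻¹ := by
    intro i
    rw [mul_comm, rate_eq_cov, weight_eq_range, cov_insertNth_le lam i y z le_rfl,
      cov_insertNth_gt lam i y z le_rfl]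
    congr 1
    · simp only [ha, hb]; ring
    · refine Finset.prod_congr rfl fun k _ => ?_
      split_ifs with h
      · rw [cov_insertNth_le lam i y z (by omega)]; simp [ha]
      · rw [cov_insertNth_gt lam i y z (by omega)]
  have hpos : ∀ k, 0 < b k := fun k => by
    have : 0 ≤ covWith lam y z k := measureReal_nonneg
    simp only [hb]; positivity
  have hapos : ∀ k, 0 < a (k + 1) := fun k => by
    have : 0 ≤ cov lam z (k + 1) := measureReal_nonneg
    simp only [ha]; positivity
  simp_rw [hterm]
  rw [Fin.sum_univ_eq_sum_range (fun i => (b i - a i) * ∏ k ∈ Finset.range (n + 1),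
    (if k < i then a (k + 1) else b k)⁻¹), sum_mul_prod_inv_telescope a b (by simp [ha, cov_zero])
    (fun k => (hapos k).ne') (fun k => (hpos k).ne'), weight_eq_range]
  simp [ha]

lemma sum_density_insertNth (lam : Measure D) [IsFiniteMeasure lam] {mu : ℝ} (hmu : 0 < mu) {n : ℕ}
    (y : Particle D) (z : Fin n → Particle D) :
    ∑ i : Fin (n + 1), density lam mu (i.insertNth (α := fun _ => Particle D) y z) *
      rate lam mu ⟨n + 1, i.insertNth (α := fun _ => Particle D) y z⟩ i =
      (nbhdUnion ⟨n, z⟩)ᶜ.indicator (fun _ => density lam mu z) y := by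
  classical
  simp only [density, valid_insertNth, indicator, mem_compl_iff]
  by_cases hz : Valid z
  · by_cases hy : y ∈ nbhdUnion ⟨n, z⟩
    · simp [hy]
    · simp only [hy, hz, not_false_iff, and_self, if_true]
      exact sum_weight_insertNth lam hmu y z
  · simp [hz]

lemma density_snoc_mul_rate (lam : Measure D) [IsFiniteMeasure lam] {mu : ℝ} (hmu : 0 < mu) {n : ℕ}
    (y : Particle D) (z : Fin n → Particle D) :
    density lam mu ((Fin.last n).insertNth (α := fun _ => Particle D) y z) *
      ∑ i, rate lam mu ⟨n + 1, (Fin.last n).insertNth (α := fun _ => Particle D) y z⟩ i =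
      (nbhdUnion ⟨n, z⟩)ᶜ.indicator (fun _ => density lam mu z) y := by
  classical
  simp only [density, valid_insertNth, indicator, mem_compl_iff]
  by_cases hz : Valid z
  · by_cases hy : y ∈ nbhdUnion ⟨n, z⟩
    · simp [hy]
    · simp only [hy, hz, not_false_iff, and_self, if_true]
      have hpos : ∀ x : Fin (n + 1) → Particle D,
          0 < cov lam x (n + 1) + ((n : ℝ) + 1) * mu := fun x => by
        have := cov_nonneg lam x (n + 1); positivity
      rw [sum_rate, weight_succ, Nat.cast_succ, add_comm (((n : ℝ) + 1) * mu),
        inv_mul_cancel_right₀ (hpos _).ne']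
      congr 1
      funext i
      rw [Fin.insertNth_last', Fin.snoc_castSucc]
  · simp [hz]

variable [SecondCountableTopology D]

lemma measurable_density (lam : Measure D) [IsFiniteMeasure lam] (mu : ℝ) {n : ℕ} :
    Measurable fun x : Fin n → Particle D => density lam mu x :=
  Measurable.ite (measurableSet_valid n) (measurable_weight lam mu) measurable_const

/-- The unnormalized product-form law of ordered configurations. -/
def productForm (lam : Measure D) (mu : ℝ) : Measure (Config D) :=
  Measure.sum fun n => ((Measure.pi fun _ : Fin n => lamBar lam).withDensity
    fun x => ENNReal.ofReal (density lam mu x)).map fun x => (⟨n, x⟩ : Config D)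

lemma lintegral_productForm (lam : Measure D) [IsFiniteMeasure lam] (mu : ℝ)
    {F : Config D → ℝ≥0∞} (hF : Measurable F) :
    ∫⁻ γ, F γ ∂(productForm lam mu) = ∑' n : ℕ, ∫⁻ x : Fin n → Particle D,
      ENNReal.ofReal (density lam mu x) * F ⟨n, x⟩ ∂(Measure.pi fun _ => lamBar lam) := by
  rw [productForm, lintegral_sum_measure]
  congr 1; funext n
  rw [lintegral_map hF (measurable_configMk n)]
  exact lintegral_withDensity_eq_lintegral_mul _
    (measurable_density lam mu).ennreal_ofReal (hF.comp (measurable_configMk n))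

instance isFiniteMeasure_productForm (lam : Measure D) [IsFiniteMeasure lam] (mu : ℝ)
    [hmu : Fact (0 < mu)] : IsFiniteMeasure (productForm lam mu) := by
  constructor
  rw [← lintegral_one, lintegral_productForm lam mu measurable_const]
  have hle : ∀ n : ℕ, ∫⁻ x : Fin n → Particle D, ENNReal.ofReal (density lam mu x) * 1
      ∂(Measure.pi fun _ => lamBar lam) ≤
      ENNReal.ofReal (((lamBar lam).real univ / mu) ^ n / n.factorial) := by
    intro n
    calc _ ≤ ∫⁻ x : Fin n → Particle D, ENNReal.ofReal (((n.factorial : ℝ) * mu ^ n)⁻¹)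
        ∂(Measure.pi fun _ => lamBar lam) := by
          refine lintegral_mono fun x => ?_
          rw [mul_one]
          exact ENNReal.ofReal_le_ofReal (density_le lam hmu.out x)
      _ = _ := by
          rw [lintegral_const, Measure.pi_univ, Finset.prod_const, Finset.card_univ,
            Fintype.card_fin, ← ofReal_measureReal (measure_ne_top (lamBar lam) univ),
            ← ENNReal.ofReal_pow measureReal_nonneg, ← ENNReal.ofReal_mul]
          · congr 1
            rw [div_pow]
            have := hmu.out.ne'
            field_simp
          · have := hmu.out.le; positivity
  refine (ENNReal.tsum_le_tsum hle).trans_lt ?_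
  have hs := Real.summable_pow_div_factorial ((lamBar lam).real univ / mu)
  have h0 : ∀ n : ℕ, 0 ≤ ((lamBar lam).real univ / mu) ^ n / n.factorial := fun n => by
    have := hmu.out.le
    have : 0 ≤ (lamBar lam).real univ := measureReal_nonneg
    positivity
  rw [← ENNReal.ofReal_tsum_of_nonneg h0 hs]
  exact ENNReal.ofReal_lt_top

lemma integral_productForm (lam : Measure D) [IsFiniteMeasure lam] {mu : ℝ} (hmu : 0 < mu)
    {φ : Config D → ℝ} (hφ : Measurable φ) {C : ℝ} (hC : ∀ γ, |φ γ| ≤ C) {N : ℕ}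
    (hN : ∀ γ : Config D, N ≤ γ.1 → φ γ = 0) :
    ∫ γ, φ γ ∂(productForm lam mu) = ∑ n ∈ Finset.range N, ∫ x : Fin n → Particle D,
      density lam mu x * φ ⟨n, x⟩ ∂(Measure.pi fun _ => lamBar lam) := by
  have : Fact (0 < mu) := ⟨hmu⟩
  have hint : Integrable φ (productForm lam mu) :=
    Integrable.of_bound hφ.aestronglyMeasurable C (Filter.Eventually.of_forall hC)
  have h1 := hasSum_integral_measure (μ := fun n => ((Measure.pi fun _ : Fin n =>
    lamBar lam).withDensity fun x => ENNReal.ofReal (density lam mu x)).map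
      fun x => (⟨n, x⟩ : Config D)) (f := φ) hint
  rw [productForm, ← h1.tsum_eq]
  have h2 : ∀ n : ℕ, ∫ γ, φ γ ∂(((Measure.pi fun _ : Fin n =>
      lamBar lam).withDensity fun x => ENNReal.ofReal (density lam mu x)).map
      fun x => (⟨n, x⟩ : Config D)) = ∫ x : Fin n → Particle D,
      density lam mu x * φ ⟨n, x⟩ ∂(Measure.pi fun _ => lamBar lam) := by
    intro n
    rw [integral_map (measurable_configMk n).aemeasurable hφ.aestronglyMeasurable,
      integral_withDensity_eq_integral_toReal_smul
        (measurable_density lam mu).ennreal_ofReal (by simp)]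
    refine integral_congr_ae (Filter.Eventually.of_forall fun x => ?_)
    simp [ENNReal.toReal_ofReal (density_nonneg lam hmu x)]
  simp_rw [h2]
  refine tsum_eq_sum fun n hn => ?_
  have : N ≤ n := by simpa using hn
  simp [hN ⟨n, _⟩ this]

section Balance

variable (lam : Measure D) [IsFiniteMeasure lam] {mu : ℝ} {f : Config D → ℝ}

lemma integrable_density_mul (hmu : 0 < mu) {n : ℕ} {h : (Fin n → Particle D) → ℝ}
    (hh : Measurable h) {C : ℝ} (hC : ∀ x, |h x| ≤ C) :
    Integrable (fun x => density lam mu x * h x) (Measure.pi fun _ => lamBar lam) := by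
  refine Integrable.of_bound ((measurable_density lam mu).mul hh).aestronglyMeasurable
    (((n.factorial : ℝ) * mu ^ n)⁻¹ * C) (Filter.Eventually.of_forall fun x => ?_)
  rw [Real.norm_eq_abs, abs_mul, abs_of_nonneg (density_nonneg lam hmu x)]
  exact mul_le_mul (density_le lam hmu x) (hC x) (abs_nonneg _) (by positivity)

lemma integral_insertNth_prod {X : Type*} [MeasurableSpace X] (ρ : Measure X) [SigmaFinite ρ]
    {n : ℕ} (i : Fin (n + 1)) (G : (Fin (n + 1) → X) → ℝ) :
    ∫ x, G x ∂(Measure.pi fun _ => ρ) = ∫ p : X × (Fin n → X),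
      G (i.insertNth (α := fun _ => X) p.1 p.2) ∂(ρ.prod (Measure.pi fun _ => ρ)) := by
  have h := (measurePreserving_piFinSuccAbove (fun _ : Fin (n + 1) => ρ) i).symm
  rw [← h.integral_comp (MeasurableEquiv.measurableEmbedding _)]
  rfl

lemma integrable_insertNth_prod {X : Type*} [MeasurableSpace X] {ρ : Measure X} [SigmaFinite ρ]
    {n : ℕ} (i : Fin (n + 1)) {G : (Fin (n + 1) → X) → ℝ}
    (hG : Integrable G (Measure.pi fun _ => ρ)) :
    Integrable (fun p : X × (Fin n → X) => G (i.insertNth (α := fun _ => X) p.1 p.2))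
      (ρ.prod (Measure.pi fun _ => ρ)) := by
  have h := (measurePreserving_piFinSuccAbove (fun _ : Fin (n + 1) => ρ) i).symm
  exact (h.integrable_comp_emb (MeasurableEquiv.measurableEmbedding _)).2 hG

lemma integral_density_mul_upPart (hmu : 0 < mu) (hf : Measurable f) {C : ℝ}
    (hC : ∀ γ, |f γ| ≤ C) (n : ℕ) :
    ∫ x : Fin n → Particle D, density lam mu x * upPart lam f ⟨n, x⟩
        ∂(Measure.pi fun _ => lamBar lam) =
      ∫ x : Fin (n + 1) → Particle D, density lam mu x *
        ((∑ i, rate lam mu ⟨n + 1, x⟩ i) * f ⟨n + 1, x⟩) ∂(Measure.pi fun _ => lamBar lam) := by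
  have hint : Integrable (fun x : Fin (n + 1) → Particle D => density lam mu x *
        ((∑ i, rate lam mu ⟨n + 1, x⟩ i) * f ⟨n + 1, x⟩)) (Measure.pi fun _ => lamBar lam) := by
    refine integrable_density_mul lam hmu (C := (n + 1 : ℕ) * (mu + (lamBar lam).real univ) * C)
      (Measurable.mul ?_ (measurable_config.1 hf _)) fun x => ?_
    · exact Finset.measurable_sum
        (f := fun (i : Fin (n + 1)) (x : Fin (n + 1) → Particle D) => rate lam mu ⟨n + 1, x⟩ i)
        (Finset.univ : Finset (Fin (n + 1))) fun i _ => measurable_rate lam mu i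
    · rw [abs_mul]
      exact mul_le_mul (abs_sum_rate_le lam hmu x) (hC _) (abs_nonneg _)
        ((abs_nonneg _).trans (abs_sum_rate_le lam hmu x))
  rw [integral_insertNth _ (Fin.last n) hint]
  refine integral_congr_ae (Filter.Eventually.of_forall fun z => ?_)
  dsimp only
  rw [upPart_eq, ← integral_const_mul]
  refine integral_congr_ae (Filter.Eventually.of_forall fun y => ?_)
  dsimp only
  rw [← mul_assoc, density_snoc_mul_rate lam hmu y z, Fin.insertNth_last']
  by_cases hy : y ∈ (nbhdUnion ⟨n, z⟩)ᶜ
  · simp [hy, append]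
  · simp [hy]

lemma integral_density_mul_downPart (hmu : 0 < mu) (hf : Measurable f) {C : ℝ}
    (hC : ∀ γ, |f γ| ≤ C) (n : ℕ) :
    ∫ x : Fin (n + 1) → Particle D, density lam mu x * downPart lam mu f ⟨n + 1, x⟩
        ∂(Measure.pi fun _ => lamBar lam) =
      ∫ x : Fin n → Particle D, density lam mu x *
        ((lamBar lam).real (nbhdUnion ⟨n, x⟩)ᶜ * f ⟨n, x⟩) ∂(Measure.pi fun _ => lamBar lam) := by
  have hint : ∀ i : Fin (n + 1), Integrable (fun x : Fin (n + 1) → Particle D =>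
      density lam mu x * (rate lam mu ⟨n + 1, x⟩ i * f ⟨n, i.removeNth x⟩))
      (Measure.pi fun _ => lamBar lam) := by
    intro i
    refine integrable_density_mul lam hmu (C := (mu + (lamBar lam).real univ) * C)
      ((measurable_rate lam mu i).mul (measurable_comp_removeNth hf i)) fun x => ?_
    have h0 : 0 ≤ rate lam mu ⟨n + 1, x⟩ i := hmu.le.trans (le_rate lam mu ⟨n + 1, x⟩ i)
    rw [abs_mul, abs_of_nonneg h0]
    exact mul_le_mul (rate_le lam mu ⟨n + 1, x⟩ i) (hC _) (abs_nonneg _)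
      (h0.trans (rate_le lam mu ⟨n + 1, x⟩ i))
  have h1 : ∀ x : Fin (n + 1) → Particle D, density lam mu x * downPart lam mu f ⟨n + 1, x⟩ =
      ∑ i : Fin (n + 1), density lam mu x *
        (rate lam mu ⟨n + 1, x⟩ i * f ⟨n, i.removeNth x⟩) := fun x =>
    Finset.mul_sum _ _ _
  rw [integral_congr_ae (Filter.Eventually.of_forall h1), integral_finsetSum _ fun i _ => hint i,
    Finset.sum_congr rfl fun i _ => integral_insertNth_prod (lamBar lam) i _,
    ← integral_finsetSum _ fun i _ => integrable_insertNth_prod i (hint i)]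
  have h2 : ∀ p : Particle D × (Fin n → Particle D),
      ∑ i : Fin (n + 1), density lam mu (i.insertNth (α := fun _ => Particle D) p.1 p.2) *
        (rate lam mu ⟨n + 1, i.insertNth (α := fun _ => Particle D) p.1 p.2⟩ i *
          f ⟨n, i.removeNth (i.insertNth (α := fun _ => Particle D) p.1 p.2)⟩) =
      (nbhdUnion ⟨n, p.2⟩)ᶜ.indicator (fun _ => density lam mu p.2 * f ⟨n, p.2⟩) p.1 := by
    intro p
    simp_rw [Fin.removeNth_insertNth, ← mul_assoc]
    rw [← Finset.sum_mul, sum_density_insertNth lam hmu]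
    by_cases hy : p.1 ∈ (nbhdUnion ⟨n, p.2⟩)ᶜ <;> simp [hy]
  have hint2 := integrable_finsetSum Finset.univ fun i (_ : i ∈ Finset.univ) =>
    integrable_insertNth_prod i (hint i)
  rw [integral_congr_ae (Filter.Eventually.of_forall h2)]
  rw [integral_prod_symm]
  · refine integral_congr_ae (Filter.Eventually.of_forall fun z => ?_)
    dsimp only
    rw [integral_indicator (measurableSet_nbhdUnion _).compl, integral_const]
    simp only [smul_eq_mul, measureReal_restrict_apply_univ]
    ring
  · exact hint2.congr (Filter.Eventually.of_forall fun p => (by simpa using h2 p))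

end Balance

/-- The product form is invariant. -/
theorem isInvariant_productForm (lam : Measure D) [IsFiniteMeasure lam] {mu : ℝ} (hmu : 0 < mu) :
    IsInvariant lam mu (productForm lam mu) := by
  rintro N f hf ⟨C, hC⟩ hN
  have hC0 : 0 ≤ C := (abs_nonneg _).trans (hC ⟨0, Fin.elim0⟩)
  rw [integral_productForm lam hmu (measurable_generator lam mu hf hC)
    (abs_generator_le lam hmu hC hC0 hN) (N := N + 2)
    (fun γ hγ => generator_eq_zero lam mu hN (by omega))]
  set U : ℕ → ℝ := fun n => ∫ x : Fin n → Particle D, density lam mu x * upPart lam f ⟨n, x⟩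
        ∂(Measure.pi fun _ => lamBar lam) with hU
  set S : ℕ → ℝ := fun n => ∫ x : Fin n → Particle D, density lam mu x *
        ((lamBar lam).real (nbhdUnion ⟨n, x⟩)ᶜ * f ⟨n, x⟩) ∂(Measure.pi fun _ => lamBar lam) with hS
  set V : ℕ → ℝ := fun n => ∫ x : Fin n → Particle D, density lam mu x *
        ((∑ i, rate lam mu ⟨n, x⟩ i) * f ⟨n, x⟩) ∂(Measure.pi fun _ => lamBar lam) with hV
  set E : ℕ → ℝ := fun n => ∫ x : Fin n → Particle D, density lam mu x *
        downPart lam mu f ⟨n, x⟩ ∂(Measure.pi fun _ => lamBar lam) with hE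
  have hUV : ∀ n, U n = V (n + 1) := integral_density_mul_upPart lam hmu hf hC
  have hES : ∀ n, E (n + 1) = S n := integral_density_mul_downPart lam hmu hf hC
  have hV0 : V 0 = 0 := by simp [hV]
  have hE0 : E 0 = 0 := by simp [hE, downPart]
  have hL : 0 ≤ (lamBar lam).real univ := measureReal_nonneg
  have hterm : ∀ n : ℕ, ∫ x : Fin n → Particle D, density lam mu x *
      generator lam mu f ⟨n, x⟩ ∂(Measure.pi fun _ => lamBar lam)
      = (E n - V n) + (U n - S n) := by
    intro n
    simp_rw [generator_eq lam mu hf hC, mul_add, mul_sub]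
    have i1 : Integrable (fun x : Fin n → Particle D => density lam mu x *
        downPart lam mu f ⟨n, x⟩) (Measure.pi fun _ => lamBar lam) := by
      refine integrable_density_mul lam hmu (C := n * ((mu + (lamBar lam).real univ) * C))
        (measurable_config.1 (measurable_downPart lam mu hf) n) fun x => ?_
      refine (Finset.abs_sum_le_sum_abs _ _).trans ?_
      refine (Finset.sum_le_sum (g := fun _ => (mu + (lamBar lam).real univ) * C)
        fun i _ => ?_).trans_eq (by simp)
      rw [abs_mul, abs_of_nonneg (hmu.le.trans (le_rate lam mu ⟨n, x⟩ i))]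
      exact mul_le_mul (rate_le lam mu ⟨n, x⟩ i) (hC _) (abs_nonneg _) (by positivity)
    have i2 : Integrable (fun x : Fin n → Particle D => density lam mu x *
        ((∑ i, rate lam mu ⟨n, x⟩ i) * f ⟨n, x⟩)) (Measure.pi fun _ => lamBar lam) := by
      refine integrable_density_mul lam hmu (C := n * (mu + (lamBar lam).real univ) * C)
        (Measurable.mul ?_ (measurable_config.1 hf _)) fun x => ?_
      · exact Finset.measurable_sum
          (f := fun (i : Fin n) (x : Fin n → Particle D) => rate lam mu ⟨n, x⟩ i)
          (Finset.univ : Finset (Fin n)) fun i _ => measurable_rate lam mu i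
      · rw [abs_mul]
        exact mul_le_mul (abs_sum_rate_le lam hmu x) (hC _) (abs_nonneg _) (by positivity)
    have i3 : Integrable (fun x : Fin n → Particle D => density lam mu x *
        upPart lam f ⟨n, x⟩) (Measure.pi fun _ => lamBar lam) := by
      refine integrable_density_mul lam hmu (C := C * (lamBar lam).real univ)
        (measurable_config.1 (measurable_upPart lam hf) n) fun x => ?_
      refine (norm_setIntegral_le_of_norm_le_const (C := C)
        (f := fun y => f (append ⟨n, x⟩ y)) (measure_lt_top _ _) fun y _ => hC _).trans ?_
      gcongr
      · exact measure_ne_top _ _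
      · exact subset_univ _
    have i4 : Integrable (fun x : Fin n → Particle D => density lam mu x *
        ((lamBar lam).real (nbhdUnion ⟨n, x⟩)ᶜ * f ⟨n, x⟩)) (Measure.pi fun _ => lamBar lam) := by
      refine integrable_density_mul lam hmu (C := (lamBar lam).real univ * C)
        (Measurable.mul ?_ (measurable_config.1 hf _)) fun x => ?_
      · exact (measurable_measure_prodMk_left (ν := lamBar lam)
          (measurableSet_nbhdUnion_prod (D := D) n).compl).ennreal_toReal
      · rw [abs_mul, abs_of_nonneg measureReal_nonneg]
        refine mul_le_mul ?_ (hC _) (abs_nonneg _) hL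
        exact measureReal_mono (subset_univ _) (measure_ne_top _ _)
    refine (integral_add (i1.sub i2) (i3.sub i4)).trans ?_
    exact congrArg₂ (· + ·) (integral_sub i1 i2) (integral_sub i3 i4)
  simp_rw [hterm]
  have htel : ∀ M : ℕ, ∑ n ∈ Finset.range (M + 1), ((E n - V n) + (U n - S n)) = U M - S M := by
    intro M
    induction M with
    | zero => simp [hV0, hE0]
    | succ M ih => rw [Finset.sum_range_succ, ih, hES, ← hUV]; ring
  rw [htel]
  have hUz : U (N + 1) = 0 := by
    have : ∀ x : Fin (N + 1) → Particle D, upPart lam f ⟨N + 1, x⟩ = 0 := fun x => by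
      have : ∀ y, f (append ⟨N + 1, x⟩ y) = 0 := fun y => hN _ (by simp only [append]; omega)
      simp [upPart, this]
    simp [hU, this]
  have hSz : S (N + 1) = 0 := by
    have : ∀ x : Fin (N + 1) → Particle D, f ⟨N + 1, x⟩ = 0 := fun x => hN _ (by simp)
    simp [hS, this]
  rw [hUz, hSz, sub_zero]

end

section

/-- The configurations with `k` particles. -/
def level (D : Type*) (k : ℕ) : Set (Config D) := {γ | γ.1 = k}

lemma measurableSet_level {D : Type*} [MeasurableSpace D] (k : ℕ) : MeasurableSet (level D k) :=
  measurable_config_length (measurableSet_singleton k)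

lemma tendsto_measureReal_level {D : Type*} [MeasurableSpace D] (π : Measure (Config D))
    [IsFiniteMeasure π] :
    Filter.Tendsto (fun n => π.real (level D n)) Filter.atTop (nhds 0) := by
  have h1 : ∑' n, π (level D n) ≠ ∞ := by
    rw [← measure_iUnion (fun i j hij => Set.disjoint_left.2 fun γ (h : γ.1 = i) (h' : γ.1 = j) =>
      hij (h.symm.trans h')) measurableSet_level]
    exact measure_ne_top _ _
  have h2 := ENNReal.tendsto_atTop_zero_of_tsum_ne_top h1
  exact (ENNReal.tendsto_toReal ENNReal.zero_ne_top).comp h2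

variable {D : Type*} [MetricSpace D] [MeasurableSpace D]

lemma mul_generator_le (lam : Measure D) [IsFiniteMeasure lam] {mu : ℝ} (hmu : 0 < mu)
    {h : Config D → ℝ} (hh : ∀ γ, h γ = 1 ∨ h γ = -1) {k n : ℕ} (hkn : k ≤ n)
    {γ : Config D} (hγ : k ≤ γ.1) :
    h γ * generator lam mu (fun γ => if k ≤ γ.1 ∧ γ.1 ≤ n then h γ else 0) γ ≤
      (level D k).indicator (fun _ => -(k * mu)) γ +
      (level D (n + 1)).indicator (fun _ => ((n : ℝ) + 1) * (mu + (lamBar lam).real univ)) γ := by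
  set f : Config D → ℝ := fun γ => if k ≤ γ.1 ∧ γ.1 ≤ n then h γ else 0 with hf
  have hsq : h γ * h γ = 1 := by rcases hh γ with h | h <;> simp [h]
  have hle : ∀ γ', h γ * f γ' ≤ 1 := by
    intro γ'
    simp only [hf]
    split_ifs
    · rcases hh γ with h1 | h1 <;> rcases hh γ' with h2 | h2 <;> rw [h1, h2] <;> norm_num
    · simp
  rcases Nat.lt_trichotomy γ.1 (n + 1) with hlt | heq | hgt
  · have hfγ : f γ = h γ := if_pos ⟨hγ, by omega⟩
    have hn1 : γ ∉ level D (n + 1) := fun h : γ.1 = n + 1 => by omega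
    rw [generator_def, hfγ, mul_add, Finset.mul_sum, ← integral_const_mul,
      indicator_of_notMem hn1]
    refine add_le_add ?_ (integral_nonpos fun y => ?_)
    · by_cases hkγ : γ.1 = k
      · rw [indicator_of_mem (show γ ∈ level D k from hkγ)]
        have : ∀ i ∈ Finset.univ, h γ * (rate lam mu γ i * (f (remove γ i) - h γ)) ≤ -mu := by
          intro i _
          have h0 : f (remove γ i) = 0 := if_neg fun hc => by
            have := remove_fst γ i; omega
          have := le_rate lam mu γ i
          rw [h0]
          have e : h γ * (rate lam mu γ i * (0 - h γ)) = -(h γ * h γ) * rate lam mu γ i := by ring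
          rw [e, hsq]; linarith
        refine (Finset.sum_le_sum this).trans_eq ?_
        simp [hkγ]
      · rw [indicator_of_notMem (show γ ∉ level D k from hkγ)]
        refine Finset.sum_nonpos fun i _ => ?_
        have e : h γ * (rate lam mu γ i * (f (remove γ i) - h γ))
          = rate lam mu γ i * (h γ * f (remove γ i) - h γ * h γ) := by ring
        rw [e, hsq]
        exact mul_nonpos_of_nonneg_of_nonpos (hmu.le.trans (le_rate lam mu γ i))
          (by linarith [hle (remove γ i)])
    · have e : h γ * (f (append γ y) - h γ) = h γ * f (append γ y) - h γ * h γ := by ring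
      simp only [Pi.zero_apply]
      rw [e, hsq]
      linarith [hle (append γ y)]
  · have hfγ : f γ = 0 := if_neg (by omega)
    have happ : ∀ y, f (append γ y) = 0 := fun y => if_neg (by simp only [append]; omega)
    have hk' : γ ∉ level D k := fun h : γ.1 = k => by omega
    rw [generator_def, indicator_of_notMem hk', indicator_of_mem (show γ ∈ level D (n + 1) from heq)]
    simp only [hfγ, happ, sub_zero, integral_zero, add_zero, zero_add]
    rw [Finset.mul_sum]
    have : ∀ i ∈ Finset.univ, h γ * (rate lam mu γ i * f (remove γ i)) ≤
        mu + (lamBar lam).real univ := by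
      intro i _
      have e : h γ * (rate lam mu γ i * f (remove γ i))
        = rate lam mu γ i * (h γ * f (remove γ i)) := by ring
      rw [e]
      refine (mul_le_of_le_one_right (hmu.le.trans (le_rate lam mu γ i)) (hle _)).trans
        (rate_le lam mu γ i)
    refine (Finset.sum_le_sum this).trans_eq ?_
    simp [heq, mul_add]
  · have hfn : ∀ γ : Config D, n < γ.1 → f γ = 0 := fun γ hγ => if_neg (by omega)
    rw [generator_eq_zero lam mu hfn hgt, mul_zero,
      indicator_of_notMem (show γ ∉ level D k from fun h : γ.1 = k => by omega),
      indicator_of_notMem (show γ ∉ level D (n + 1) from fun h : γ.1 = n + 1 => by omega), add_zero]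

variable [BorelSpace D] [SecondCountableTopology D]

/-- The flow from level `n + 1` to level `n` is at most that from level `n` to level `n + 1`. -/
lemma IsInvariant.level_succ_le {lam : Measure D} [IsFiniteMeasure lam] {mu : ℝ} (hmu : 0 < mu)
    {π : Measure (Config D)} [IsFiniteMeasure π] (hπ : IsInvariant lam mu π) (n : ℕ) :
    ((n : ℝ) + 1) * mu * π.real (level D (n + 1)) ≤
      (lamBar lam).real univ * π.real (level D n) := by
  set f : Config D → ℝ := fun γ => if γ.1 ≤ n then 1 else 0 with hf
  have hfm : Measurable f := Measurable.ite
    (measurableSet_le measurable_config_length measurable_const) measurable_const measurable_const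
  have hfb : ∀ γ, |f γ| ≤ 1 := fun γ => by simp only [hf]; split_ifs <;> simp
  have hfn : ∀ γ : Config D, n < γ.1 → f γ = 0 := fun γ hγ => if_neg (by omega)
  have h0 := hπ n f hfm ⟨1, hfb⟩ hfn
  have hle : ∀ γ, (level D (n + 1)).indicator (fun _ => ((n : ℝ) + 1) * mu) γ +
      (level D n).indicator (fun _ => -(lamBar lam).real univ) γ ≤ generator lam mu f γ := by
    intro γ
    rcases Nat.lt_trichotomy γ.1 (n + 1) with hlt | heq | hgt
    · have hfγ : f γ = 1 := if_pos (by omega)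
      have hrem : ∀ i, f (remove γ i) = 1 := fun i => if_pos (by have := remove_fst γ i; omega)
      rw [indicator_of_notMem (show γ ∉ level D (n + 1) from fun h : γ.1 = n + 1 => by omega),
        generator_def]
      simp only [hfγ, hrem, sub_self, mul_zero, Finset.sum_const_zero, zero_add]
      by_cases hn : γ.1 = n
      · have happ : ∀ y, f (append γ y) = 0 := fun y => if_neg (by simp only [append]; omega)
        rw [indicator_of_mem (show γ ∈ level D n from hn)]
        simp only [happ, zero_sub, integral_const, measureReal_restrict_apply_univ, smul_eq_mul,
          mul_neg, mul_one, neg_le_neg_iff]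
        exact measureReal_mono (subset_univ _) (measure_ne_top _ _)
      · have happ : ∀ y, f (append γ y) = 1 := fun y => if_pos (by simp only [append]; omega)
        rw [indicator_of_notMem (show γ ∉ level D n from hn)]
        simp [happ]
    · have hfγ : f γ = 0 := if_neg (by omega)
      have hrem : ∀ i, f (remove γ i) = 1 := fun i => if_pos (by have := remove_fst γ i; omega)
      have happ : ∀ y, f (append γ y) = 0 := fun y => if_neg (by simp only [append]; omega)
      rw [indicator_of_mem (show γ ∈ level D (n + 1) from heq),
        indicator_of_notMem (show γ ∉ level D n from fun h : γ.1 = n => by omega), generator_def]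
      simp only [hfγ, hrem, happ, sub_zero, mul_one, integral_zero, add_zero]
      refine le_trans (by simp [heq]) (Finset.sum_le_sum fun i _ => le_rate lam mu γ i)
    · rw [generator_eq_zero lam mu hfn hgt,
        indicator_of_notMem (show γ ∉ level D n from fun h : γ.1 = n => by omega),
        indicator_of_notMem (show γ ∉ level D (n + 1) from fun h : γ.1 = n + 1 => by omega),
        add_zero]
  have i1 : Integrable ((level D (n + 1)).indicator fun _ => ((n : ℝ) + 1) * mu) π :=
    (integrable_const _).indicator (measurableSet_level _)
  have i2 : Integrable ((level D n).indicator fun _ => -(lamBar lam).real univ) π :=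
    (integrable_const _).indicator (measurableSet_level _)
  have := integral_mono (i1.add i2) (integrable_generator lam hmu hfm hfb hfn π) hle
  rw [h0, integral_add' i1 i2, integral_indicator (measurableSet_level _),
    integral_indicator (measurableSet_level _)] at this
  simp only [integral_const, measureReal_restrict_apply_univ, smul_eq_mul] at this
  linarith

lemma IsInvariant.tendsto_level {lam : Measure D} [IsFiniteMeasure lam] {mu : ℝ} (hmu : 0 < mu)
    {π : Measure (Config D)} [IsFiniteMeasure π] (hπ : IsInvariant lam mu π) :
    Filter.Tendsto (fun n : ℕ => ((n : ℝ) + 1) * (mu + (lamBar lam).real univ) *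
      π.real (level D (n + 1))) Filter.atTop (nhds 0) := by
  have hL : 0 ≤ (lamBar lam).real univ := measureReal_nonneg
  have h1 := (tendsto_measureReal_level π).const_mul
    ((mu + (lamBar lam).real univ) / mu * (lamBar lam).real univ)
  rw [mul_zero] at h1
  refine squeeze_zero (fun n => by positivity) (fun n => ?_) h1
  have h2 := hπ.level_succ_le hmu n
  calc _ = (mu + (lamBar lam).real univ) / mu * (((n : ℝ) + 1) * mu * π.real (level D (n + 1))) := by
        field_simp
    _ ≤ (mu + (lamBar lam).real univ) / mu * ((lamBar lam).real univ * π.real (level D n)) := by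
        gcongr
    _ = _ := by ring

/-- Invariant finite measures are determined by their mass at the empty configuration. -/
theorem IsInvariant.eq_of_level_zero {lam : Measure D} [IsFiniteMeasure lam] {mu : ℝ}
    (hmu : 0 < mu) {π π' : Measure (Config D)} [IsFiniteMeasure π] [IsFiniteMeasure π']
    (hπ : IsInvariant lam mu π) (hπ' : IsInvariant lam mu π')
    (h0 : π.real (level D 0) = π'.real (level D 0)) : π = π' := by
  set m := π + π' with hm
  have ac1 : π ≪ m := Measure.absolutelyContinuous_of_le (Measure.le_add_right le_rfl)
  have ac2 : π' ≪ m := Measure.absolutelyContinuous_of_le (Measure.le_add_left le_rfl)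
  set w : Config D → ℝ := fun γ => (π.rnDeriv m γ).toReal - (π'.rnDeriv m γ).toReal with hw
  have hwm : Measurable w := (Measure.measurable_rnDeriv π m).ennreal_toReal.sub
    (Measure.measurable_rnDeriv π' m).ennreal_toReal
  have hwi : Integrable w m :=
    Measure.integrable_toReal_rnDeriv.sub Measure.integrable_toReal_rnDeriv
  have hwφ : ∀ φ : Config D → ℝ, Measurable φ → (∃ C, ∀ γ, |φ γ| ≤ C) →
      ∫ γ, w γ * φ γ ∂m = ∫ γ, φ γ ∂π - ∫ γ, φ γ ∂π' := by
    rintro φ hφ ⟨C, hC⟩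
    rw [← integral_rnDeriv_smul ac1, ← integral_rnDeriv_smul ac2, ← integral_sub]
    · refine integral_congr_ae (Filter.Eventually.of_forall fun γ => ?_)
      simp [hw, sub_mul]
    · exact (integrable_rnDeriv_smul_iff ac1).2
        (Integrable.of_bound hφ.aestronglyMeasurable C (Filter.Eventually.of_forall hC))
    · exact (integrable_rnDeriv_smul_iff ac2).2
        (Integrable.of_bound hφ.aestronglyMeasurable C (Filter.Eventually.of_forall hC))
  have hwset : ∀ s, MeasurableSet s → ∫ γ in s, w γ ∂m = π.real s - π'.real s := by
    intro s hs
    have := hwφ (s.indicator 1) (measurable_one.indicator hs) ⟨1, fun γ => by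
      by_cases h : γ ∈ s <;> simp [h]⟩
    rw [integral_indicator_one hs, integral_indicator_one hs] at this
    rw [← this, ← integral_indicator hs]
    refine integral_congr_ae (Filter.Eventually.of_forall fun γ => ?_)
    by_cases h : γ ∈ s <;> simp [h]
  have habs : ∀ s, MeasurableSet s → ∫ γ in s, |w γ| ∂m ≤ π.real s + π'.real s := by
    intro s hs
    have h1 : ∫ γ in s, |w γ| ∂m ≤
        ∫ γ in s, ((π.rnDeriv m γ).toReal + (π'.rnDeriv m γ).toReal) ∂m := by
      refine integral_mono hwi.abs.integrableOn (Measure.integrable_toReal_rnDeriv.add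
        Measure.integrable_toReal_rnDeriv).integrableOn fun γ => ?_
      refine (abs_sub _ _).trans ?_
      rw [abs_of_nonneg ENNReal.toReal_nonneg, abs_of_nonneg ENNReal.toReal_nonneg]
    rwa [integral_add Measure.integrable_toReal_rnDeriv.integrableOn
      Measure.integrable_toReal_rnDeriv.integrableOn, Measure.setIntegral_toReal_rnDeriv ac1,
      Measure.setIntegral_toReal_rnDeriv ac2] at h1
  set h : Config D → ℝ := fun γ => if 0 ≤ w γ then 1 else -1 with hh
  have hhm : Measurable h :=
    Measurable.ite (measurableSet_le measurable_const hwm) measurable_const measurable_const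
  have hh1 : ∀ γ, h γ = 1 ∨ h γ = -1 := fun γ => by simp only [hh]; split_ifs <;> simp
  have hwh : ∀ γ, w γ = |w γ| * h γ := by
    intro γ
    simp only [hh]
    split_ifs with hc
    · rw [abs_of_nonneg hc, mul_one]
    · rw [abs_of_neg (not_le.1 hc)]; ring
  have hlevel : ∀ k, ∀ᵐ γ ∂m, γ.1 = k → w γ = 0 := by
    intro k
    induction k using Nat.strong_induction_on with
    | _ k ih =>
    rcases Nat.eq_zero_or_pos k with rfl | hk
    · set e : Config D := ⟨0, Fin.elim0⟩
      have he : ∀ γ : Config D, γ.1 = 0 → γ = e := by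
        rintro ⟨n, x⟩ (rfl : n = 0)
        exact Sigma.ext rfl (heq_of_eq (Subsingleton.elim _ _))
      have h1 := hwset _ (measurableSet_level 0)
      rw [h0, sub_self, setIntegral_congr_fun (g := fun _ => w e) (measurableSet_level 0)
        (fun γ hγ => by rw [he γ hγ]), setIntegral_const, smul_eq_mul, mul_eq_zero] at h1
      rcases h1 with h1 | h1
      · rw [measureReal_eq_zero_iff] at h1
        filter_upwards [measure_eq_zero_iff_ae_notMem.1 h1] with γ hγ hγ0
        exact absurd hγ0 hγ
      · exact Filter.Eventually.of_forall fun γ hγ => by rw [he γ hγ]; exact h1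
    · have hlow : ∀ᵐ γ ∂m, γ.1 < k → w γ = 0 := by
        have : ∀ᵐ γ ∂m, ∀ j : ℕ, j < k → γ.1 = j → w γ = 0 := by
          rw [ae_all_iff]
          intro j
          by_cases hj : j < k
          · filter_upwards [ih j hj] with γ hγ _ using hγ
          · exact Filter.Eventually.of_forall fun γ h => absurd h hj
        filter_upwards [this] with γ hγ hlt using hγ _ hlt rfl
      have hmain : ∀ n, k ≤ n → (k * mu) * ∫ γ in level D k, |w γ| ∂m ≤
          ((n : ℝ) + 1) * (mu + (lamBar lam).real univ) * π.real (level D (n + 1)) +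
          ((n : ℝ) + 1) * (mu + (lamBar lam).real univ) * π'.real (level D (n + 1)) := by
        intro n hkn
        have hL : 0 ≤ (lamBar lam).real univ := measureReal_nonneg
        set f : Config D → ℝ := fun γ => if k ≤ γ.1 ∧ γ.1 ≤ n then h γ else 0 with hf
        have hfm : Measurable f := Measurable.ite
          ((measurableSet_le measurable_const measurable_config_length).inter
            (measurableSet_le measurable_config_length measurable_const)) hhm measurable_const
        have hfb : ∀ γ, |f γ| ≤ 1 := fun γ => by
          simp only [hf]
          split_ifs
          · rcases hh1 γ with h | h <;> simp [h]
          · simp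
        have hfn : ∀ γ : Config D, n < γ.1 → f γ = 0 := fun γ hγ => if_neg (by omega)
        have hz : ∫ γ, w γ * generator lam mu f γ ∂m = 0 := by
          rw [hwφ _ (measurable_generator lam mu hfm hfb)
            ⟨_, abs_generator_le lam hmu hfb zero_le_one hfn⟩, hπ n f hfm ⟨1, hfb⟩ hfn,
            hπ' n f hfm ⟨1, hfb⟩ hfn, sub_zero]
        have hle : ∀ᵐ γ ∂m, w γ * generator lam mu f γ ≤
            (level D k).indicator (fun γ => -(k * mu) * |w γ|) γ +
            (level D (n + 1)).indicator
              (fun γ => ((n : ℝ) + 1) * (mu + (lamBar lam).real univ) * |w γ|) γ := by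
          filter_upwards [hlow] with γ hγ
          by_cases hlt : γ.1 < k
          · rw [hγ hlt, zero_mul,
              indicator_of_notMem (show γ ∉ level D k from fun h : γ.1 = k => by omega),
              indicator_of_notMem (show γ ∉ level D (n + 1) from fun h : γ.1 = n + 1 => by omega),
              add_zero]
          · have := mul_le_mul_of_nonneg_left
              (mul_generator_le lam hmu hh1 hkn (not_lt.1 hlt)) (abs_nonneg (w γ))
            rw [← mul_assoc, ← hwh] at this
            refine this.trans_eq ?_
            rw [mul_add]
            congr 1
            · by_cases hc : γ ∈ level D k <;> simp [hc, mul_comm]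
            · by_cases hc : γ ∈ level D (n + 1) <;> simp [hc, mul_comm]
        have i1 : Integrable ((level D k).indicator fun γ => -(k * mu) * |w γ|) m :=
          (hwi.abs.const_mul _).indicator (measurableSet_level _)
        have i2 : Integrable ((level D (n + 1)).indicator
            fun γ => ((n : ℝ) + 1) * (mu + (lamBar lam).real univ) * |w γ|) m :=
          (hwi.abs.const_mul _).indicator (measurableSet_level _)
        have i3 : Integrable (fun γ => w γ * generator lam mu f γ) m :=
          hwi.mul_bdd (measurable_generator lam mu hfm hfb).aestronglyMeasurable
            (Filter.Eventually.of_forall (abs_generator_le lam hmu hfb zero_le_one hfn))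
        have key := integral_mono_ae i3 (i1.add i2) hle
        rw [hz, integral_add' i1 i2, integral_indicator (measurableSet_level _),
          integral_indicator (measurableSet_level _), integral_const_mul,
          integral_const_mul] at key
        have hb := habs _ (measurableSet_level (D := D) (n + 1))
        have hb2 := mul_le_mul_of_nonneg_left hb
          (show 0 ≤ ((n : ℝ) + 1) * (mu + (lamBar lam).real univ) by positivity)
        linarith
      have hlim := (hπ.tendsto_level hmu).add (hπ'.tendsto_level hmu)
      rw [add_zero] at hlim
      have hzero : (k * mu) * ∫ γ in level D k, |w γ| ∂m ≤ 0 :=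
        ge_of_tendsto hlim (Filter.eventually_atTop.2 ⟨k, hmain⟩)
      have hkpos : (0 : ℝ) < k * mu := by
        have : (0 : ℝ) < k := by exact_mod_cast hk
        positivity
      have hint0 : ∫ γ in level D k, |w γ| ∂m = 0 :=
        le_antisymm (nonpos_of_mul_nonpos_right hzero hkpos)
          (integral_nonneg fun _ => abs_nonneg _)
      rw [integral_eq_zero_iff_of_nonneg (fun _ => abs_nonneg _) hwi.abs.integrableOn] at hint0
      have := (ae_restrict_iff' (measurableSet_level (D := D) k)).1 hint0
      filter_upwards [this] with γ hγ hk
      simpa using hγ hk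
  have hall : ∀ᵐ γ ∂m, w γ = 0 := by
    filter_upwards [ae_all_iff.2 hlevel] with γ hγ using hγ _ rfl
  ext s hs
  have h1 := hwset s hs
  rw [setIntegral_congr_ae (g := fun _ => 0) hs (hall.mono fun γ hγ _ => hγ),
    integral_zero, eq_comm, sub_eq_zero] at h1
  exact (measureReal_eq_measureReal_iff).1 h1

end

section

lemma IsInvariant.smul {D : Type*} [MetricSpace D] [MeasurableSpace D] {lam : Measure D} {mu : ℝ}
    {π : Measure (Config D)} (h : IsInvariant lam mu π) (K : ℝ≥0) :
    IsInvariant lam mu (K • π) := by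
  intro n f hf hC hn
  rw [integral_smul_nnreal_measure, h n f hf hC hn, smul_zero]

section MartingaleProblem

variable {D : Type*} [MetricSpace D] [MeasurableSpace D] [BorelSpace D]
  [SecondCountableTopology D] {lam : Measure D} [IsFiniteMeasure lam] {mu : ℝ}
  {Ω : Type*} [mΩ : MeasurableSpace Ω] {P : Measure Ω} [IsProbabilityMeasure P]
  {ℱ : Filtration ℝ≥0 mΩ} {η : ℝ≥0 → Ω → Config D}

omit [BorelSpace D] [SecondCountableTopology D] [IsFiniteMeasure lam] [IsProbabilityMeasure P] in
lemma IsStationaryMatchingProcess.measurable_at (h : IsStationaryMatchingProcess lam mu P ℱ η)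
    (t : ℝ≥0) : Measurable (η t) :=
  h.measurable.comp measurable_prodMk_left

theorem IsStationaryMatchingProcess.isInvariant (hmu : 0 < mu)
    (h : IsStationaryMatchingProcess lam mu P ℱ η) : IsInvariant lam mu (P.map (η 0)) := by
  rintro n f hf ⟨C, hC⟩ hn
  have hC0 : 0 ≤ C := (abs_nonneg _).trans (hC ⟨0, Fin.elim0⟩)
  have hM := h.martingale n f hf ⟨C, hC⟩ hn
  set L := generator lam mu f with hL
  have hLm : Measurable L := measurable_generator lam mu hf hC
  have hLb := abs_generator_le lam hmu hC hC0 hn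
  have hlaw : ∀ (φ : Config D → ℝ), Measurable φ → ∀ t, ∫ ω, φ (η t ω) ∂P
      = ∫ γ, φ γ ∂(P.map (η 0)) := by
    intro φ hφ t
    rw [← h.stationary t, integral_map (h.measurable_at t).aemeasurable hφ.aestronglyMeasurable]
  have hfi : ∀ t, Integrable (fun ω => f (η t ω)) P := fun t =>
    Integrable.of_bound (hf.comp (h.measurable_at t)).aestronglyMeasurable C
      (Filter.Eventually.of_forall fun ω => hC _)
  have hjoint : Integrable (fun p : Ω × ℝ => L (η p.2.toNNReal p.1))
      (P.prod (volume.restrict (Ioc (0 : ℝ) 1))) :=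
    Integrable.of_bound ((hLm.comp (h.measurable.comp
      ((measurable_real_toNNReal.comp measurable_snd).prodMk
        measurable_fst))).aestronglyMeasurable) _
      (Filter.Eventually.of_forall fun p => hLb _)
  have h1 := hM.setIntegral_eq (show (0 : ℝ≥0) ≤ 1 from zero_le_one) MeasurableSet.univ
  simp only [Measure.restrict_univ, NNReal.coe_zero, intervalIntegral.integral_same, sub_self,
    integral_zero, NNReal.coe_one, intervalIntegral.integral_of_le zero_le_one] at h1
  have i2 : Integrable (fun ω => ∫ s in Ioc (0 : ℝ) 1, L (η s.toNNReal ω)) P :=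
    hjoint.integral_prod_left
  have h2 : ∫ ω, (∫ s in Ioc (0 : ℝ) 1, L (η s.toNNReal ω)) ∂P = ∫ γ, L γ ∂(P.map (η 0)) := by
    rw [integral_integral_swap hjoint]
    simp_rw [hlaw L hLm]
    simp
  have h3 : ∫ ω, (f (η 1 ω) - f (η 0 ω) - (∫ s in Ioc (0 : ℝ) 1, L (η s.toNNReal ω))) ∂P
      = (∫ ω, f (η 1 ω) ∂P - ∫ ω, f (η 0 ω) ∂P)
        - ∫ ω, (∫ s in Ioc (0 : ℝ) 1, L (η s.toNNReal ω)) ∂P := by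
    rw [← integral_sub (hfi 1) (hfi 0)]
    exact integral_sub ((hfi 1).sub (hfi 0)) i2
  rw [h3, h2, hlaw f hf, hlaw f hf] at h1
  linarith

lemma productForm_level_zero : (productForm lam mu).real (level D 0) = 1 := by
  have h := lintegral_productForm lam mu (F := (level D 0).indicator 1)
    (measurable_one.indicator (measurableSet_level 0))
  rw [lintegral_indicator_one (measurableSet_level 0), tsum_eq_single 0] at h
  · have h2 : ∀ x : Fin 0 → Particle D, ENNReal.ofReal (density lam mu x) *
        (level D 0).indicator 1 (⟨0, x⟩ : Config D) = 1 := by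
      intro x
      rw [indicator_of_mem (show (⟨0, x⟩ : Config D) ∈ level D 0 from rfl)]
      simp [density, weight, Valid]
    simp_rw [h2] at h
    rw [Measure.real, h]
    simp
  · intro n hn
    have h2 : ∀ x : Fin n → Particle D, ENNReal.ofReal (density lam mu x) *
        (level D 0).indicator 1 (⟨n, x⟩ : Config D) = 0 := by
      intro x
      rw [indicator_of_notMem (show (⟨n, x⟩ : Config D) ∉ level D 0 from hn)]
      simp
    simp [h2]

/-- The stationary law is the normalized product form. -/
theorem IsStationaryMatchingProcess.map_eq (hmu : 0 < mu)
    (h : IsStationaryMatchingProcess lam mu P ℱ η) (t : ℝ≥0) :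
    ∃ K : ℝ≥0, 0 < K ∧ P.map (η t) = K • productForm lam mu := by
  have : Fact (0 < mu) := ⟨hmu⟩
  have hprob : IsProbabilityMeasure (P.map (η 0)) :=
    Measure.isProbabilityMeasure_map (h.measurable_at 0).aemeasurable
  set K : ℝ≥0 := ((P.map (η 0)) (level D 0)).toNNReal with hK
  have heq : P.map (η 0) = K • productForm lam mu := by
    refine (h.isInvariant hmu).eq_of_level_zero hmu ((isInvariant_productForm lam hmu).smul K) ?_
    rw [measureReal_nnreal_smul_apply, productForm_level_zero, mul_one]
    rfl
  refine ⟨K, pos_iff_ne_zero.2 fun h0 => ?_, (h.stationary t).trans heq⟩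
  rw [h0, zero_smul] at heq
  exact IsProbabilityMeasure.ne_zero (P.map (η 0)) heq

end MartingaleProblem

section Janossy

variable {D : Type*} [MetricSpace D]

/-- The multiset of particles of a configuration. -/
def toMultiset {D : Type*} (γ : Config D) : Multiset (Particle D) := Finset.univ.val.map γ.2

lemma valid_comp_equiv {ι κ : Type*} (e : ι ≃ κ) (x : κ → Particle D) :
    Valid (x ∘ e) ↔ Valid x := by
  simp only [Valid, Function.comp]
  constructor
  · intro h i j
    simpa using h (e.symm i) (e.symm j)
  · exact fun h i j => h _ _

lemma valid_iff_toMultiset {ι : Type*} [Fintype ι] (x : ι → Particle D) :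
    Valid x ↔ ∀ a ∈ Finset.univ.val.map x, ∀ b ∈ Finset.univ.val.map x, a ∉ nbhd b := by
  simp [Valid]

variable [MeasurableSpace D]

open Classical in
/-- The unnormalized Janossy density as a function of multisets. -/
def janossy (lam : Measure D) (mu : ℝ) (M : Multiset (Particle D)) : ℝ≥0 :=
  if ∀ a ∈ M, ∀ b ∈ M, a ∉ nbhd b then (piTildeMultiset lam mu M).toNNReal else 0

open Classical in
lemma coe_janossy_map_univ (lam : Measure D) {mu : ℝ} (hmu : 0 < mu) {ι : Type*} [Fintype ι]
    (x : ι → Particle D) :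
    (janossy lam mu (Finset.univ.val.map x) : ℝ) = (if Valid x then 1 else 0) * piTilde lam mu x := by
  unfold janossy
  by_cases hv : Valid x
  · rw [if_pos ((valid_iff_toMultiset x).1 hv), if_pos hv, piTildeMultiset_map_univ,
      Real.coe_toNNReal _ (piTilde_nonneg lam hmu x), one_mul]
  · rw [if_neg (mt (valid_iff_toMultiset x).2 hv), if_neg hv, zero_mul, NNReal.coe_zero]

lemma sum_density_perm (lam : Measure D) {mu : ℝ} (hmu : 0 < mu) {n : ℕ}
    (x : Fin n → Particle D) :
    ∑ σ : Equiv.Perm (Fin n), density lam mu (x ∘ σ) = janossy lam mu (Finset.univ.val.map x) := by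
  classical
  rw [coe_janossy_map_univ lam hmu, piTilde_eq_sum lam mu (Fintype.card_fin n)]
  simp only [density, valid_comp_equiv]
  split_ifs <;> simp

variable [BorelSpace D] [SecondCountableTopology D]

lemma multisetMeasurable_janossy (lam : Measure D) [IsFiniteMeasure lam] {mu : ℝ} (hmu : 0 < mu) :
    MultisetMeasurable (janossy lam mu) := by
  intro n
  have h1 : Measurable fun x : Fin n → Particle D =>
      ∑ σ : Equiv.Perm (Fin n), density lam mu (x ∘ σ) :=
    Finset.measurable_sum _ fun σ _ => (measurable_density lam mu).comp
      (measurable_pi_lambda _ fun i => measurable_pi_apply (σ i))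
  have h2 := h1.real_toNNReal
  simpa only [sum_density_perm lam hmu, Real.toNNReal_coe] using h2

lemma lintegral_productForm_toMultiset (lam : Measure D) [IsFiniteMeasure lam] {mu : ℝ}
    (hmu : 0 < mu) {F : Multiset (Particle D) → ℝ≥0∞} (hF : MultisetMeasurable F) :
    ∫⁻ γ, F (toMultiset γ) ∂(productForm lam mu) =
      poissonIntegral (lamBar lam) (fun M => janossy lam mu M * F M) := by
  rw [lintegral_productForm lam mu (F := fun γ => F (toMultiset γ))
    (measurable_config.2 fun n => hF n), poissonIntegral]
  congr 1; funext n
  have h1 : ∀ σ : Equiv.Perm (Fin n), ∫⁻ x : Fin n → Particle D,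
      ENNReal.ofReal (density lam mu (x ∘ σ)) * F (Finset.univ.val.map x)
        ∂(Measure.pi fun _ => lamBar lam) =
      ∫⁻ x : Fin n → Particle D, ENNReal.ofReal (density lam mu x) * F (Finset.univ.val.map x)
        ∂(Measure.pi fun _ => lamBar lam) := by
    intro σ
    rw [← lintegral_pi_reindex (lamBar lam) σ.symm (fun x : Fin n → Particle D =>
      ENNReal.ofReal (density lam mu x) * F (Finset.univ.val.map x))]
    refine lintegral_congr fun x => ?_
    rw [Equiv.symm_symm, map_univ_comp_equiv σ x]
    rfl
  have h2 : ∀ x : Fin n → Particle D, (janossy lam mu (Finset.univ.val.map x) : ℝ≥0∞) =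
      ∑ σ : Equiv.Perm (Fin n), ENNReal.ofReal (density lam mu (x ∘ σ)) := by
    intro x
    rw [← ENNReal.ofReal_coe_nnreal, ← sum_density_perm lam hmu,
      ENNReal.ofReal_sum_of_nonneg fun σ _ => density_nonneg lam hmu _]
  simp_rw [h2, Finset.sum_mul]
  rw [lintegral_finsetSum]
  · simp_rw [h1]
    rw [Finset.sum_const, Finset.card_univ, Fintype.card_perm, Fintype.card_fin, nsmul_eq_mul,
      ← mul_assoc, ENNReal.inv_mul_cancel, one_mul]
    · rfl
    · exact_mod_cast n.factorial_ne_zero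
    · exact ENNReal.natCast_ne_top _
  · intro σ _
    exact ((measurable_density lam mu).comp (measurable_pi_lambda _ fun i =>
      measurable_pi_apply (σ i))).ennreal_ofReal.mul (hF n)

end Janossy

section Unordered

variable {D : Type*} [MeasurableSpace D]

/-- The points of colour `c` of a multiset of particles. -/
def multisetPart (c : Color) (M : Multiset (Particle D)) : Measure D :=
  (M.map fun p => if p.2 = c then Measure.dirac p.1 else 0).sum

/-- The unordered configuration of a multiset of particles. -/
def multisetConfig (M : Multiset (Particle D)) : Measure D × (Measure D)ᵒᵈ :=
  (multisetPart red M, OrderDual.toDual (multisetPart blue M))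

lemma colorPart_eq (c : Color) (γ : Config D) : colorPart c γ = multisetPart c (toMultiset γ) := by
  rw [multisetPart, toMultiset, Multiset.map_map]
  rfl

lemma unordered_eq (γ : Config D) : unordered γ = multisetConfig (toMultiset γ) := by
  rw [unordered, colorPart_eq, colorPart_eq]
  rfl

lemma multisetPart_apply (c : Color) (M : Multiset (Particle D)) {B : Set D}
    [DecidablePred fun p : Particle D => p.2 = c ∧ p.1 ∈ B] (hB : MeasurableSet B) :
    multisetPart c M B = M.countP (fun p => p.2 = c ∧ p.1 ∈ B) := by
  induction M using Multiset.induction_on with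
  | empty => simp [multisetPart]
  | cons p M ih =>
    have h : multisetPart c (p ::ₘ M) =
        (if p.2 = c then Measure.dirac p.1 else 0) + multisetPart c M := by
      simp [multisetPart]
    rw [h, Measure.add_apply, ih, Multiset.countP_cons, Nat.cast_add, add_comm]
    congr 1
    by_cases h1 : p.2 = c
    · by_cases h2 : p.1 ∈ B <;> simp [h1, h2, Measure.dirac_apply' _ hB]
    · simp [h1]

lemma measurable_countP (n : ℕ) {p : Particle D → Prop} [DecidablePred p]
    (hp : MeasurableSet {a | p a}) :
    Measurable fun x : Fin n → Particle D => (Finset.univ.val.map x).countP p := by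
  have : (fun x : Fin n → Particle D => (Finset.univ.val.map x).countP p) =
      fun x => ∑ i, if p (x i) then 1 else 0 := by
    funext x
    rw [Multiset.countP_map, ← Finset.filter_val, Finset.card_val, Finset.card_filter]
  rw [this]
  exact Finset.measurable_sum _ fun i _ => Measurable.ite (measurable_pi_apply i hp)
    measurable_const measurable_const

lemma measurableSet_colored (c : Color) {B : Set D} (hB : MeasurableSet B) :
    MeasurableSet {p : Particle D | p.2 = c ∧ p.1 ∈ B} :=
  (measurable_snd (measurableSet_singleton c)).inter (measurable_fst hB)

lemma multisetMeasurable_multisetPart (c : Color) :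
    MultisetMeasurable (multisetPart c : Multiset (Particle D) → Measure D) := by
  classical
  intro n
  refine Measure.measurable_of_measurable_coe _ fun B hB => ?_
  simp_rw [multisetPart_apply c _ hB]
  exact (measurable_of_countable (fun k : ℕ => (k : ℝ≥0∞))).comp
    (measurable_countP n (measurableSet_colored c hB))

lemma measurable_colorPart (c : Color) : Measurable (colorPart c : Config D → Measure D) := by
  rw [funext (colorPart_eq c)]
  exact measurable_config.2 (multisetMeasurable_multisetPart c)

lemma measurable_unordered : Measurable (unordered : Config D → Measure D × (Measure D)ᵒᵈ) :=
  (measurable_colorPart red).prodMk (measurable_colorPart blue)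

lemma multisetPart_mem_countingMeasures (c : Color) (M : Multiset (Particle D)) :
    multisetPart c M ∈ countingMeasures D := by
  induction M using Multiset.induction_on with
  | empty => exact ⟨0, Fin.elim0, by simp [multisetPart]⟩
  | cons p M ih =>
    have h : multisetPart c (p ::ₘ M) =
        (if p.2 = c then Measure.dirac p.1 else 0) + multisetPart c M := by
      simp [multisetPart]
    obtain ⟨n, q, hq⟩ := ih
    rw [h]
    split_ifs with hc
    · exact ⟨n + 1, Fin.cons p.1 q, by rw [Fin.sum_univ_succ, hq]; simp⟩
    · exact ⟨n, q, by rw [zero_add, hq]⟩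

lemma multisetConfig_mem_configurations (M : Multiset (Particle D)) :
    multisetConfig M ∈ configurations D :=
  ⟨multisetPart_mem_countingMeasures red M, multisetPart_mem_countingMeasures blue M⟩

end Unordered

end

section

section Association

/-- Positive association for nonnegative functions implies positive association. -/
theorem positivelyAssociated_of_lintegral {E : Type*} [MeasurableSpace E] [Preorder E] {S : Set E}
    {Q : Measure E} [IsProbabilityMeasure Q]
    (h : ∀ f g : E → ℝ≥0, Measurable f → Measurable g → MonotoneOn f S → MonotoneOn g S →
      (∫⁻ ξ, f ξ ∂Q) * (∫⁻ ξ, g ξ ∂Q) ≤ ∫⁻ ξ, f ξ * g ξ ∂Q) :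
    PositivelyAssociated S Q := by
  have hbdd : ∀ (N : ℝ) (f g : E → ℝ), Measurable f → Measurable g → MonotoneOn f S →
      MonotoneOn g S → (∀ ξ, |f ξ| ≤ N) → (∀ ξ, |g ξ| ≤ N) →
      (∫ ξ, f ξ ∂Q) * (∫ ξ, g ξ ∂Q) ≤ ∫ ξ, f ξ * g ξ ∂Q := by
    intro N f g hf hg hfm hgm hfN hgN
    have hN : 0 ≤ N := by
      obtain ⟨ξ⟩ : Nonempty E := Measure.nonempty_of_neZero Q
      exact (abs_nonneg _).trans (hfN ξ)
    have hpos : ∀ {f : E → ℝ}, (∀ ξ, |f ξ| ≤ N) → ∀ ξ, 0 ≤ f ξ + N := fun hf ξ => by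
      linarith [(abs_le.1 (hf ξ)).1]
    have hmono : ∀ {f : E → ℝ}, MonotoneOn f S → MonotoneOn (fun ξ => (f ξ + N).toNNReal) S :=
      fun hf a ha b hb hab => Real.toNNReal_le_toNNReal (by linarith [hf ha hb hab])
    have hi : ∀ {f : E → ℝ}, Measurable f → (∀ ξ, |f ξ| ≤ N) → Integrable f Q := fun hf hN =>
      Integrable.of_bound hf.aestronglyMeasurable N (Filter.Eventually.of_forall hN)
    have hfi := hi hf hfN
    have hgi := hi hg hgN
    have hfgi : Integrable (fun ξ => f ξ * g ξ) Q :=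
      hfi.mul_bdd hg.aestronglyMeasurable (Filter.Eventually.of_forall hgN)
    have hof : ∀ {f : E → ℝ}, Measurable f → (∀ ξ, |f ξ| ≤ N) →
        ∫⁻ ξ, ((f ξ + N).toNNReal : ℝ≥0∞) ∂Q = ENNReal.ofReal (∫ ξ, f ξ ∂Q + N) := by
      intro f hf hfN
      have e : ∫ ξ, f ξ ∂Q + N = ∫ ξ, (f ξ + N) ∂Q := by
        rw [integral_add (hi hf hfN) (integrable_const _)]; simp
      have hi' : Integrable (fun ξ => f ξ + N) Q := (hi hf hfN).add (integrable_const _)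
      rw [e, ofReal_integral_eq_lintegral_ofReal hi' (Filter.Eventually.of_forall (hpos hfN))]
      rfl
    have key := h _ _ (hf.add_const N).real_toNNReal (hg.add_const N).real_toNNReal
      (hmono hfm) (hmono hgm)
    have hprod : ∫⁻ ξ, ((f ξ + N).toNNReal : ℝ≥0∞) * ((g ξ + N).toNNReal : ℝ≥0∞) ∂Q =
        ENNReal.ofReal (∫ ξ, (f ξ + N) * (g ξ + N) ∂Q) := by
      rw [ofReal_integral_eq_lintegral_ofReal]
      · refine lintegral_congr fun ξ => ?_
        rw [ENNReal.ofReal_mul (hpos hfN ξ)]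
        rfl
      · exact ((hi hf hfN).add (integrable_const N)).mul_bdd (c := N + N)
          (hg.add_const N).aestronglyMeasurable (Filter.Eventually.of_forall fun ξ => by
            rw [Real.norm_eq_abs, abs_of_nonneg (hpos hgN ξ)]
            linarith [(abs_le.1 (hgN ξ)).2])
      · exact Filter.Eventually.of_forall fun ξ => mul_nonneg (hpos hfN ξ) (hpos hgN ξ)
    have hge : ∀ {f : E → ℝ}, (∀ ξ, |f ξ| ≤ N) → Integrable f Q → 0 ≤ ∫ ξ, f ξ ∂Q + N := by
      intro f hf hfi
      have e : ∫ ξ, f ξ ∂Q + N = ∫ ξ, (f ξ + N) ∂Q := by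
        rw [integral_add hfi (integrable_const _)]; simp
      rw [e]
      exact integral_nonneg (hpos hf)
    rw [hof hf hfN, hof hg hgN, hprod, ← ENNReal.ofReal_mul (hge hfN hfi),
      ENNReal.ofReal_le_ofReal_iff (integral_nonneg fun ξ =>
        mul_nonneg (hpos hfN ξ) (hpos hgN ξ))] at key
    have e2 : ∫ ξ, (f ξ + N) * (g ξ + N) ∂Q =
        ∫ ξ, f ξ * g ξ ∂Q + N * ∫ ξ, f ξ ∂Q + N * ∫ ξ, g ξ ∂Q + N * N := by
      have : ∀ ξ, (f ξ + N) * (g ξ + N) = f ξ * g ξ + N * f ξ + N * g ξ + N * N := fun ξ => by ring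
      simp_rw [this]
      have i1 : Integrable (fun ξ => f ξ * g ξ + N * f ξ) Q := hfgi.add (hfi.const_mul N)
      have i2 : Integrable (fun ξ => f ξ * g ξ + N * f ξ + N * g ξ) Q :=
        i1.add (hgi.const_mul N)
      rw [integral_add i2 (integrable_const _), integral_add i1 (hgi.const_mul N), integral_add hfgi (hfi.const_mul N), integral_const_mul, integral_const_mul]
      simp
    rw [e2] at key
    linarith
  intro f g hf hg hfm hgm hfi hgi hfgi
  set c : ℕ → (E → ℝ) → E → ℝ := fun N f ξ => max (-(N : ℝ)) (min (f ξ) N) with hc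
  have hcm : ∀ N {f : E → ℝ}, Measurable f → Measurable (c N f) := fun N f hf =>
    measurable_const.max (hf.min measurable_const)
  have hcmono : ∀ N {f : E → ℝ}, MonotoneOn f S → MonotoneOn (c N f) S :=
    fun N f hf a ha b hb hab => max_le_max le_rfl (min_le_min (hf ha hb hab) le_rfl)
  have hcN : ∀ (N : ℕ) (f : E → ℝ) ξ, |c N f ξ| ≤ N := by
    intro N f ξ
    have : (0 : ℝ) ≤ N := N.cast_nonneg
    rw [abs_le]
    exact ⟨le_max_left _ _, max_le (by linarith) (min_le_right _ _)⟩
  have hcle : ∀ (N : ℕ) (f : E → ℝ) ξ, |c N f ξ| ≤ |f ξ| := by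
    intro N f ξ
    have : (0 : ℝ) ≤ N := N.cast_nonneg
    rw [abs_le]
    constructor
    · refine le_max_of_le_right (le_min (neg_abs_le _) ?_)
      linarith [abs_nonneg (f ξ)]
    · exact max_le (by linarith [abs_nonneg (f ξ)]) ((min_le_left _ _).trans (le_abs_self _))
  have hclim : ∀ (f : E → ℝ) ξ, Filter.Tendsto (fun N => c N f ξ) Filter.atTop (nhds (f ξ)) := by
    intro f ξ
    obtain ⟨M, hM⟩ := exists_nat_ge |f ξ|
    refine tendsto_const_nhds.congr' ?_
    filter_upwards [Filter.eventually_ge_atTop M] with N hN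
    have hMN : (M : ℝ) ≤ N := by exact_mod_cast hN
    have h1 := abs_le.1 (hM.trans hMN)
    simp only [hc]
    rw [min_eq_left h1.2, max_eq_right h1.1]
  have t1 : ∀ {f : E → ℝ}, Measurable f → Integrable f Q →
      Filter.Tendsto (fun N => ∫ ξ, c N f ξ ∂Q) Filter.atTop (nhds (∫ ξ, f ξ ∂Q)) :=
    fun {f} hf hfi => tendsto_integral_of_dominated_convergence (fun ξ => |f ξ|)
      (fun N => (hcm N hf).aestronglyMeasurable) hfi.abs
      (fun N => Filter.Eventually.of_forall fun ξ => hcle N f ξ)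
      (Filter.Eventually.of_forall fun ξ => hclim f ξ)
  have t2 : Filter.Tendsto (fun N => ∫ ξ, c N f ξ * c N g ξ ∂Q) Filter.atTop
      (nhds (∫ ξ, f ξ * g ξ ∂Q)) :=
    tendsto_integral_of_dominated_convergence (fun ξ => |f ξ * g ξ|)
      (fun N => ((hcm N hf).mul (hcm N hg)).aestronglyMeasurable) hfgi.abs
      (fun N => Filter.Eventually.of_forall fun ξ => by
        rw [Real.norm_eq_abs, abs_mul, abs_mul]
        exact mul_le_mul (hcle N f ξ) (hcle N g ξ) (abs_nonneg _) (abs_nonneg _))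
      (Filter.Eventually.of_forall fun ξ => (hclim f ξ).mul (hclim g ξ))
  exact le_of_tendsto_of_tendsto' ((t1 hf hfi).mul (t1 hg hgi)) t2 fun N =>
    hbdd N _ _ (hcm N hf) (hcm N hg) (hcmono N hfm) (hcmono N hgm) (hcN N f) (hcN N g)

end Association

section JanossyLattice

variable {D : Type*} [MetricSpace D] [MeasurableSpace D] [BorelSpace D] {lam : Measure D}
  [IsFiniteMeasure lam] {mu : ℝ}

lemma janossy_mul_le (hmu : 0 < mu) {ι : Type*} [Fintype ι] [DecidableEq ι] (x : ι → Particle D)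
    (c : Color) (S T : Finset ι) :
    janossy lam mu (S.val.map x) * janossy lam mu (T.val.map x) ≤
      janossy lam mu ((twistSup (otherColor x c) S T).val.map x) *
        janossy lam mu ((twistInf (otherColor x c) S T).val.map x) := by
  classical
  by_cases hS : ∀ a ∈ S.val.map x, ∀ b ∈ S.val.map x, a ∉ nbhd b
  swap
  · have h0 : janossy lam mu (S.val.map x) = 0 := if_neg hS
    rw [h0, zero_mul]
    exact zero_le
  by_cases hT : ∀ a ∈ T.val.map x, ∀ b ∈ T.val.map x, a ∉ nbhd b
  swap
  · have h0 : janossy lam mu (T.val.map x) = 0 := if_neg hT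
    rw [h0, mul_zero]
    exact zero_le
  have hcol : ∀ i j, x i ∈ nbhd (x j) → ((x i).2 ≠ c ↔ ¬ (x j).2 ≠ c) := by
    intro i j hij
    have : (x i).2 = !(x j).2 := hij.2
    rw [this]
    cases (x j).2 <;> cases c <;> simp
  simp only [Multiset.mem_map, Finset.mem_val, forall_exists_index, and_imp,
    forall_apply_eq_imp_iff₂] at hS hT
  have h1 : ∀ a ∈ (twistSup (otherColor x c) S T).val.map x,
      ∀ b ∈ (twistSup (otherColor x c) S T).val.map x, a ∉ nbhd b := by
    simp only [Multiset.mem_map, Finset.mem_val, forall_exists_index, and_imp,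
      forall_apply_eq_imp_iff₂, mem_twistSup, mem_otherColor]
    intro i hi j hj hij
    have := hcol i j hij
    have := hS i; have := hT i
    by_cases hc : (x i).2 ≠ c
    · have hj' := this
      have hi' : i ∈ S ∧ i ∈ T := by tauto
      have hjST : j ∈ S ∨ j ∈ T := by tauto
      rcases hjST with h | h
      · exact hS i hi'.1 j h hij
      · exact hT i hi'.2 j h hij
    · have hj' : j ∈ S ∧ j ∈ T := by tauto
      have hiST : i ∈ S ∨ i ∈ T := by tauto
      rcases hiST with h | h
      · exact hS i h j hj'.1 hij
      · exact hT i h j hj'.2 hij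
  have h2 : ∀ a ∈ (twistInf (otherColor x c) S T).val.map x,
      ∀ b ∈ (twistInf (otherColor x c) S T).val.map x, a ∉ nbhd b := by
    simp only [Multiset.mem_map, Finset.mem_val, forall_exists_index, and_imp,
      forall_apply_eq_imp_iff₂, mem_twistInf, mem_otherColor]
    intro i hi j hj hij
    have := hcol i j hij
    by_cases hc : (x i).2 ≠ c
    · have hj' : j ∈ S ∧ j ∈ T := by tauto
      have hiST : i ∈ S ∨ i ∈ T := by tauto
      rcases hiST with h | h
      · exact hS i h j hj'.1 hij
      · exact hT i h j hj'.2 hij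
    · have hi' : i ∈ S ∧ i ∈ T := by tauto
      have hjST : j ∈ S ∨ j ∈ T := by tauto
      rcases hjST with h | h
      · exact hS i hi'.1 j h hij
      · exact hT i hi'.2 j h hij
  have hS' : ∀ a ∈ S.val.map x, ∀ b ∈ S.val.map x, a ∉ nbhd b := by simpa using hS
  have hT' : ∀ a ∈ T.val.map x, ∀ b ∈ T.val.map x, a ∉ nbhd b := by simpa using hT
  simp only [janossy, if_pos hS', if_pos hT', if_pos h1, if_pos h2]
  have h0 := fun M => piTildeMultiset_nonneg lam hmu M
  rw [← Real.toNNReal_mul (h0 _), ← Real.toNNReal_mul (h0 _)]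
  exact Real.toNNReal_le_toNNReal (logSupermodular_piTildeMultiset lam hmu x c S T)

/-- `F` increases when particles of colour `c` are added and others are removed. -/
def ColorMonotone {D β : Type*} [LE β] (c : Color) (F : Multiset (Particle D) → β) : Prop :=
  ∀ (n : ℕ) (x : Fin n → Particle D) (S T : Finset (Fin n)),
    (∀ i, (x i).2 = c → i ∈ S → i ∈ T) → (∀ i, (x i).2 ≠ c → i ∈ T → i ∈ S) →
      F (S.val.map x) ≤ F (T.val.map x)

lemma ColorMonotone.le_twistSup_left {D β : Type*} [LE β] {c : Color}
    {F : Multiset (Particle D) → β} (hF : ColorMonotone c F) {n : ℕ} (x : Fin n → Particle D)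
    (S T : Finset (Fin n)) :
    F (S.val.map x) ≤ F ((twistSup (otherColor x c) S T).val.map x) :=
  hF n x _ _ (fun i hi hS => by rw [mem_twistSup, mem_otherColor]; tauto)
    (fun i hi hS => by rw [mem_twistSup, mem_otherColor] at hS; tauto)

lemma ColorMonotone.le_twistSup_right {D β : Type*} [LE β] {c : Color}
    {F : Multiset (Particle D) → β} (hF : ColorMonotone c F) {n : ℕ} (x : Fin n → Particle D)
    (S T : Finset (Fin n)) :
    F (T.val.map x) ≤ F ((twistSup (otherColor x c) S T).val.map x) :=
  hF n x _ _ (fun i hi hS => by rw [mem_twistSup, mem_otherColor]; tauto)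
    (fun i hi hS => by rw [mem_twistSup, mem_otherColor] at hS; tauto)

lemma ColorMonotone.twistInf_le_left {D β : Type*} [LE β] {c : Color}
    {F : Multiset (Particle D) → β} (hF : ColorMonotone c F) {n : ℕ} (x : Fin n → Particle D)
    (S T : Finset (Fin n)) :
    F ((twistInf (otherColor x c) S T).val.map x) ≤ F (S.val.map x) :=
  hF n x _ _ (fun i hi hS => by rw [mem_twistInf, mem_otherColor] at hS; tauto)
    (fun i hi hS => by rw [mem_twistInf, mem_otherColor]; tauto)

variable [SecondCountableTopology D]

lemma MultisetMeasurable.mul {X β : Type*} [MeasurableSpace X] [MeasurableSpace β] [Mul β]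
    [MeasurableMul₂ β] {F G : Multiset X → β} (hF : MultisetMeasurable F)
    (hG : MultisetMeasurable G) : MultisetMeasurable fun M => F M * G M :=
  fun n => (hF n).mul (hG n)

lemma poissonIntegral_janossy_mul_le (hmu : 0 < mu) (c : Color)
    {F G : Multiset (Particle D) → ℝ≥0} (hF : MultisetMeasurable F) (hG : MultisetMeasurable G)
    (hFm : ColorMonotone c F) (hGm : ColorMonotone c G) :
    poissonIntegral (lamBar lam) (fun M => (janossy lam mu M * F M : ℝ≥0)) *
      poissonIntegral (lamBar lam) (fun M => (janossy lam mu M * G M : ℝ≥0)) ≤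
    poissonIntegral (lamBar lam) (fun M => (janossy lam mu M * (F M * G M) : ℝ≥0)) *
      poissonIntegral (lamBar lam) (fun M => janossy lam mu M) := by
  have hj := multisetMeasurable_janossy lam hmu
  refine poissonIntegral_four_functions _ (hj.mul hF) (hj.mul hG) (hj.mul (hF.mul hG)) hj ?_
  intro n x
  refine ⟨otherColor x c, fun S T => ?_⟩
  calc janossy lam mu (S.val.map x) * F (S.val.map x) *
        (janossy lam mu (T.val.map x) * G (T.val.map x))
      = (janossy lam mu (S.val.map x) * janossy lam mu (T.val.map x)) *
        (F (S.val.map x) * G (T.val.map x)) := by ring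
    _ ≤ (janossy lam mu ((twistSup (otherColor x c) S T).val.map x) *
        janossy lam mu ((twistInf (otherColor x c) S T).val.map x)) *
        (F ((twistSup (otherColor x c) S T).val.map x) *
          G ((twistSup (otherColor x c) S T).val.map x)) :=
      mul_le_mul' (janossy_mul_le hmu x c S T)
        (mul_le_mul' (hFm.le_twistSup_left x S T) (hGm.le_twistSup_right x S T))
    _ = _ := by ring

/-- The law of the unordered configuration under the normalized product form. -/
structure IsNormalizedProductForm (lam : Measure D) (mu : ℝ) (π : Measure (Config D))
    (K : ℝ≥0) : Prop where
  pos : 0 < K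
  eq : π = K • productForm lam mu
  prob : IsProbabilityMeasure π

variable {π : Measure (Config D)} {K : ℝ≥0}

lemma IsNormalizedProductForm.lintegral (hmu : 0 < mu) (h : IsNormalizedProductForm lam mu π K)
    {F : Multiset (Particle D) → ℝ≥0} (hF : MultisetMeasurable F) :
    ∫⁻ γ, F (toMultiset γ) ∂π =
      K * poissonIntegral (lamBar lam) (fun M => (janossy lam mu M * F M : ℝ≥0)) := by
  rw [h.eq, lintegral_smul_measure, lintegral_productForm_toMultiset lam hmu
    (F := fun M => (F M : ℝ≥0∞)) fun n => (hF n).coe_nnreal_ennreal]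
  simp only [ENNReal.coe_mul]
  rfl

lemma IsNormalizedProductForm.mul_poissonIntegral_janossy (hmu : 0 < mu)
    (h : IsNormalizedProductForm lam mu π K) :
    (K : ℝ≥0∞) * poissonIntegral (lamBar lam) (fun M => janossy lam mu M) = 1 := by
  have := h.prob
  have h1 := h.lintegral hmu (F := fun _ => 1) (fun n => measurable_const)
  simpa using h1.symm

/-- Positive association for functions of multisets. -/
theorem IsNormalizedProductForm.lintegral_mul_le (hmu : 0 < mu)
    (h : IsNormalizedProductForm lam mu π K) (c : Color)
    {F G : Multiset (Particle D) → ℝ≥0} (hF : MultisetMeasurable F) (hG : MultisetMeasurable G)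
    (hFm : ColorMonotone c F) (hGm : ColorMonotone c G) :
    (∫⁻ γ, F (toMultiset γ) ∂π) * (∫⁻ γ, G (toMultiset γ) ∂π) ≤
      ∫⁻ γ, F (toMultiset γ) * G (toMultiset γ) ∂π := by
  have e := h.lintegral hmu (hF.mul hG)
  simp only [ENNReal.coe_mul] at e
  rw [h.lintegral hmu hF, h.lintegral hmu hG, e]
  have key := poissonIntegral_janossy_mul_le (lam := lam) hmu c hF hG hFm hGm
  have h1 := h.mul_poissonIntegral_janossy hmu
  set A := poissonIntegral (lamBar lam) (fun M => janossy lam mu M)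
  set I₁ := poissonIntegral (lamBar lam) (fun M => (janossy lam mu M * F M : ℝ≥0))
  set I₂ := poissonIntegral (lamBar lam) (fun M => (janossy lam mu M * G M : ℝ≥0))
  set I₃ := poissonIntegral (lamBar lam) (fun M => (janossy lam mu M * (F M * G M) : ℝ≥0))
  calc (K : ℝ≥0∞) * I₁ * (K * I₂) = K * K * (I₁ * I₂) := by ring
    _ ≤ K * K * (I₃ * A) := mul_le_mul_right key _
    _ = K * I₃ * (K * A) := by ring
    _ = K * I₃ := by rw [h1, mul_one]

end JanossyLattice

section Laws

variable {D : Type*} [MeasurableSpace D]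

lemma multisetPart_map_val_le {ι : Type*} (x : ι → Particle D) (c : Color) {S T : Finset ι}
    (h : ∀ i, (x i).2 = c → i ∈ S → i ∈ T) :
    multisetPart c (S.val.map x) ≤ multisetPart c (T.val.map x) := by
  classical
  refine Measure.le_iff.2 fun B hB => ?_
  rw [multisetPart_apply c _ hB, multisetPart_apply c _ hB]
  norm_cast
  rw [Multiset.countP_map, Multiset.countP_map, ← Finset.filter_val, ← Finset.filter_val,
    Finset.card_val, Finset.card_val]
  refine Finset.card_le_card fun i hi => ?_
  rw [Finset.mem_filter] at hi ⊢
  exact ⟨h i hi.2.1 hi.1, hi.2⟩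

lemma colorMonotone_comp_multisetPart {β : Type*} [Preorder β] {c : Color} {f : Measure D → β}
    (hf : MonotoneOn f (countingMeasures D)) : ColorMonotone c fun M => f (multisetPart c M) :=
  fun _ x _ _ h _ => hf (multisetPart_mem_countingMeasures c _)
    (multisetPart_mem_countingMeasures c _) (multisetPart_map_val_le x c h)

lemma colorMonotone_comp_multisetConfig {β : Type*} [Preorder β]
    {f : Measure D × (Measure D)ᵒᵈ → β} (hf : MonotoneOn f (configurations D)) :
    ColorMonotone red fun M => f (multisetConfig M) := by
  intro n x S T h1 h2
  refine hf (multisetConfig_mem_configurations _) (multisetConfig_mem_configurations _)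
    ⟨multisetPart_map_val_le x red h1, ?_⟩
  exact multisetPart_map_val_le x blue fun i hi => h2 i (by rw [hi]; simp)

lemma measurable_toNNReal_apply {B : Set D} (hB : MeasurableSet B) :
    Measurable fun ν : Measure D => (ν B).toNNReal :=
  (Measure.measurable_coe hB).ennreal_toNNReal

lemma countingMeasures_apply_ne_top {ν : Measure D} (hν : ν ∈ countingMeasures D) (B : Set D) :
    ν B ≠ ∞ := by
  obtain ⟨n, p, rfl⟩ := hν
  exact measure_ne_top _ _

lemma monotoneOn_toNNReal_apply (B : Set D) :
    MonotoneOn (fun ν : Measure D => (ν B).toNNReal) (countingMeasures D) :=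
  fun _ _ _ hν' h => ENNReal.toNNReal_mono (countingMeasures_apply_ne_top hν' B) (h B)

end Laws

end

section

section Moments

variable {D : Type*} [MetricSpace D] [MeasurableSpace D] [BorelSpace D] {lam : Measure D}
  [IsFiniteMeasure lam] {mu : ℝ} [SecondCountableTopology D] {π : Measure (Config D)} {K : ℝ≥0}

/-- The mean number of particles is finite. -/
lemma IsNormalizedProductForm.lintegral_length_lt_top (hmu : 0 < mu)
    (h : IsNormalizedProductForm lam mu π K) : ∫⁻ γ, (γ.1 : ℝ≥0∞) ∂π < ∞ := by
  have := h.prob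
  have hinv : IsInvariant lam mu π := h.eq ▸ (isInvariant_productForm lam hmu).smul K
  have e1 : ∫⁻ γ, (γ.1 : ℝ≥0∞) ∂π = ∑' n : ℕ, (n : ℝ≥0∞) * π (level D n) := by
    rw [← lintegral_map (f := fun n : ℕ => (n : ℝ≥0∞)) (measurable_of_countable _)
      measurable_config_length, lintegral_countable']
    congr 1; funext n
    rw [Measure.map_apply measurable_config_length (measurableSet_singleton n)]
    rfl
  have e2 : ∑' n, π (level D n) ≤ 1 := by
    rw [← measure_iUnion (fun i j hij => Set.disjoint_left.2 fun γ (h : γ.1 = i) (h' : γ.1 = j) =>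
      hij (h.symm.trans h')) fun n => measurableSet_level n]
    exact prob_le_one
  have e3 : ∀ n : ℕ, ((n + 1 : ℕ) : ℝ≥0∞) * π (level D (n + 1)) ≤
      ENNReal.ofReal ((lamBar lam).real univ / mu) * π (level D n) := by
    intro n
    have h1 := hinv.level_succ_le hmu n
    rw [← ofReal_measureReal, ← ofReal_measureReal, ← ENNReal.ofReal_natCast,
      ← ENNReal.ofReal_mul (Nat.cast_nonneg _),
      ← ENNReal.ofReal_mul (div_nonneg measureReal_nonneg hmu.le)]
    refine ENNReal.ofReal_le_ofReal ?_
    rw [div_mul_eq_mul_div, le_div_iff₀ hmu]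
    push_cast
    linarith
  rw [e1, tsum_eq_zero_add' ENNReal.summable]
  simp only [Nat.cast_zero, zero_mul, zero_add]
  calc _ ≤ ∑' n, ENNReal.ofReal ((lamBar lam).real univ / mu) * π (level D n) :=
        ENNReal.tsum_le_tsum e3
    _ = ENNReal.ofReal ((lamBar lam).real univ / mu) * ∑' n, π (level D n) :=
        ENNReal.tsum_mul_left
    _ ≤ ENNReal.ofReal ((lamBar lam).real univ / mu) * 1 := mul_le_mul_right e2 _
    _ < ∞ := by rw [mul_one]; exact ENNReal.ofReal_lt_top

lemma ColorMonotone.prod {D : Type*} {c : Color} {ι : Type*} {F : ι → Multiset (Particle D) → ℝ≥0}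
    (hF : ∀ i, ColorMonotone c (F i)) (s : Finset ι) : ColorMonotone c fun M => ∏ i ∈ s, F i M :=
  fun n x S T h1 h2 => Finset.prod_le_prod' fun i _ => hF i n x S T h1 h2

lemma IsNormalizedProductForm.prod_lintegral_le (hmu : 0 < mu)
    (h : IsNormalizedProductForm lam mu π K) (c : Color) {ι : Type*}
    {F : ι → Multiset (Particle D) → ℝ≥0} (hF : ∀ i, MultisetMeasurable (F i))
    (hFm : ∀ i, ColorMonotone c (F i)) (s : Finset ι) :
    ∏ i ∈ s, ∫⁻ γ, F i (toMultiset γ) ∂π ≤ ∫⁻ γ, ∏ i ∈ s, (F i (toMultiset γ) : ℝ≥0∞) ∂π := by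
  classical
  have := h.prob
  induction s using Finset.induction_on with
  | empty => simp
  | insert i s hi ih =>
    rw [Finset.prod_insert hi]
    simp_rw [Finset.prod_insert hi]
    have hm : MultisetMeasurable fun M => ∏ i ∈ s, F i M := fun n =>
      Finset.measurable_fun_prod s fun i _ => hF i n
    have h1 := h.lintegral_mul_le hmu c (hF i) hm (hFm i) (ColorMonotone.prod hFm s)
    simp only [ENNReal.ofNNReal_finsetProd] at h1
    exact (mul_le_mul_right ih _).trans h1

end Moments

section Voids

lemma add_pow_le_pow_add_mul (t δ : ℝ≥0) (n : ℕ) :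
    (t + δ) ^ n ≤ t ^ n + δ * (n * (t + δ) ^ (n - 1)) := by
  induction n with
  | zero => simp
  | succ n ih =>
    have h1 : t * (n * (t + δ) ^ (n - 1)) ≤ n * (t + δ) ^ n := by
      cases n with
      | zero => simp
      | succ n =>
        calc t * ((n + 1 : ℕ) * (t + δ) ^ (n + 1 - 1))
            ≤ (t + δ) * ((n + 1 : ℕ) * (t + δ) ^ (n + 1 - 1)) :=
              mul_le_mul_left le_self_add _
          _ = (n + 1 : ℕ) * (t + δ) ^ (n + 1) := by rw [Nat.add_sub_cancel]; ring
    calc (t + δ) ^ (n + 1) = t * (t + δ) ^ n + δ * (t + δ) ^ n := by ring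
      _ ≤ t * (t ^ n + δ * (n * (t + δ) ^ (n - 1))) + δ * (t + δ) ^ n := by gcongr
      _ = t ^ (n + 1) + δ * (t * (n * (t + δ) ^ (n - 1))) + δ * (t + δ) ^ n := by ring
      _ ≤ t ^ (n + 1) + δ * (n * (t + δ) ^ n) + δ * (t + δ) ^ n := by gcongr
      _ = t ^ (n + 1) + δ * ((n + 1 : ℕ) * (t + δ) ^ (n + 1 - 1)) := by
        rw [Nat.add_sub_cancel]; push_cast; ring

/-- A function `g` on `[0, 1]` with `g 1 = 1` and `g' ≤ m g` satisfies `g 0 ≥ exp (-m)`. -/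
lemma exp_neg_le_of_forall_le {g : ℝ≥0 → ℝ} {m : ℝ} (h1 : g 1 = 1)
    (h : ∀ t δ : ℝ≥0, t + δ ≤ 1 → g (t + δ) ≤ g t + δ * (m * g (t + δ))) :
    Real.exp (-m) ≤ g 0 := by
  refine le_of_tendsto (Real.tendsto_one_add_div_pow_exp (-m)) ?_
  obtain ⟨N₀, hN₀⟩ := exists_nat_gt (max m 0)
  filter_upwards [Filter.eventually_ge_atTop N₀] with N hN
  have hN' : max m 0 < N := hN₀.trans_le (by exact_mod_cast hN)
  have hNpos : (0 : ℝ) < N := (le_max_right _ _).trans_lt hN'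
  have hq : 0 ≤ 1 + -m / N := by
    have : m / N ≤ 1 := (div_le_one hNpos).2 ((le_max_left _ _).trans hN'.le)
    rw [neg_div]
    linarith
  have hNne : (N : ℝ≥0) ≠ 0 := by exact_mod_cast hNpos.ne'
  have key : ∀ j : ℕ, j ≤ N → (1 + -m / N) ^ j * g (j / N) ≤ g 0 := by
    intro j
    induction j with
    | zero => simp
    | succ j ih =>
      intro hj
      refine le_trans ?_ (ih (by omega))
      rw [pow_succ, mul_assoc]
      refine mul_le_mul_of_nonneg_left ?_ (pow_nonneg hq j)
      have e : (((j + 1 : ℕ) : ℝ≥0) / N) = j / N + 1 / N := by push_cast; rw [add_div]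
      have := h (j / N) (1 / N) (by
        rw [← e, div_le_one (pos_iff_ne_zero.2 hNne)]
        exact_mod_cast hj)
      rw [← e] at this
      push_cast at this ⊢
      have e2 : (1 + -m / N) * g ((j + 1) / N) =
        g ((j + 1) / N) - 1 / N * (m * g ((j + 1) / N)) := by ring
      rw [e2]
      linarith
  have := key N le_rfl
  rwa [div_self hNne, h1, mul_one] at this

variable {D : Type*}

open Classical in
/-- The number of particles of a multiset in the set `A`. -/
def countIn (A : Set (Particle D)) (M : Multiset (Particle D)) : ℕ := M.countP (· ∈ A)

lemma countIn_le_card (A : Set (Particle D)) (M : Multiset (Particle D)) :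
    countIn A M ≤ Multiset.card M := by
  classical
  exact Multiset.countP_le_card _ _

lemma multisetMeasurable_countIn [MeasurableSpace D] {A : Set (Particle D)}
    (hA : MeasurableSet A) : MultisetMeasurable (countIn A) := by
  classical
  intro n
  exact measurable_countP n hA

lemma multisetMeasurable_pow_countIn [MeasurableSpace D] {A : Set (Particle D)} (hA : MeasurableSet A) (s : ℝ≥0) :
    MultisetMeasurable fun M => s ^ countIn A M :=
  fun n => (measurable_of_countable fun k : ℕ => s ^ k).comp (multisetMeasurable_countIn hA n)

lemma measurable_cons_map {β : Type*} [MeasurableSpace D] [MeasurableSpace β] {F : Multiset (Particle D) → β}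
    (hF : MultisetMeasurable F) (n : ℕ) :
    Measurable fun p : Particle D × (Fin n → Particle D) =>
      F (p.1 ::ₘ Finset.univ.val.map p.2) := by
  have h := (hF (n + 1)).comp (measurable_insertNth (X := Particle D) 0)
  simp only [Function.comp_def, map_univ_insertNth] at h
  exact h

lemma colorMonotone_countIn {A : Set (Particle D)} {c : Color} (hA : ∀ a ∈ A, a.2 = c) :
    ColorMonotone c (countIn A) := by
  classical
  intro n x S T h1 _
  rw [countIn, countIn, Multiset.countP_map, Multiset.countP_map, ← Finset.filter_val,
    ← Finset.filter_val, Finset.card_val, Finset.card_val]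
  refine Finset.card_le_card fun i hi => ?_
  rw [Finset.mem_filter] at hi ⊢
  exact ⟨h1 i (hA _ hi.2) hi.1, hi.2⟩

variable [MetricSpace D] [MeasurableSpace D] [BorelSpace D] {lam : Measure D}
  [IsFiniteMeasure lam] {mu : ℝ}

lemma janossy_cons_mul_le (hmu : 0 < mu) {ι : Type*} [Fintype ι] [DecidableEq ι]
    (x : ι → Particle D) (a : Particle D) (S T : Finset ι) :
    janossy lam mu (a ::ₘ S.val.map x) * janossy lam mu (T.val.map x) ≤
      janossy lam mu (a ::ₘ (twistSup (otherColor x a.2) S T).val.map x) *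
        janossy lam mu ((twistInf (otherColor x a.2) S T).val.map x) := by
  set y : Option ι → Particle D := fun o => o.elim a x
  have e1 : ∀ S : Finset ι, (Finset.insertNone S).val.map y = a ::ₘ S.val.map x := by
    intro S
    simp [Finset.insertNone, y, Function.comp_def]
  have e2 : ∀ T : Finset ι, (T.map Function.Embedding.some).val.map y = T.val.map x := by
    intro T
    simp [y, Function.comp_def]
  have h := janossy_mul_le (lam := lam) hmu y a.2 (Finset.insertNone S)
    (T.map Function.Embedding.some)
  have e3 : twistSup (otherColor y a.2) (Finset.insertNone S) (T.map Function.Embedding.some) =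
      Finset.insertNone (twistSup (otherColor x a.2) S T) := by
    ext o
    cases o <;> simp [mem_twistSup, mem_otherColor, y]
  have e4 : twistInf (otherColor y a.2) (Finset.insertNone S) (T.map Function.Embedding.some) =
      (twistInf (otherColor x a.2) S T).map Function.Embedding.some := by
    ext o
    cases o <;> simp [mem_twistInf, mem_otherColor, y]
  rwa [e3, e4, e1, e1, e2, e2] at h

variable [SecondCountableTopology D]

lemma poissonIntegral_janossy_cons_mul_le (hmu : 0 < mu) {A : Set (Particle D)}
    (hA : MeasurableSet A) (a : Particle D) (hAc : ∀ b ∈ A, b.2 = a.2) {s : ℝ≥0} (hs : s ≤ 1) :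
    poissonIntegral (lamBar lam) (fun M => (janossy lam mu (a ::ₘ M) * s ^ countIn A M : ℝ≥0)) *
      poissonIntegral (lamBar lam) (fun M => janossy lam mu M) ≤
    poissonIntegral (lamBar lam) (fun M => janossy lam mu (a ::ₘ M)) *
      poissonIntegral (lamBar lam) (fun M => (janossy lam mu M * s ^ countIn A M : ℝ≥0)) := by
  have hj := multisetMeasurable_janossy lam hmu
  have hja : MultisetMeasurable fun M => janossy lam mu (a ::ₘ M) := fun n =>
    (measurable_cons_map hj n).comp measurable_prodMk_left
  have hs' := multisetMeasurable_pow_countIn hA s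
  refine poissonIntegral_four_functions _ (hja.mul hs') hj hja (hj.mul hs') fun n x =>
    ⟨otherColor x a.2, fun S T => ?_⟩
  calc _ = janossy lam mu (a ::ₘ S.val.map x) * janossy lam mu (T.val.map x) *
        s ^ countIn A (S.val.map x) := by ring
    _ ≤ janossy lam mu (a ::ₘ (twistSup (otherColor x a.2) S T).val.map x) *
        janossy lam mu ((twistInf (otherColor x a.2) S T).val.map x) *
        s ^ countIn A ((twistInf (otherColor x a.2) S T).val.map x) :=
      mul_le_mul' (janossy_cons_mul_le hmu x a S T) (pow_le_pow_of_le_one zero_le hs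
        ((colorMonotone_countIn hAc).twistInf_le_left x S T))
    _ = _ := by ring

lemma poissonIntegral_janossy_mul_countIn (hmu : 0 < mu) {A : Set (Particle D)}
    (hA : MeasurableSet A) (s : ℝ≥0) :
    poissonIntegral (lamBar lam)
        (fun M => (janossy lam mu M * (countIn A M * s ^ (countIn A M - 1)) : ℝ≥0)) =
      ∫⁻ a in A, poissonIntegral (lamBar lam)
        (fun M => (janossy lam mu (a ::ₘ M) * s ^ countIn A M : ℝ≥0)) ∂(lamBar lam) := by
  classical
  have hj := multisetMeasurable_janossy lam hmu
  set H : Particle D → Multiset (Particle D) → ℝ≥0∞ := fun a M =>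
    A.indicator 1 a * (janossy lam mu (a ::ₘ M) * s ^ countIn A M : ℝ≥0) with hH
  have hHm : ∀ n : ℕ, Measurable fun p : Particle D × (Fin n → Particle D) =>
      H p.1 (Finset.univ.val.map p.2) := fun n =>
    ((measurable_one.indicator hA).comp measurable_fst).mul
      ((measurable_cons_map hj n).mul
        ((multisetMeasurable_pow_countIn hA s n).comp measurable_snd)).coe_nnreal_ennreal
  have e1 : ∀ M : Multiset (Particle D), (M.map fun a => H a (M.erase a)).sum =
      (janossy lam mu M * (countIn A M * s ^ (countIn A M - 1)) : ℝ≥0) := by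
    intro M
    have h1 : ∀ a ∈ M, H a (M.erase a) = A.indicator 1 a *
        (janossy lam mu M * s ^ (countIn A M - 1) : ℝ≥0) := by
      intro a ha
      by_cases haA : a ∈ A
      · simp only [hH]
        rw [Multiset.cons_erase ha]
        have : countIn A M = countIn A (M.erase a) + 1 := by
          conv_lhs => rw [← Multiset.cons_erase ha]
          exact Multiset.countP_cons_of_pos _ haA
        rw [this, Nat.add_sub_cancel]
      · simp [hH, haA]
    rw [Multiset.map_congr rfl h1, Multiset.sum_map_mul_right]
    have h2 : (M.map (A.indicator (1 : Particle D → ℝ≥0∞))).sum = countIn A M := by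
      clear h1
      induction M using Multiset.induction_on with
      | empty => simp [countIn]
      | cons a M ih =>
        rw [Multiset.map_cons, Multiset.sum_cons, countIn, Multiset.countP_cons]
        by_cases haA : a ∈ A
        · simp [haA, ih, countIn, add_comm]
        · simp [haA, ih, countIn]
    rw [h2]
    push_cast
    ring
  rw [← lintegral_indicator hA, ← funext e1]
  refine Eq.trans (by congr!) ((poissonIntegral_mecke (lamBar lam) hHm).trans ?_)
  refine lintegral_congr fun a => ?_
  by_cases haA : a ∈ A
  · simp [hH, haA]
  · simp [hH, haA, poissonIntegral]

variable {π : Measure (Config D)} {K : ℝ≥0}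

lemma IsNormalizedProductForm.lintegral_countIn_mul_pow_le (hmu : 0 < mu)
    (h : IsNormalizedProductForm lam mu π K) {A : Set (Particle D)} (hA : MeasurableSet A)
    {c : Color} (hAc : ∀ a ∈ A, a.2 = c) {s : ℝ≥0} (hs : s ≤ 1) :
    ∫⁻ γ, ((countIn A (toMultiset γ) * s ^ (countIn A (toMultiset γ) - 1) : ℝ≥0) : ℝ≥0∞) ∂π ≤
      (∫⁻ γ, (countIn A (toMultiset γ) : ℝ≥0) ∂π) *
        ∫⁻ γ, (s ^ countIn A (toMultiset γ) : ℝ≥0) ∂π := by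
  have := h.prob
  have hc := multisetMeasurable_countIn hA
  have hG1 : ∫⁻ γ, (s ^ countIn A (toMultiset γ) : ℝ≥0) ∂π ≠ ∞ := by
    refine ne_top_of_le_ne_top ENNReal.one_ne_top ?_
    calc ∫⁻ γ, (s ^ countIn A (toMultiset γ) : ℝ≥0) ∂π ≤ ∫⁻ _, 1 ∂π :=
          lintegral_mono fun γ => ENNReal.coe_le_one_iff.2 (pow_le_one₀ zero_le hs)
      _ = 1 := by simp
  have hA1 := h.mul_poissonIntegral_janossy hmu
  have hG := h.lintegral hmu (multisetMeasurable_pow_countIn hA s)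
  have hmom : ∀ s : ℝ≥0,
      ∫⁻ γ, ((countIn A (toMultiset γ) * s ^ (countIn A (toMultiset γ) - 1) : ℝ≥0) : ℝ≥0∞) ∂π =
      ∫⁻ a in A, K * poissonIntegral (lamBar lam)
        (fun M => (janossy lam mu (a ::ₘ M) * s ^ countIn A M : ℝ≥0)) ∂(lamBar lam) := by
    intro s
    rw [lintegral_const_mul' _ _ ENNReal.coe_ne_top, ← poissonIntegral_janossy_mul_countIn hmu hA s]
    exact h.lintegral hmu (F := fun M => countIn A M * s ^ (countIn A M - 1)) fun n =>
      (measurable_of_countable fun k : ℕ => (k : ℝ≥0) * s ^ (k - 1)).comp (hc n)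
  have hm := hmom 1
  simp only [one_pow, mul_one] at hm
  rw [hmom s, hm, ← lintegral_mul_const' _ _ hG1]
  refine setLIntegral_mono' hA fun a ha => ?_
  have key := poissonIntegral_janossy_cons_mul_le (lam := lam) hmu hA a
    (fun b hb => (hAc b hb).trans (hAc a ha).symm) hs
  rw [hG]
  set I₀ := poissonIntegral (lamBar lam) (fun M => janossy lam mu M)
  set I₁ := poissonIntegral (lamBar lam)
    (fun M => (janossy lam mu (a ::ₘ M) * s ^ countIn A M : ℝ≥0))
  set I₂ := poissonIntegral (lamBar lam) (fun M => (janossy lam mu M * s ^ countIn A M : ℝ≥0))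
  set I₃ := poissonIntegral (lamBar lam) (fun M => janossy lam mu (a ::ₘ M))
  calc (K : ℝ≥0∞) * I₁ = K * I₁ * (K * I₀) := by rw [hA1, mul_one]
    _ = K * K * (I₁ * I₀) := by ring
    _ ≤ K * K * (I₃ * I₂) := mul_le_mul_right key _
    _ = K * I₃ * (K * I₂) := by ring

/-- Void probabilities are at least those of a Poisson process with the same mean. -/
theorem IsNormalizedProductForm.exp_neg_le_void (hmu : 0 < mu)
    (h : IsNormalizedProductForm lam mu π K) {A : Set (Particle D)} (hA : MeasurableSet A)
    {c : Color} (hAc : ∀ a ∈ A, a.2 = c)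
    (hfin : ∫⁻ γ, (countIn A (toMultiset γ) : ℝ≥0) ∂π ≠ ∞) :
    ENNReal.ofReal (Real.exp (-(∫⁻ γ, (countIn A (toMultiset γ) : ℝ≥0) ∂π).toReal)) ≤
      π {γ | countIn A (toMultiset γ) = 0} := by
  have := h.prob
  set m := ∫⁻ γ, (countIn A (toMultiset γ) : ℝ≥0) ∂π with hm
  set G : ℝ≥0 → ℝ≥0∞ := fun s => ∫⁻ γ, (s ^ countIn A (toMultiset γ) : ℝ≥0) ∂π with hG
  have hcm : Measurable fun γ : Config D => countIn A (toMultiset γ) :=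
    measurable_config.2 (multisetMeasurable_countIn hA)
  have hGtop : ∀ s ≤ 1, G s ≠ ∞ := by
    intro s hs
    refine ne_top_of_le_ne_top ENNReal.one_ne_top ?_
    calc G s ≤ ∫⁻ _, 1 ∂π :=
          lintegral_mono fun γ => ENNReal.coe_le_one_iff.2 (pow_le_one₀ zero_le hs)
      _ = 1 := by simp
  have hstep : ∀ t δ : ℝ≥0, t + δ ≤ 1 → G (t + δ) ≤ G t + δ * (m * G (t + δ)) := by
    intro t δ htδ
    have hd : Measurable fun γ : Config D => ((countIn A (toMultiset γ) *
        (t + δ) ^ (countIn A (toMultiset γ) - 1) : ℝ≥0) : ℝ≥0∞) :=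
      (measurable_of_countable fun k : ℕ => (((k : ℝ≥0) * (t + δ) ^ (k - 1) : ℝ≥0) : ℝ≥0∞)).comp
        hcm
    calc G (t + δ) ≤ ∫⁻ γ, ((t ^ countIn A (toMultiset γ) : ℝ≥0) : ℝ≥0∞) + δ *
          ((countIn A (toMultiset γ) * (t + δ) ^ (countIn A (toMultiset γ) - 1) : ℝ≥0) : ℝ≥0∞)
            ∂π := lintegral_mono fun γ => by
          rw [← ENNReal.coe_mul, ← ENNReal.coe_add]
          exact ENNReal.coe_le_coe.2 (add_pow_le_pow_add_mul t δ (countIn A (toMultiset γ)))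
      _ = G t + δ * ∫⁻ γ, ((countIn A (toMultiset γ) *
            (t + δ) ^ (countIn A (toMultiset γ) - 1) : ℝ≥0) : ℝ≥0∞) ∂π := by
        rw [lintegral_add_right _ (hd.const_mul _), lintegral_const_mul _ hd]
      _ ≤ G t + δ * (m * G (t + δ)) := by
        gcongr
        exact h.lintegral_countIn_mul_pow_le hmu hA hAc htδ
  have hG0 : G 0 = π {γ | countIn A (toMultiset γ) = 0} := by
    have hs : MeasurableSet {γ : Config D | countIn A (toMultiset γ) = 0} :=
      hcm (measurableSet_singleton 0)
    rw [← lintegral_indicator_one hs]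
    refine lintegral_congr fun γ => ?_
    by_cases h0 : countIn A (toMultiset γ) = 0
    · simp [indicator, h0]
    · simp [indicator, h0]
  rw [← hG0]
  refine ENNReal.ofReal_le_of_le_toReal (exp_neg_le_of_forall_le (g := fun s => (G s).toReal) ?_ ?_)
  · simp [hG]
  · intro t δ htδ
    have ht : t ≤ 1 := le_self_add.trans htδ
    have h1 : m * G (t + δ) ≠ ∞ := ENNReal.mul_ne_top hfin (hGtop _ htδ)
    have h2 := ENNReal.toReal_mono (ENNReal.add_ne_top.2
      ⟨hGtop t ht, ENNReal.mul_ne_top ENNReal.coe_ne_top h1⟩) (hstep t δ htδ)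
    rwa [ENNReal.toReal_add (hGtop t ht) (ENNReal.mul_ne_top ENNReal.coe_ne_top h1),
      ENNReal.toReal_mul, ENNReal.toReal_mul, ENNReal.coe_toReal] at h2

end Voids

end

section

section StationaryLaw

variable {D : Type*} [MetricSpace D] [MeasurableSpace D] [BorelSpace D] {lam : Measure D}
  [IsFiniteMeasure lam] {mu : ℝ} [SecondCountableTopology D] {π : Measure (Config D)} {K : ℝ≥0}

open Classical in
theorem IsNormalizedProductForm.hasJanossyDensity (hmu : 0 < mu)
    (h : IsNormalizedProductForm lam mu π K) :
    HasJanossyDensity (π.map unordered) (lamBar lam)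
      (fun _ x => K * (if Valid x then 1 else 0) * piTilde lam mu x) := by
  intro F hF
  have hFm : MultisetMeasurable fun M => F (multisetConfig M) := fun n =>
    hF.comp (((multisetMeasurable_multisetPart red) n).prodMk
      ((multisetMeasurable_multisetPart blue) n))
  rw [lintegral_map hF measurable_unordered]
  simp_rw [unordered_eq]
  rw [h.eq, lintegral_smul_measure, lintegral_productForm_toMultiset lam hmu hFm, poissonIntegral,
    ENNReal.smul_def, smul_eq_mul, ← ENNReal.tsum_mul_left]
  congr 1; funext n
  rw [mul_left_comm, ← lintegral_const_mul' _ _ ENNReal.coe_ne_top]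
  congr 1
  refine lintegral_congr fun x => ?_
  rw [mul_assoc (K : ℝ), ← coe_janossy_map_univ lam hmu x, ← NNReal.coe_mul,
    ENNReal.ofReal_coe_nnreal, ENNReal.coe_mul, mul_assoc]
  rfl

theorem IsNormalizedProductForm.positivelyAssociated_unordered (hmu : 0 < mu)
    (h : IsNormalizedProductForm lam mu π K) :
    PositivelyAssociated (configurations D) (π.map unordered) := by
  have := h.prob
  have : IsProbabilityMeasure (π.map (unordered (D := D))) :=
    Measure.isProbabilityMeasure_map measurable_unordered.aemeasurable
  refine positivelyAssociated_of_lintegral fun f g hf hg hfm hgm => ?_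
  have hm : ∀ {f : Measure D × (Measure D)ᵒᵈ → ℝ≥0}, Measurable f →
      MultisetMeasurable fun M => f (multisetConfig M) := fun hf n =>
    hf.comp (((multisetMeasurable_multisetPart red) n).prodMk
      ((multisetMeasurable_multisetPart blue) n))
  rw [lintegral_map hf.coe_nnreal_ennreal measurable_unordered,
    lintegral_map hg.coe_nnreal_ennreal measurable_unordered,
    lintegral_map (f := fun ξ => (f ξ : ℝ≥0∞) * g ξ)
      (hf.coe_nnreal_ennreal.mul hg.coe_nnreal_ennreal) measurable_unordered]
  simp_rw [unordered_eq]
  exact h.lintegral_mul_le hmu red (hm hf) (hm hg) (colorMonotone_comp_multisetConfig hfm)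
    (colorMonotone_comp_multisetConfig hgm)

theorem IsNormalizedProductForm.positivelyAssociated_colorPart (hmu : 0 < mu)
    (h : IsNormalizedProductForm lam mu π K) (c : Color) :
    PositivelyAssociated (countingMeasures D) (π.map (colorPart c)) := by
  have := h.prob
  have hc := measurable_colorPart (D := D) c
  have : IsProbabilityMeasure (π.map (colorPart c)) :=
    Measure.isProbabilityMeasure_map hc.aemeasurable
  refine positivelyAssociated_of_lintegral fun f g hf hg hfm hgm => ?_
  rw [lintegral_map hf.coe_nnreal_ennreal hc, lintegral_map hg.coe_nnreal_ennreal hc,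
    lintegral_map (f := fun ξ => (f ξ : ℝ≥0∞) * g ξ)
      (hf.coe_nnreal_ennreal.mul hg.coe_nnreal_ennreal) hc]
  simp_rw [colorPart_eq]
  exact h.lintegral_mul_le hmu c (fun n => hf.comp (multisetMeasurable_multisetPart c n))
    (fun n => hg.comp (multisetMeasurable_multisetPart c n))
    (colorMonotone_comp_multisetPart hfm) (colorMonotone_comp_multisetPart hgm)

lemma colorPart_apply {D : Type*} [MeasurableSpace D] (c : Color) (γ : Config D) {B : Set D}
    (hB : MeasurableSet B) :
    colorPart c γ B = countIn {p | p.2 = c ∧ p.1 ∈ B} (toMultiset γ) := by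
  classical
  rw [colorPart_eq, multisetPart_apply c _ hB, countIn]
  congr!

theorem IsNormalizedProductForm.weaklySuperPoissonian_colorPart (hmu : 0 < mu)
    (h : IsNormalizedProductForm lam mu π K) (c : Color) :
    WeaklySuperPoissonian (π.map (colorPart c)) := by
  have hc := measurable_colorPart (D := D) c
  have hmean : ∀ {B : Set D}, MeasurableSet B → ∫⁻ ν, ν B ∂(π.map (colorPart c)) =
      ∫⁻ γ, (countIn {p | p.2 = c ∧ p.1 ∈ B} (toMultiset γ) : ℝ≥0) ∂π := by
    intro B hB
    rw [lintegral_map (Measure.measurable_coe hB) hc]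
    simp_rw [colorPart_apply c _ hB]
    rfl
  have hfin : ∀ {B : Set D}, MeasurableSet B → ∫⁻ ν, ν B ∂(π.map (colorPart c)) < ∞ := by
    intro B hB
    rw [hmean hB]
    refine lt_of_le_of_lt (lintegral_mono fun γ => ?_) (h.lintegral_length_lt_top hmu)
    have h1 : countIn {p | p.2 = c ∧ p.1 ∈ B} (toMultiset γ) ≤ γ.1 := by
      refine (countIn_le_card _ _).trans ?_
      simp [toMultiset]
    rw [ENNReal.coe_natCast]
    exact Nat.cast_le.2 h1
  refine ⟨hfin MeasurableSet.univ, fun k B hB _ => ?_, fun B hB => ?_⟩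
  · have h1 := h.prod_lintegral_le hmu c (F := fun i M => (multisetPart c M (B i)).toNNReal)
      (fun i n => (measurable_toNNReal_apply (hB i)).comp (multisetMeasurable_multisetPart c n))
      (fun i => colorMonotone_comp_multisetPart (monotoneOn_toNNReal_apply (B i))) Finset.univ
    have h2 : ∀ (γ : Config D) i,
        ((multisetPart c (toMultiset γ) (B i)).toNNReal : ℝ≥0∞) = colorPart c γ (B i) := by
      intro γ i
      rw [colorPart_eq, ENNReal.coe_toNNReal (countingMeasures_apply_ne_top
        (multisetPart_mem_countingMeasures c _) _)]
    simp_rw [h2] at h1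
    rw [lintegral_map (Finset.measurable_fun_prod _ fun i _ => Measure.measurable_coe (hB i)) hc]
    simp_rw [fun i => lintegral_map (μ := π) (Measure.measurable_coe (hB i)) hc]
    exact h1
  · have h1 := h.exp_neg_le_void hmu (measurableSet_colored c hB) (c := c) (fun a ha => ha.1)
      (by rw [← hmean hB]; exact (hfin hB).ne)
    rw [← hmean hB] at h1
    have h2 : MeasurableSet {ν : Measure D | ν B = 0} :=
      Measure.measurable_coe hB (measurableSet_singleton 0)
    rw [Measure.map_apply hc h2]
    refine h1.trans (measure_mono fun γ hγ => ?_)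
    change colorPart c γ B = 0
    rw [colorPart_apply c γ hB, show countIn _ (toMultiset γ) = 0 from hγ, Nat.cast_zero]

lemma IsStationaryMatchingProcess.exists_isNormalizedProductForm (hmu : 0 < mu) {Ω : Type*}
    [mΩ : MeasurableSpace Ω] {P : Measure Ω} [IsProbabilityMeasure P] {ℱ : Filtration ℝ≥0 mΩ}
    {η : ℝ≥0 → Ω → Config D} (h : IsStationaryMatchingProcess lam mu P ℱ η) (t : ℝ≥0) :
    ∃ K : ℝ≥0, IsNormalizedProductForm lam mu (P.map (η t)) K := by
  obtain ⟨K, hK, e⟩ := h.map_eq hmu t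
  exact ⟨K, hK, e, Measure.isProbabilityMeasure_map (h.measurable_at t).aemeasurable⟩

end StationaryLaw

end

end FIFM

end

open Classical in
theorem mainTheorem3 {D : Type*} [MetricSpace D] [CompactSpace D] [MeasurableSpace D]
    [BorelSpace D] (lam : Measure D) [IsFiniteMeasure lam] (mu : ℝ) (hmu : 0 < mu) :
    (∀ ξ γ : Finset (FIFM.Particle D),
      FIFM.piTildeSet lam mu (FIFM.join ξ γ) * FIFM.piTildeSet lam mu (FIFM.meet ξ γ) ≥
        FIFM.piTildeSet lam mu ξ * FIFM.piTildeSet lam mu γ) ∧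
    (∀ {Ω : Type*} [mΩ : MeasurableSpace Ω] (P : Measure Ω) [IsProbabilityMeasure P]
      (ℱ : Filtration ℝ≥0 mΩ) (η : ℝ≥0 → Ω → FIFM.Config D),
      FIFM.IsStationaryMatchingProcess lam mu P ℱ η → ∀ t : ℝ≥0,
        (∃ K : ℝ, 0 < K ∧
          FIFM.HasJanossyDensity (P.map fun ω => FIFM.unordered (η t ω)) (FIFM.lamBar lam)
            (fun _ x => K * (if FIFM.Valid x then 1 else 0) * FIFM.piTilde lam mu x)) ∧
        FIFM.PositivelyAssociated (FIFM.configurations D)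
          (P.map fun ω => FIFM.unordered (η t ω)) ∧
        (∀ c : FIFM.Color,
          FIFM.PositivelyAssociated (FIFM.countingMeasures D)
            (P.map fun ω => FIFM.colorPart c (η t ω)) ∧
          FIFM.WeaklySuperPoissonian (P.map fun ω => FIFM.colorPart c (η t ω)))) := by
  refine ⟨fun ξ γ => FIFM.piTildeSet_join_mul_meet lam hmu ξ γ, ?_⟩
  intro Ω mΩ P _ ℱ η h t
  obtain ⟨K, hK⟩ := h.exists_isNormalizedProductForm hmu t
  have e1 : (P.map fun ω => FIFM.unordered (η t ω)) = (P.map (η t)).map FIFM.unordered :=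
    (Measure.map_map FIFM.measurable_unordered (h.measurable_at t)).symm
  have e2 : ∀ c, (P.map fun ω => FIFM.colorPart c (η t ω)) =
      (P.map (η t)).map (FIFM.colorPart c) := fun c =>
    (Measure.map_map (FIFM.measurable_colorPart c) (h.measurable_at t)).symm
  simp only [e1, e2]
  exact ⟨⟨K, hK.pos, hK.hasJanossyDensity hmu⟩, hK.positivelyAssociated_unordered hmu, fun c =>
    ⟨hK.positivelyAssociated_colorPart hmu c, hK.weaklySuperPoissonian_colorPart hmu c⟩⟩
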